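/- Let $n\ge 5$ be an integer with $\gcd(n,6)=1$, and let $m_0,m_1,m_2,m_3,n_0,n_1,n_2$ be integers in $\{1,\dots,n-1\}$ with $m_0+m_1+m_2+m_3=n$ and $n_0+n_1+n_2=n$, such that all $m_j$, all $n_i$, and $m_0+m_3$, $m_1+m_3$, $m_2+m_3$ are prime to $n$. On $\mathbb P^1\times\mathbb P^1$ over $\mathbb C$, with homogeneous coordinates $((x_0:x_1),(y_0:y_1))$, let $\Sigma$ be the normal $(\mathbb Z/n)^2$-covering given by $$z^n=y_0^{m_0}y_1^{m_1}(y_1-y_0)^{m_2}(x_0y_1-x_1y_0)^{m_3}x_0^{\,n-m_3},\qquad w^n=x_0^{n_0}x_1^{n_1}(x_1-x_0)^{n_2},$$ that is, the normalization of $\mathbb P^1\times\mathbb P^1$ in the covering defined by these equations, on which $(a,b)\in(\mathbb Z/n)^2$ acts by $z\mapsto e^{2\pi i a/n}z$, $w\mapsto e^{2\pi i b/n}w$. Let $\pi:Z\to\mathbb P^1\times\mathbb P^1$ be the blow-up of the three points $P_0=\{x_0=y_0=0\}$, $P_1=\{x_1=y_1=0\}$, $P_2=\{x_0-x_1=y_0-y_1=0\}$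 (so $Z$ is a del Pezzo surface of degree $5$), and let $S$ be the normalization of $\Sigma\times_{\mathbb P^1\times\mathbb P^1}Z$, with its induced $(\mathbb Z/n)^2$-action and its covering $S\to Z$. Then $S$ is a smooth irreducible surface over $\mathbb C$. The branch locus $\mathscr B\subset Z$ of $S\to Z$ (the set of points over no neighbourhood of which it is étale) is the inverse image under $\pi$ of the union of the seven curves $x_0=0$, $x_1=0$, $x_1=x_0$, $y_0=0$, $y_1=0$, $y_1=y_0$, $x_0y_1=x_1y_0$; and for each irreducible component $D$ of $\mathscr B$ the local monodromy around $D$ (the element of $(\mathbb Z/n)^2$ which generates the inertia group $I$ at the generic points of $S$ over $D$ and multiplies a local parameter there by $e^{2\pi i/|I|}$) is well defined and has order $n$ in $(\mathbb Z/n)^2$. -/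

import Mathlib

open CategoryTheory CategoryTheory.Limits AlgebraicGeometry

noncomputable section

namespace AbelianCover

attribute [local instance] MvPolynomial.gradedAlgebra

/-! ### The projective line and `ℙ¹ × ℙ¹` over the complex numbers -/

/-- The grading by degree of `ℂ[x₀, x₁]`. -/
abbrev grading : ℕ → Submodule ℂ (MvPolynomial (Fin 2) ℂ) :=
  MvPolynomial.homogeneousSubmodule (Fin 2) ℂ

/-- The complex projective line `Proj ℂ[x₀, x₁]`. -/
abbrev P1 : Scheme.{0} := Proj grading

/-- The base `Spec ℂ`. -/
abbrev pt : Scheme.{0} := Spec (CommRingCat.of ℂ)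

/-- The structure morphism of the projective line. -/
def P1.toPt : P1 ⟶ pt :=
  Proj.toSpecZero grading ≫ Spec.map (CommRingCat.ofHom (algebraMap ℂ (grading 0)))

instance : IsSeparated P1.toPt := by
  have h : IsSeparated (P1.toPt ≫ terminal.from pt) := by
    rw [terminal.comp_from]
    infer_instance
  exact IsSeparated.of_comp P1.toPt (terminal.from pt)

/-- The surface `ℙ¹ × ℙ¹`. The first factor has homogeneous coordinates `(x₀ : x₁)`, the second
one `(y₀ : y₁)`. -/
abbrev P1xP1 : Scheme.{0} := pullback P1.toPt P1.toPt

/-- The first projection. -/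
abbrev pr₁ : P1xP1 ⟶ P1 := pullback.fst P1.toPt P1.toPt

/-- The second projection. -/
abbrev pr₂ : P1xP1 ⟶ P1 := pullback.snd P1.toPt P1.toPt

/-- The structure morphism of `ℙ¹ × ℙ¹`. -/
def P1xP1.toPt : P1xP1 ⟶ pt := pr₁ ≫ P1.toPt

instance : IsSeparated P1xP1.toPt := by
  unfold P1xP1.toPt
  infer_instance

/-- The linear forms `x₀`, `x₁`, `x₁ - x₀`, which vanish at `∞`, `0`, `1` respectively, where
the affine coordinate is `x = x₁ / x₀`. -/
def linForm : Fin 3 → MvPolynomial (Fin 2) ℂ :=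
  ![MvPolynomial.X 0, MvPolynomial.X 1, MvPolynomial.X 1 - MvPolynomial.X 0]

/-- The points `∞`, `0`, `1` of the projective line, as closed subsets. -/
def mark (i : Fin 3) : Set P1 := ((Proj.basicOpen grading (linForm i) : P1.Opens) : Set P1)ᶜ

lemma isClosed_mark (i : Fin 3) : IsClosed (mark i) :=
  (Proj.basicOpen grading (linForm i)).isOpen.isClosed_compl

/-- The point `P₀ = (∞, ∞)`, `P₁ = (0, 0)` or `P₂ = (1, 1)`, as a closed subset. -/
def diagMark (i : Fin 3) : Set P1xP1 := pr₁ ⁻¹' mark i ∩ pr₂ ⁻¹' mark i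

lemma isClosed_diagMark (i : Fin 3) : IsClosed (diagMark i) :=
  ((isClosed_mark i).preimage pr₁.continuous).inter ((isClosed_mark i).preimage pr₂.continuous)

/-- The ideal sheaf of the reduced closed subscheme `{P₀, P₁, P₂}` of `ℙ¹ × ℙ¹`. -/
def centre : P1xP1.IdealSheafData :=
  Scheme.IdealSheafData.vanishingIdeal ⟨⋃ i, diagMark i, isClosed_iUnion_of_finite isClosed_diagMark⟩

/-- The union of the seven curves `x = ∞, 0, 1`, `y = ∞, 0, 1` and the diagonal `Δ` in
`ℙ¹ × ℙ¹`. -/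
def branchCurves : Set P1xP1 :=
  (⋃ i, pr₁ ⁻¹' mark i) ∪ (⋃ i, pr₂ ⁻¹' mark i) ∪ Set.range (pullback.diagonal P1.toPt)

/-! ### Blow-ups -/

/-- An ideal sheaf is invertible (its subscheme is an effective Cartier divisor) if it is locally
generated by one non-zero-divisor. -/
def IsInvertibleIdeal {X : Scheme.{0}} (I : X.IdealSheafData) : Prop :=
  ∀ x : X, ∃ U : X.affineOpens, x ∈ U.1 ∧ ∃ s ∈ nonZeroDivisors Γ(X, U.1), I.ideal U = Ideal.span {s}

/-- `π : Z ⟶ X` is the blow-up of `X` along the ideal sheaf `I`: the inverse image ideal sheaf of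
`I` on `Z` is invertible, and `π` is universal with this property. -/
structure IsBlowup {Z X : Scheme.{0}} (π : Z ⟶ X) (I : X.IdealSheafData) : Prop where
  invertible : IsInvertibleIdeal (I.comap π)
  universal : ∀ {W : Scheme.{0}} (g : W ⟶ X), IsInvertibleIdeal (I.comap g) →
    ∃! h : W ⟶ Z, h ≫ π = g

/-! ### The étale Kummer cover of the complement of the seven curves -/

/-- The polynomial `x (x - 1) y (y - 1) (y - x)`. -/
def disc : MvPolynomial (Fin 2) ℂ :=
  MvPolynomial.X 0 * (MvPolynomial.X 0 - 1) * MvPolynomial.X 1 * (MvPolynomial.X 1 - 1) *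
    (MvPolynomial.X 1 - MvPolynomial.X 0)

/-- The coordinate ring `ℂ[x, y][1 / (x (x - 1) y (y - 1) (y - x))]` of the complement of the
seven curves in `ℙ¹ × ℙ¹`. -/
abbrev R : Type := Localization.Away disc

/-- The affine coordinate `x = x₁ / x₀`. -/
def xc : R := algebraMap (MvPolynomial (Fin 2) ℂ) R (MvPolynomial.X 0)

/-- The affine coordinate `y = y₁ / y₀`. -/
def yc : R := algebraMap (MvPolynomial (Fin 2) ℂ) R (MvPolynomial.X 1)

/-- The form `y₀ ^ m₀ y₁ ^ m₁ (y₁ - y₀) ^ m₂ (x₀ y₁ - x₁ y₀) ^ m₃ x₀ ^ (n - m₃)`. -/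
def formZ {A : Type} [CommRing A] (n : ℕ) (m : Fin 4 → ℕ) (x₀ x₁ y₀ y₁ : A) : A :=
  y₀ ^ m 0 * y₁ ^ m 1 * (y₁ - y₀) ^ m 2 * (x₀ * y₁ - x₁ * y₀) ^ m 3 * x₀ ^ (n - m 3)

/-- The form `x₀ ^ n₀ x₁ ^ n₁ (x₁ - x₀) ^ n₂`. -/
def formW {A : Type} [CommRing A] (k : Fin 3 → ℕ) (x₀ x₁ : A) : A :=
  x₀ ^ k 0 * x₁ ^ k 1 * (x₁ - x₀) ^ k 2

/-- The cyclic extension `A[t] / (t ^ n - f)`. -/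
abbrev Cyc (A : Type) [CommRing A] (n : ℕ) (f : A) : Type :=
  AdjoinRoot (Polynomial.X ^ n - Polynomial.C f : Polynomial A)

/-- The `(ℤ/n)²`-extension `R[z, w] / (z ^ n - f, w ^ n - g)`, where `f` and `g` are the two forms
above in the affine coordinates given by `x₀ = y₀ = 1`. -/
abbrev Kummer (n : ℕ) (m : Fin 4 → ℕ) (k : Fin 3 → ℕ) : Type :=
  TensorProduct R (Cyc R n (formZ n m 1 xc 1 yc)) (Cyc R n (formW k 1 xc))

/-- The ring homomorphism `(ℂ[x₀, x₁][1 / x₀])₀ → A` with `x₁ / x₀ ↦ a`. -/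
def affHom {A : Type} [CommRing A] [Algebra ℂ A] (a : A) :
    HomogeneousLocalization.Away grading (MvPolynomial.X 0) →+* A :=
  (IsLocalization.Away.lift (S := Localization.Away (MvPolynomial.X 0 : MvPolynomial (Fin 2) ℂ))
    (MvPolynomial.X 0 : MvPolynomial (Fin 2) ℂ)
    (g := (MvPolynomial.aeval ![1, a] : MvPolynomial (Fin 2) ℂ →ₐ[ℂ] A).toRingHom)
    (by simp)).comp
  (algebraMap (HomogeneousLocalization.Away grading (MvPolynomial.X 0))
    (Localization.Away (MvPolynomial.X 0 : MvPolynomial (Fin 2) ℂ)))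

/-- The morphism `Spec A ⟶ ℙ¹` with homogeneous coordinates `(1 : a)`. -/
def affPoint {A : Type} [CommRing A] [Algebra ℂ A] (a : A) : Spec (CommRingCat.of A) ⟶ P1 :=
  Spec.map (CommRingCat.ofHom (affHom a)) ≫
    Proj.awayι grading (MvPolynomial.X 0)
      ((MvPolynomial.mem_homogeneousSubmodule 1 _).mpr (MvPolynomial.isHomogeneous_X ℂ 0)) Nat.one_pos

lemma affPoint_toPt {A : Type} [CommRing A] [Algebra ℂ A] (a : A) :
    affPoint a ≫ P1.toPt = Spec.map (CommRingCat.ofHom (algebraMap ℂ A)) := by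
  rw [affPoint, P1.toPt, Category.assoc, Proj.awayι_toSpecZero_assoc, ← Spec.map_comp,
    ← Spec.map_comp, ← CommRingCat.ofHom_comp, ← CommRingCat.ofHom_comp]
  congr 2
  ext c
  have h : (HomogeneousLocalization.fromZeroRingHom grading
      (Submonoid.powers (MvPolynomial.X 0)) (algebraMap ℂ (grading 0) c)).val =
      algebraMap (MvPolynomial (Fin 2) ℂ) _ (MvPolynomial.C c) := by
    rw [← Localization.mk_one_eq_algebraMap]
    rfl
  simp only [affHom, RingHom.comp_apply, HomogeneousLocalization.algebraMap_apply]
  rw [h, IsLocalization.Away.lift_eq]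
  simp

/-- The inclusion of the complement of the seven curves in `ℙ¹ × ℙ¹`. -/
def chart : Spec (CommRingCat.of R) ⟶ P1xP1 :=
  pullback.lift (affPoint xc) (affPoint yc) (by rw [affPoint_toPt, affPoint_toPt])

variable (n : ℕ) (m : Fin 4 → ℕ) (k : Fin 3 → ℕ)

/-- The étale cover of the complement of the seven curves defined by the two equations
`z ^ n = y₀ ^ m₀ y₁ ^ m₁ (y₁ - y₀) ^ m₂ (x₀ y₁ - x₁ y₀) ^ m₃ x₀ ^ (n - m₃)` and
`w ^ n = x₀ ^ n₀ x₁ ^ n₁ (x₁ - x₀) ^ n₂`. -/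
abbrev V : Scheme.{0} := Spec (CommRingCat.of (Kummer n m k))

/-- The morphism from the étale cover to `ℙ¹ × ℙ¹`. -/
def V.toP1xP1 : V n m k ⟶ P1xP1 :=
  Spec.map (CommRingCat.ofHom (algebraMap R (Kummer n m k))) ≫ chart

instance : IsAffineHom (V.toP1xP1 n m k) := by
  have h : IsAffineHom (V.toP1xP1 n m k ≫ P1xP1.toPt) := inferInstance
  exact IsAffineHom.of_comp (V.toP1xP1 n m k) P1xP1.toPt

/-- The primitive `n`-th root of unity `exp (2 π i / n)`. -/
def zeta : ℂ := Complex.exp (2 * Real.pi * Complex.I / n)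

lemma zeta_pow : zeta n ^ n = 1 := by
  rcases eq_or_ne n 0 with rfl | h
  · simp
  · exact (Complex.isPrimitiveRoot_exp n h).pow_eq_one

/-- The automorphism of `A[t] / (t ^ n - f)` over `A` with `t ↦ exp (2 π i a / n) t`. -/
def cycAct {A : Type} [CommRing A] [Algebra ℂ A] (f : A) (a : ZMod n) : Cyc A n f →ₐ[A] Cyc A n f :=
  AdjoinRoot.liftAlgHom _ (Algebra.ofId A _)
    (algebraMap ℂ (Cyc A n f) (zeta n ^ a.val) * AdjoinRoot.root _) (by
      have h := AdjoinRoot.eval₂_root (Polynomial.X ^ n - Polynomial.C f : Polynomial A)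
      change Polynomial.eval₂ (algebraMap A (Cyc A n f)) _ _ = 0
      simp only [Polynomial.eval₂_sub, Polynomial.eval₂_pow, Polynomial.eval₂_X,
        Polynomial.eval₂_C] at h ⊢
      rw [mul_pow, ← map_pow, ← pow_mul, mul_comm a.val, pow_mul, zeta_pow, one_pow, map_one,
        one_mul]
      exact h)

/-- The action of `(a, b)` on the étale cover: as an automorphism of functions,
`z ↦ exp (2 π i a / n) z` and `w ↦ exp (2 π i b / n) w`. -/
def actV (g : ZMod n × ZMod n) : V n m k ⟶ V n m k :=
  Spec.map (CommRingCat.ofHom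
    (Algebra.TensorProduct.map (cycAct n (formZ n m 1 xc 1 yc) g.1)
      (cycAct n (formW k 1 xc) g.2)).toRingHom)

lemma actV_comp (g : ZMod n × ZMod n) : actV n m k g ≫ V.toP1xP1 n m k = V.toP1xP1 n m k := by
  rw [actV, V.toP1xP1, ← Category.assoc, ← Spec.map_comp, ← CommRingCat.ofHom_comp]
  congr 3
  exact (Algebra.TensorProduct.map (cycAct n (formZ n m 1 xc 1 yc) g.1)
    (cycAct n (formW k 1 xc) g.2)).comp_algebraMap

/-! ### Normalization -/

/-- Functoriality of the relative normalization: a commutative square from `f : X ⟶ Y` to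
`f' : X' ⟶ Y'` induces a morphism between the normalization of `Y` in `X` and the
normalization of `Y'` in `X'`. -/
def normalizationMap {X Y X' Y' : Scheme.{0}} (f : X ⟶ Y) (f' : X' ⟶ Y') [QuasiCompact f]
    [QuasiSeparated f] [QuasiCompact f'] [QuasiSeparated f'] (u : X ⟶ X') (v : Y ⟶ Y')
    (h : f ≫ v = u ≫ f') : f.normalization ⟶ f'.normalization :=
  f.normalizationDesc (pullback.lift (u ≫ f'.toNormalization) f
    (by rw [Category.assoc, Scheme.Hom.toNormalization_fromNormalization, h]))
    (pullback.snd f'.fromNormalization v) (pullback.lift_snd _ _ _).symm ≫ pullback.fst f'.fromNormalization v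

lemma toNormalization_normalizationMap {X Y X' Y' : Scheme.{0}} (f : X ⟶ Y) (f' : X' ⟶ Y')
    [QuasiCompact f] [QuasiSeparated f] [QuasiCompact f'] [QuasiSeparated f'] (u : X ⟶ X')
    (v : Y ⟶ Y') (h : f ≫ v = u ≫ f') :
    f.toNormalization ≫ normalizationMap f f' u v h = u ≫ f'.toNormalization := by
  rw [normalizationMap, Scheme.Hom.toNormalization_normalizationDesc_assoc, pullback.lift_fst]

lemma normalizationMap_fromNormalization {X Y X' Y' : Scheme.{0}} (f : X ⟶ Y) (f' : X' ⟶ Y')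
    [QuasiCompact f] [QuasiSeparated f] [QuasiCompact f'] [QuasiSeparated f'] (u : X ⟶ X')
    (v : Y ⟶ Y') (h : f ≫ v = u ≫ f') :
    normalizationMap f f' u v h ≫ f'.fromNormalization = f.fromNormalization ≫ v := by
  rw [normalizationMap, Category.assoc, pullback.condition,
    Scheme.Hom.normalizationDesc_comp_assoc]

/-- The surface `Σ`: the normalization of `ℙ¹ × ℙ¹` in the étale cover `V`. -/
def Sig : Scheme.{0} := (V.toP1xP1 n m k).normalization

/-- The covering `Σ ⟶ ℙ¹ × ℙ¹`. -/
def Sig.toP1xP1 : Sig n m k ⟶ P1xP1 := (V.toP1xP1 n m k).fromNormalization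

/-- The inclusion of `V` in `Σ`. -/
def V.toSig : V n m k ⟶ Sig n m k := (V.toP1xP1 n m k).toNormalization

instance : QuasiCompact (V.toSig n m k) := by
  exact inferInstanceAs (QuasiCompact (V.toP1xP1 n m k).toNormalization)

instance : QuasiSeparated (V.toSig n m k) := by
  exact inferInstanceAs (QuasiSeparated (V.toP1xP1 n m k).toNormalization)

/-- The action of `(ℤ/n)²` on `Σ`. -/
def actSig (g : ZMod n × ZMod n) : Sig n m k ⟶ Sig n m k :=
  normalizationMap (V.toP1xP1 n m k) (V.toP1xP1 n m k) (actV n m k g) (𝟙 _)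
    (by rw [actV_comp, Category.comp_id])

lemma toSig_actSig (g : ZMod n × ZMod n) :
    V.toSig n m k ≫ actSig n m k g = actV n m k g ≫ V.toSig n m k :=
  toNormalization_normalizationMap ..

lemma actSig_comp (g : ZMod n × ZMod n) :
    actSig n m k g ≫ Sig.toP1xP1 n m k = Sig.toP1xP1 n m k :=
  (normalizationMap_fromNormalization ..).trans (Category.comp_id _)

variable {Z : Scheme.{0}} (π : Z ⟶ P1xP1)

/-- The fibre product of `Σ` and `Z` over `ℙ¹ × ℙ¹`. -/
abbrev SigZ : Scheme.{0} := pullback (Sig.toP1xP1 n m k) π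

/-- The inclusion in `Σ ×_{ℙ¹ × ℙ¹} Z` of the inverse image of `V ⊆ Σ`. -/
abbrev VZ.toSigZ : pullback (V.toSig n m k) (pullback.fst (Sig.toP1xP1 n m k) π) ⟶ SigZ n m k π :=
  pullback.snd (V.toSig n m k) (pullback.fst (Sig.toP1xP1 n m k) π)

/-- The surface `S`: the normalization of `Σ ×_{ℙ¹ × ℙ¹} Z`. -/
def S : Scheme.{0} := (VZ.toSigZ n m k π).normalization

/-- The covering `S ⟶ Z`. -/
def S.toZ : S n m k π ⟶ Z :=
  (VZ.toSigZ n m k π).fromNormalization ≫ pullback.snd (Sig.toP1xP1 n m k) π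

/-- The structure morphism of `S`. -/
def S.toPt : S n m k π ⟶ pt := S.toZ n m k π ≫ π ≫ P1xP1.toPt

/-- The action of `(ℤ/n)²` on `Σ ×_{ℙ¹ × ℙ¹} Z`. -/
def actSigZ (g : ZMod n × ZMod n) : SigZ n m k π ⟶ SigZ n m k π :=
  pullback.map _ _ _ _ (actSig n m k g) (𝟙 Z) (𝟙 P1xP1)
    (by rw [actSig_comp, Category.comp_id]) (by rw [Category.comp_id, Category.id_comp])

/-- The action of `(ℤ/n)²` on `S`. -/
def actS (g : ZMod n × ZMod n) : S n m k π ⟶ S n m k π :=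
  normalizationMap (VZ.toSigZ n m k π) (VZ.toSigZ n m k π)
    (pullback.map _ _ _ _ (actV n m k g) (actSigZ n m k π g) (actSig n m k g)
      (toSig_actSig n m k g) (pullback.lift_fst _ _ _).symm)
    (actSigZ n m k π g) (pullback.lift_snd _ _ _).symm

/-! ### Branch locus and local monodromy -/

/-- The branch locus of `φ : X ⟶ Y`: the points of `Y` over no neighbourhood of which `φ` is
étale. -/
def branchLocus {X Y : Scheme.{0}} (φ : X ⟶ Y) : Set Y :=
  {y | ¬ ∃ U : Y.Opens, y ∈ U ∧ Etale (φ ∣_ U)}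

/-- The inertia set of a family of endomorphisms `act` of `X` at a point `x`: the `g` such that
`act g` fixes `x` and induces the identity on its residue field. -/
def inertia {G : Type} {X : Scheme.{0}} (act : G → (X ⟶ X)) (x : X) : Set G :=
  {g | X.fromSpecResidueField x ≫ act g = X.fromSpecResidueField x}

/-- The endomorphism of the local ring of `X` at `x` induced by an endomorphism of `X` that
fixes `x`. -/
def stalkEnd {X : Scheme.{0}} (σ : X ⟶ X) (x : X) (h : σ x = x) :
    X.presheaf.stalk x →+* X.presheaf.stalk x :=
  (X.presheaf.stalkSpecializes (specializes_of_eq h) ≫ σ.stalkMap x).hom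

/-- The complex constants in the local ring of a scheme over `Spec ℂ`. -/
def stalkConst {X : Scheme.{0}} (s : X ⟶ pt) (x : X) : ℂ →+* X.presheaf.stalk x :=
  ((Scheme.ΓSpecIso (CommRingCat.of ℂ)).inv ≫ s.appTop ≫ X.presheaf.germ ⊤ x trivial).hom

/-- `g` is the distinguished generator of the inertia group at `x`: it lies in the inertia group
`I` and acts on the cotangent space of `X` at `x` as multiplication by `exp (2 π i / |I|)`. When
`x` is the generic point of a divisor over a branch divisor `D` of a Galois covering,
`g` is the deck transformation given by a small positive loop around `D`. -/
def IsInertiaGenerator {G : Type} {X : Scheme.{0}} (s : X ⟶ pt) (act : G → (X ⟶ X)) (x : X)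
    (g : G) : Prop :=
  g ∈ inertia act x ∧ ∃ h : act g x = x, ∀ t ∈ IsLocalRing.maximalIdeal (X.presheaf.stalk x),
    stalkEnd (act g) x h t - stalkConst s x (zeta (Nat.card (inertia act x))) * t ∈
      IsLocalRing.maximalIdeal (X.presheaf.stalk x) ^ 2

/-- `g ∈ (ℤ/n)²` is a local monodromy of `S ⟶ Z` around the closure of the point `η` of `Z`. -/
def IsLocalMonodromy (η : Z) (g : ZMod n × ZMod n) : Prop :=
  ∃ ξ : S n m k π, S.toZ n m k π ξ = η ∧ IsInertiaGenerator (S.toPt n m k π) (actS n m k π) ξ g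

end AbelianCover

end

/-! ### Relative normalization over an affine open subscheme -/

open CategoryTheory CategoryTheory.Limits AlgebraicGeometry
noncomputable section
namespace AbelianCover

/-! Everything follows from a normal form near each point of `Z`. By `hasCorner`, each point has a
neighbourhood `Spec B`, with `B = ℂ[s, t]_h` and `h(0) ≠ 0`, on which the inverse image of the seven
curves is `s t = 0` and the two functions whose roots are `z`, `w` have the form `c ^ n u s ^ a t ^
b` and `c' ^ n v s ^ d t ^ e`. Here `u`, `v` are units of `B`, `c`, `c'` are units on the complement
of the curves, and `a e - b d` is prime to `n`.

To see this, note that the degrees of both forms in the `x`- and in the `y`-coordinates are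
divisible by `n` (for the first form, because of the factor `x₀ ^ (n - m₃)`). Hence a permutation of
the three marked points, applied to both factors of `ℙ¹ × ℙ¹`, changes the forms only by `n`-th
powers and signs, and few charts remain. Where `x = xᵢ` meets `y = yⱼ` with `i ≠ j`, the determinant
is `mⱼ kᵢ` up to sign. Where the exceptional curve over `Pᵢ` meets the strict transforms of `x =
xᵢ`, of `y = yᵢ` and of the diagonal, it is `(mᵢ + m₃) kᵢ`, `mᵢ kᵢ` and `m₃ kᵢ` up to sign. These
are the places where the coprimality hypotheses enter. As `Z` is known only by its universal
property, its affine charts are first derived from that property (`IsBlowup.exists_chart`,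
`IsBlowup.mem_range_chart_or`).

Since the matrix of exponents is invertible modulo `n`, the ring `K` of the étale cover contains
monomials `p`, `q` in `z`, `w` and units with `p ^ n`, `q ^ n` equal to `s`, `t` up to units of `B`,
and they generate `K` (`exists_roots`). In `C = B[p, q]` both `p` and `q` are prime, so `C` is
integrally closed in `K = C[1 / (p q)]` and is the integral closure of `B`
(`IsBikummer.mem_range_of_isIntegral`). Therefore `Spec C` is the part of `S` over `Spec B`
(`exists_isPullback_S`).

The theorem can now be read off from `C`. It is a domain and smooth of dimension two
(`IsBikummer.formallySmooth`, `smoothOfRelativeDimension_two`), and the covering ramifies exactly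
where `s t = 0` (`IsBikummer.etale`, `IsBikummer.not_formallyUnramified`). The group acts on `p` and
`q` by two characters which together form an automorphism `χ` of `(ℤ/n)²`. The only prime over `(s)`
is `(p)`; its inertia group is the kernel of the second coordinate of `χ`, and the local monodromy
is the element with coordinates `(1, 0)`, which has order `n` (`LocalChart.isLocalMonodromy_iff`).
-/

lemma specMap_epi_of_injective {C K : CommRingCat.{0}} (ψ : C ⟶ K)
    (hψ : Function.Injective ψ.hom) {T : Scheme.{0}} [IsAffine T] (h h' : Spec C ⟶ T)
    (e : Spec.map ψ ≫ h = Spec.map ψ ≫ h') : h = h' := by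
  rw [← cancel_mono T.isoSpec.hom]
  obtain ⟨a, ha⟩ := Spec.map_surjective (h ≫ T.isoSpec.hom)
  obtain ⟨a', ha'⟩ := Spec.map_surjective (h' ≫ T.isoSpec.hom)
  rw [← ha, ← ha']
  congr 1
  have : Mono ψ := ConcreteCategory.mono_of_injective _ hψ
  rw [← cancel_mono ψ]
  apply Spec.map_injective
  rw [Spec.map_comp, Spec.map_comp, ha, ha', reassoc_of% e]

/-- A scheme integral over an affine one is affine, and the functions on `T` become elements of `K`
integral over `B`, so they come from `C`. Injectivity of `ψ` makes the chosen preimages a ring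
homomorphism. -/
lemma exists_desc_of_integrallyClosedIn {B C K : CommRingCat.{0}} (φ : B ⟶ C) (ψ : C ⟶ K)
    (hψ : Function.Injective ψ.hom)
    (hcl : ∀ x : K, (φ ≫ ψ).hom.IsIntegralElem x → ∃ c, ψ.hom c = x)
    {T : Scheme.{0}} (t : Spec K ⟶ T) (q : T ⟶ Spec B) [IsIntegralHom q]
    (h : t ≫ q = Spec.map (φ ≫ ψ)) :
    ∃ k : Spec C ⟶ T, Spec.map ψ ≫ k = t ∧ k ≫ q = Spec.map φ := by
  have : IsAffine T := isAffine_of_isAffineHom q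
  obtain ⟨a, ha⟩ := Spec.map_surjective (t ≫ T.isoSpec.hom)
  obtain ⟨r, hr⟩ := Spec.map_surjective (T.isoSpec.inv ≫ q)
  have hri : r.hom.IsIntegral := by
    rw [← IsIntegralHom.SpecMap_iff, hr]
    infer_instance
  have hra : r ≫ a = φ ≫ ψ := by
    apply Spec.map_injective
    rw [Spec.map_comp, ha, hr, Category.assoc, Iso.hom_inv_id_assoc, h]
  have hlift : ∀ y, ∃ c, ψ.hom c = a.hom y := fun y ↦ hcl _ (by
    rw [← hra, CommRingCat.hom_comp]
    obtain ⟨p, hp, hpy⟩ := hri y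
    refine ⟨p, hp, ?_⟩
    rw [← Polynomial.hom_eval₂, hpy, map_zero])
  choose c hc using hlift
  let cc : Γ(T, ⊤) →+* C :=
    { toFun := c
      map_one' := hψ (by simp [hc])
      map_mul' := fun x y ↦ hψ (by simp [hc])
      map_zero' := hψ (by simp [hc])
      map_add' := fun x y ↦ hψ (by simp [hc]) }
  have hcc : CommRingCat.ofHom cc ≫ ψ = a := by
    ext y
    exact hc y
  have key : Spec.map ψ ≫ Spec.map (CommRingCat.ofHom cc) ≫ T.isoSpec.inv = t := by
    rw [← Spec.map_comp_assoc, hcc, ha, Category.assoc, Iso.hom_inv_id, Category.comp_id]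
  refine ⟨Spec.map (CommRingCat.ofHom cc) ≫ T.isoSpec.inv, key, ?_⟩
  apply specMap_epi_of_injective ψ hψ
  rw [Category.assoc, reassoc_of% key, h, Spec.map_comp]

/-- Normalization commutes with restriction to an open subscheme, so it suffices to normalize `Spec
B` in `Spec K`. Morphisms to and from `Spec C` come from the universal property of the normalization
and from `exists_desc_of_integrallyClosedIn`. They are inverse to each other because the composites
are determined by their restrictions to `Spec K`. -/
lemma exists_isPullback_normalization {B C K : CommRingCat.{0}} (φ : B ⟶ C) (ψ : C ⟶ K)
    (hφ : φ.hom.IsIntegral) (hψ : Function.Injective ψ.hom)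
    (hcl : ∀ x : K, (φ ≫ ψ).hom.IsIntegralElem x → ∃ c, ψ.hom c = x)
    {Y : Scheme.{0}} (f : Spec K ⟶ Y) [QuasiCompact f] [QuasiSeparated f]
    (b : Spec B ⟶ Y) [IsOpenImmersion b] (hf : f = Spec.map (φ ≫ ψ) ≫ b) :
    ∃ κ : Spec C ⟶ f.normalization, IsPullback κ (Spec.map φ) f.fromNormalization b ∧
      Spec.map ψ ≫ κ = f.toNormalization := by
  have : IsIntegralHom (Spec.map φ) := IsIntegralHom.SpecMap_iff.mpr hφ
  have hl : f.toNormalization ≫ f.fromNormalization = Spec.map (φ ≫ ψ) ≫ b := by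
    rw [Scheme.Hom.toNormalization_fromNormalization, hf]
  obtain ⟨k, hk, hk'⟩ := exists_desc_of_integrallyClosedIn φ ψ hψ hcl
    (pullback.lift f.toNormalization (Spec.map (φ ≫ ψ)) hl)
    (pullback.snd f.fromNormalization b) (pullback.lift_snd _ _ _)
  have hsnd : pullback.snd f b = pullback.fst f b ≫ Spec.map (φ ≫ ψ) := by
    rw [← cancel_mono b, ← pullback.condition, Category.assoc, ← hf]
  let d : (pullback.snd f b).normalization ⟶ Spec C :=
    (pullback.snd f b).normalizationDesc (pullback.fst f b ≫ Spec.map ψ) (Spec.map φ)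
      (by rw [Category.assoc, ← Spec.map_comp, hsnd])
  have hd1 : (pullback.snd f b).toNormalization ≫ d = pullback.fst f b ≫ Spec.map ψ :=
    Scheme.Hom.toNormalization_normalizationDesc ..
  have hd2 : d ≫ Spec.map φ = (pullback.snd f b).fromNormalization :=
    Scheme.Hom.normalizationDesc_comp ..
  let P := f.normalizationPullback b
  have h1 : d ≫ k = P := by
    apply Scheme.Hom.normalization.hom_ext _ _ _ (pullback.snd f.fromNormalization b)
    · rw [reassoc_of% hd1, hk]
      apply pullback.hom_ext
      · rw [Category.assoc, pullback.lift_fst, Category.assoc,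
          Scheme.Hom.toNormalization_normalizationPullback_fst]
      · rw [Category.assoc, pullback.lift_snd, Category.assoc,
          Scheme.Hom.normalizationPullback_snd, Scheme.Hom.toNormalization_fromNormalization, hsnd]
    · rw [Category.assoc, hk', hd2]
    · exact Scheme.Hom.normalizationPullback_snd ..
  -- `f` factors through the monomorphism `b`, so base change along `b` does not change its source.
  have hiso : IsIso (pullback.fst f b) := by
    refine ⟨pullback.lift (𝟙 _) (Spec.map (φ ≫ ψ)) (by rw [Category.id_comp, hf]), ?_, ?_⟩
    · apply pullback.hom_ext
      · rw [Category.assoc, pullback.lift_fst, Category.comp_id, Category.id_comp]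
      · rw [Category.assoc, pullback.lift_snd, hsnd, Category.id_comp]
    · rw [pullback.lift_fst]
  have h2 : k ≫ inv P ≫ d = 𝟙 _ := by
    apply specMap_epi_of_injective ψ hψ
    have : Spec.map ψ ≫ k = inv (pullback.fst f b) ≫ (pullback.snd f b).toNormalization ≫ P := by
      rw [hk, ← h1, reassoc_of% hd1, IsIso.inv_hom_id_assoc, hk]
    rw [reassoc_of% this, IsIso.hom_inv_id_assoc, hd1, IsIso.inv_hom_id_assoc, Category.comp_id]
  have hkiso : IsIso k := ⟨inv P ≫ d, h2, by rw [Category.assoc, h1, IsIso.inv_hom_id]⟩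
  refine ⟨k ≫ pullback.fst _ _, ?_, ?_⟩
  · have := IsPullback.of_hasPullback f.fromNormalization b
    exact IsPullback.of_iso this (asIso k).symm (Iso.refl _) (Iso.refl _) (Iso.refl _)
      (by simp) (by simp [← hk']) (by simp) (by simp)
  · rw [reassoc_of% hk, pullback.lift_fst]

/-! ### Ideal sheaves on affine schemes and invertibility -/

/-- The ideal of `D` corresponding to an ideal sheaf on `Spec D`. -/
def specIdeal {D : CommRingCat.{0}} (J : (Spec D).IdealSheafData) : Ideal D :=
  (J.ideal ⟨⊤, isAffineOpen_top _⟩).map (Scheme.ΓSpecIso D).hom.hom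

lemma ideal_map_iso_inv {A B : CommRingCat.{0}} (e : A ≅ B) (I : Ideal A) :
    I.comap e.inv.hom = I.map e.hom.hom :=
  Ideal.comap_symm e.commRingCatIsoToRingEquiv

/-- `comap` is adjoint to `map`, and between affine schemes `map` is the preimage of ideals, whose
adjoint is extension of ideals. -/
lemma ideal_comap_top_of_isAffine {X Y : Scheme.{0}} [IsAffine X] [IsAffine Y] (f : X ⟶ Y)
    (I : Y.IdealSheafData) :
    (I.comap f).ideal ⟨⊤, isAffineOpen_top _⟩ =
      (I.ideal ⟨⊤, isAffineOpen_top _⟩).map f.appTop.hom := by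
  apply le_antisymm
  · have h : I.comap f ≤ Scheme.IdealSheafData.ofIdealTop
        ((I.ideal ⟨⊤, isAffineOpen_top _⟩).map f.appTop.hom) := by
      rw [← Scheme.IdealSheafData.le_map_iff_comap_le]
      apply Scheme.IdealSheafData.le_of_isAffine
      rw [Scheme.IdealSheafData.ideal_map_of_isAffineHom, ← Ideal.map_le_iff_le_comap]
      simp only [Scheme.IdealSheafData.ofIdealTop_ideal]
      refine le_trans (Ideal.map_id _).ge (Ideal.map_mono (f := RingHom.id _) le_rfl) |>.trans
        (le_of_eq ?_)
      have : (homOfLE (le_top : f ⁻¹ᵁ ⊤ ≤ (⊤ : X.Opens))).op = 𝟙 _ := rfl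
      erw [this, X.presheaf.map_id]
      rfl
    refine (h _).trans (le_of_eq ?_)
    simp only [Scheme.IdealSheafData.ofIdealTop_ideal]
    have : (homOfLE (le_top : (⊤ : X.Opens) ≤ (⊤ : X.Opens))).op = 𝟙 _ := rfl
    rw [this, X.presheaf.map_id]
    exact Ideal.map_id _
  · rw [Ideal.map_le_iff_le_comap]
    have := (Scheme.IdealSheafData.le_map_comap I f) ⟨⊤, isAffineOpen_top _⟩
    rwa [Scheme.IdealSheafData.ideal_map_of_isAffineHom] at this

lemma specIdeal_comap {A D : CommRingCat.{0}} (φ : A ⟶ D) (J : (Spec A).IdealSheafData) :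
    specIdeal (J.comap (Spec.map φ)) = (specIdeal J).map φ.hom := by
  rw [specIdeal, specIdeal, ideal_comap_top_of_isAffine, Ideal.map_map, Ideal.map_map,
    ← CommRingCat.hom_comp, ← CommRingCat.hom_comp, Scheme.ΓSpecIso_naturality]

lemma iso_hom_mem_nonZeroDivisors {A B : CommRingCat.{0}} (e : A ≅ B) {a : A}
    (ha : a ∈ nonZeroDivisors A) : e.hom a ∈ nonZeroDivisors B :=
  (MulEquivClass.map_nonZeroDivisors e.commRingCatIsoToRingEquiv).le
    (Submonoid.mem_map_of_mem _ ha)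

lemma isInvertibleIdeal_top {X : Scheme.{0}} :
    IsInvertibleIdeal (⊤ : X.IdealSheafData) := by
  intro x
  obtain ⟨U, hU, hx, -⟩ := exists_isAffineOpen_mem_and_subset (x := x) (U := ⊤) trivial
  exact ⟨⟨U, hU⟩, hx, 1, one_mem _, Ideal.span_singleton_one.symm⟩

lemma isInvertibleIdeal_of_specIdeal {D : CommRingCat.{0}} (J : (Spec D).IdealSheafData) (d : D)
    (hd : d ∈ nonZeroDivisors D) (h : specIdeal J = Ideal.span {d}) : IsInvertibleIdeal J := by
  intro x
  refine ⟨⟨⊤, isAffineOpen_top _⟩, trivial, (Scheme.ΓSpecIso D).inv d, ?_, ?_⟩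
  · exact iso_hom_mem_nonZeroDivisors (Scheme.ΓSpecIso D).symm hd
  · rw [← Set.image_singleton, ← Ideal.map_span, ← h, specIdeal, Ideal.map_map,
      ← CommRingCat.hom_comp, Iso.hom_inv_id]
    exact (Ideal.map_id _).symm

lemma specIdeal_comap_of_isOpenImmersion {Z : Scheme.{0}} (J : Z.IdealSheafData) {D : CommRingCat.{0}}
    (j : Spec D ⟶ Z) [IsOpenImmersion j] (W : Z.Opens) (hWa : IsAffineOpen W)
    (hW : j.opensRange = W) :
    ∃ e : Γ(Z, W) ≅ D, specIdeal (J.comap j) = (J.ideal ⟨W, hWa⟩).map e.hom.hom ∧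
      Spec.map e.hom ≫ hWa.fromSpec = j := by
  obtain rfl : j ''ᵁ ⊤ = W := by simpa using hW
  refine ⟨j.appIso ⊤ ≪≫ Scheme.ΓSpecIso D, ?_, ?_⟩
  swap
  · rw [Iso.trans_hom, Spec.map_comp, Category.assoc, Scheme.Hom.appIso_hom',
      IsAffineOpen.SpecMap_appLE_fromSpec j _ (isAffineOpen_top _), IsAffineOpen.fromSpec_top,
      Scheme.isoSpec_Spec_inv, ← Spec.map_comp_assoc, Iso.inv_hom_id, Spec.map_id,
      Category.id_comp]
  rw [specIdeal, Scheme.IdealSheafData.ideal_comap_of_isOpenImmersion, ideal_map_iso_inv,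
    Ideal.map_map]
  rfl

/-- This serves to find equations of `centre` in a chart, since `centre` is given only as a reduced
ideal sheaf. -/
lemma specIdeal_comap_vanishingIdeal {X : Scheme.{0}} (T : TopologicalSpace.Closeds X)
    {D : CommRingCat.{0}} (j : Spec D ⟶ X) [IsOpenImmersion j] :
    specIdeal ((Scheme.IdealSheafData.vanishingIdeal T).comap j) =
      PrimeSpectrum.vanishingIdeal (j ⁻¹' T) := by
  obtain ⟨e, he, hej⟩ := specIdeal_comap_of_isOpenImmersion
    (Scheme.IdealSheafData.vanishingIdeal T) j _ (isAffineOpen_opensRange j) rfl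
  rw [he, ← ideal_map_iso_inv, Scheme.IdealSheafData.vanishingIdeal_ideal]
  ext d
  simp only [Ideal.mem_comap, PrimeSpectrum.mem_vanishingIdeal]
  have hmem (q : Spec D) : j q ∈ T ↔
      (isAffineOpen_opensRange j).fromSpec (Spec.map e.hom q) ∈ T :=
    iff_of_eq (congrArg (fun φ : Spec D ⟶ X ↦ φ q ∈ T) hej.symm)
  constructor
  · intro h q hq
    have h1 := h (Spec.map e.hom q) ((hmem q).mp hq)
    change e.hom (e.inv d) ∈ q.asIdeal at h1
    simpa using h1
  · intro h p hp
    have h1 : Spec.map e.hom (Spec.map e.inv p) = p := by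
      have : Spec.map e.inv ≫ Spec.map e.hom = 𝟙 _ := by
        rw [← Spec.map_comp, e.hom_inv_id, Spec.map_id]
      exact congrArg (fun φ : Spec Γ(X, j.opensRange) ⟶ Spec Γ(X, j.opensRange) ↦ φ p) this
    exact h (Spec.map e.inv p) ((hmem _).mpr (h1.symm ▸ hp))

/-- Localization preserves non-zero-divisors, so a local equation restricts to a basic open set
inside the prescribed open set. -/
lemma IsInvertibleIdeal.exists_spec {Z : Scheme.{0}} {J : Z.IdealSheafData}
    (hJ : IsInvertibleIdeal J) (z : Z) (O : Z.Opens) (hz : z ∈ O) :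
    ∃ (D : CommRingCat.{0}) (j : Spec D ⟶ Z) (_ : IsOpenImmersion j) (w : Spec D), j w = z ∧
      Set.range j ⊆ O ∧ ∃ d ∈ nonZeroDivisors D, specIdeal (J.comap j) = Ideal.span {d} := by
  obtain ⟨U, hzU, s, hs, hsU⟩ := hJ z
  obtain ⟨f, hf, hzf⟩ := U.2.exists_basicOpen_le ⟨z, hz⟩ hzU
  have hW := U.2.basicOpen f
  obtain ⟨e, he, -⟩ := specIdeal_comap_of_isOpenImmersion J hW.fromSpec _ hW
    (TopologicalSpace.Opens.ext (by simp))
  have hzr : z ∈ Set.range hW.fromSpec := by rw [hW.range_fromSpec]; exact hzf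
  obtain ⟨w, hw⟩ := hzr
  have := U.2.isLocalization_basicOpen f
  refine ⟨_, hW.fromSpec, inferInstance, w, hw, by rw [hW.range_fromSpec]; exact hf,
    e.hom (algebraMap _ _ s), ?_, ?_⟩
  · exact iso_hom_mem_nonZeroDivisors e (IsLocalization.map_nonZeroDivisors_le
      (Submonoid.powers f) Γ(Z, Z.basicOpen f) (Submonoid.mem_map_of_mem _ hs))
  · rw [he, ← J.map_ideal (U := ⟨Z.basicOpen f, hW⟩) (V := U) (Z.basicOpen_le f), hsU,
      Ideal.map_span, Ideal.map_span, Set.image_singleton, Set.image_singleton]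
    rfl

/-! ### Affine charts of a blow-up, from its universal property -/

/-- An ideal sheaf that becomes trivial on `W` does not change `W` in the blow-up. -/
lemma IsBlowup.exists_isPullback {Z X W : Scheme.{0}} {π : Z ⟶ X} {I : X.IdealSheafData}
    (hπ : IsBlowup π I) (ι : W ⟶ X) [IsOpenImmersion ι] (hI : I.comap ι = ⊤) :
    ∃ l : W ⟶ Z, IsPullback (𝟙 W) l ι π := by
  obtain ⟨l, hl, -⟩ := hπ.universal ι (hI ▸ isInvertibleIdeal_top)
  refine ⟨l, ⟨⟨by rw [Category.id_comp, hl]⟩, ⟨PullbackCone.IsLimit.mk _ (fun s ↦ s.fst)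
    (fun s ↦ Category.comp_id _) (fun s ↦ ?_) (fun s m hm _ ↦ by simpa using hm)⟩⟩⟩
  obtain ⟨u, -, hu⟩ := hπ.universal (s.fst ≫ ι)
    (by rw [Scheme.IdealSheafData.comap_comp, hI]; simpa using isInvertibleIdeal_top)
  rw [hu (s.fst ≫ l) (by simp only [Category.assoc, hl]), hu s.snd s.condition.symm]

/-- Near a point over an open affine subscheme where the centre is defined by two equations `x`,
`y`, the blow-up has an equation `g` of the exceptional divisor with `x = x' g`, `y = y' g`. -/
lemma IsBlowup.exists_local_equation {Z X : Scheme.{0}} {π : Z ⟶ X} {I : X.IdealSheafData}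
    (hπ : IsBlowup π I) {A : CommRingCat.{0}} (ι : Spec A ⟶ X) [IsOpenImmersion ι] (x y : A)
    (hI : specIdeal (I.comap ι) = Ideal.span {x, y}) (z : Z) (hz : π z ∈ Set.range ι) :
    ∃ (D : CommRingCat.{0}) (j : Spec D ⟶ Z) (_ : IsOpenImmersion j) (w : Spec D)
      (ρ : A ⟶ D) (g x' y' a c : D), j w = z ∧ j ≫ π = Spec.map ρ ≫ ι ∧ g ∈ nonZeroDivisors D ∧
      ρ x = x' * g ∧ ρ y = y' * g ∧ a * x' + c * y' = 1 := by
  obtain ⟨D, j, hj, w, hw, hr, g, hg, hgI⟩ := hπ.invertible.exists_spec z (π ⁻¹ᵁ ι.opensRange) hz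
  have hr' : Set.range (j ≫ π) ⊆ Set.range ι := by
    rintro _ ⟨p, rfl⟩
    exact hr ⟨p, rfl⟩
  obtain ⟨ρ, hρ⟩ := Spec.map_surjective (IsOpenImmersion.lift ι (j ≫ π) hr')
  have hjρ : j ≫ π = Spec.map ρ ≫ ι := by
    rw [hρ]
    exact (IsOpenImmersion.lift_fac ..).symm
  -- The inverse image ideal is computed twice: from the equations of the centre, and from the local
  -- equation of the exceptional divisor.
  have h : Ideal.span {ρ x, ρ y} = Ideal.span {g} := by
    rw [← hgI, ← Scheme.IdealSheafData.comap_comp, hjρ, Scheme.IdealSheafData.comap_comp,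
      specIdeal_comap, hI, Ideal.map_span, Set.image_pair]
  have hx : ρ x ∈ Ideal.span {g} := h ▸ Ideal.subset_span (by simp)
  have hy : ρ y ∈ Ideal.span {g} := h ▸ Ideal.subset_span (by simp)
  have hg' : g ∈ Ideal.span {ρ x, ρ y} := h ▸ Ideal.mem_span_singleton_self g
  obtain ⟨x', hx'⟩ := Ideal.mem_span_singleton'.mp hx
  obtain ⟨y', hy'⟩ := Ideal.mem_span_singleton'.mp hy
  obtain ⟨a, c, hac⟩ := Ideal.mem_span_pair.mp hg'
  refine ⟨D, j, hj, w, ρ, g, x', y', a, c, hw, hjρ, hg, hx'.symm, hy'.symm, ?_⟩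
  -- `g` lies in `(x' g, y' g)`; cancelling the non-zero-divisor `g` shows that `x'`, `y'` generate
  -- the unit ideal.
  refine (mem_nonZeroDivisors_iff_right.mp hg |> fun H ↦ sub_eq_zero.mp (H _ ?_))
  rw [← hx', ← hy'] at hac
  linear_combination hac

/-- The conditions characterizing the ring `B = A[x/y]` with `s = x/y`. -/
structure IsQuotRing {A B : CommRingCat.{0}} (φ : A ⟶ B) (x y : A) (s : B) : Prop where
  eq : φ x = s * φ y
  lift : ∀ {D : CommRingCat.{0}} (ρ : A ⟶ D) (d : D), ρ x = d * ρ y → ρ y ∈ nonZeroDivisors D →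
    ∃ r : B ⟶ D, φ ≫ r = ρ
  ext : ∀ {D : CommRingCat.{0}} (r r' : B ⟶ D), φ ≫ r = φ ≫ r' → r s = r' s → r = r'

/-- The image of `s` is forced: it is a quotient of the image of `x` by the non-zero-divisor to
which `y` is sent. -/
lemma IsQuotRing.hom_ext {A B D : CommRingCat.{0}} {φ : A ⟶ B} {x y : A} {s : B}
    (h : IsQuotRing φ x y s) (r r' : B ⟶ D) (e : φ ≫ r = φ ≫ r')
    (hy : r (φ y) ∈ nonZeroDivisors D) : r = r' := by
  refine h.ext r r' e ?_
  have h1 := congr(r $(h.eq))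
  have h2 := congr(r' $(h.eq))
  have hx : r (φ x) = r' (φ x) := congr($(e).hom x)
  have hy' : r (φ y) = r' (φ y) := congr($(e).hom y)
  rw [map_mul] at h1 h2
  refine (mem_nonZeroDivisors_iff_right.mp hy |> fun H ↦ sub_eq_zero.mp (H _ ?_))
  rw [sub_mul, ← h1, hy', ← h2, hx, sub_self]

lemma IsBlowup.hom_ext {Z X W : Scheme.{0}} {π : Z ⟶ X} {I : X.IdealSheafData}
    (hπ : IsBlowup π I) (h h' : W ⟶ Z) (g : W ⟶ X) (hg : IsInvertibleIdeal (I.comap g))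
    (e : h ≫ π = g) (e' : h' ≫ π = g) : h = h' := by
  obtain ⟨u, -, hu⟩ := hπ.universal g hg
  rw [hu h e, hu h' e']

lemma isInvertibleIdeal_comap_of_eq_mul {X : Scheme.{0}} {I : X.IdealSheafData}
    {A : CommRingCat.{0}} (ι : Spec A ⟶ X) {x y : A}
    (hI : specIdeal (I.comap ι) = Ideal.span {x, y}) {D : CommRingCat.{0}} (ρ : A ⟶ D) (d : D)
    (hd : ρ x = d * ρ y) (hy : ρ y ∈ nonZeroDivisors D) :
    IsInvertibleIdeal (I.comap (Spec.map ρ ≫ ι)) := by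
  apply isInvertibleIdeal_of_specIdeal _ (ρ y) hy
  rw [Scheme.IdealSheafData.comap_comp, specIdeal_comap, hI, Ideal.map_span, Set.image_pair]
  apply le_antisymm
  · rw [Ideal.span_le]
    rintro _ (rfl | rfl)
    · exact Ideal.mem_span_singleton'.mpr ⟨d, hd.symm⟩
    · exact Ideal.mem_span_singleton_self _
  · exact Ideal.span_mono (by simp)

lemma exists_spec_isOpenImmersion {X : Scheme.{0}} (x : X) :
    ∃ (E : CommRingCat.{0}) (e : Spec E ⟶ X) (_ : IsOpenImmersion e) (p : Spec E), e p = x := by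
  obtain ⟨p, hp⟩ := X.affineCover.covers x
  exact ⟨_, X.affineCover.f _, X.affineCover.map_prop _, p, hp⟩

lemma hom_ext_of_spec {X Y : Scheme.{0}} (f g : X ⟶ Y)
    (h : ∀ (E : CommRingCat.{0}) (e : Spec E ⟶ X) [IsOpenImmersion e], e ≫ f = e ≫ g) : f = g :=
  Scheme.Cover.hom_ext X.affineCover _ _ fun i ↦ @h _ (X.affineCover.f i) (X.affineCover.map_prop i)

/-- A morphism which is, locally on its image, an isomorphism, is an open immersion. -/
lemma isOpenImmersion_of_forall_isIso {X Y : Scheme.{0}} (b : X ⟶ Y)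
    (h : ∀ q : X, ∃ (T : Scheme.{0}) (j : T ⟶ Y) (_ : IsOpenImmersion j), b q ∈ Set.range j ∧
      IsIso (pullback.snd b j)) : IsOpenImmersion b := by
  have hloc : ∀ q : X, ∃ (T : Scheme.{0}) (u : T ⟶ X) (_ : IsOpenImmersion u),
      q ∈ Set.range u ∧ IsOpenImmersion (u ≫ b) := by
    intro q
    obtain ⟨T, j, hj, ⟨w, hw⟩, hi⟩ := h q
    obtain ⟨p, hp, -⟩ := Scheme.Pullback.exists_preimage_pullback q w hw.symm
    exact ⟨_, pullback.fst b j, inferInstance, ⟨p, hp⟩, by rw [pullback.condition]; infer_instance⟩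
  refine IsOpenImmersion.iff_isIso_stalkMap.mpr ⟨.of_continuous_injective_isOpenMap b.continuous
    ?_ ?_, fun q ↦ ?_⟩
  · intro q q' e
    obtain ⟨T, j, hj, ⟨w, hw⟩, hi⟩ := h q
    obtain ⟨p, rfl, hp2⟩ := Scheme.Pullback.exists_preimage_pullback q w hw.symm
    obtain ⟨p', rfl, hp2'⟩ := Scheme.Pullback.exists_preimage_pullback q' w (by rw [← e, hw])
    rw [(pullback.snd b j).homeomorph.injective (hp2.trans hp2'.symm)]
  · intro O hO
    rw [isOpen_iff_forall_mem_open]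
    rintro _ ⟨q, hq, rfl⟩
    obtain ⟨T, u, hu, ⟨p, rfl⟩, hub⟩ := hloc q
    refine ⟨(u ≫ b) '' (u ⁻¹' O), ?_, (u ≫ b).isOpenEmbedding.isOpenMap _
      (hO.preimage u.continuous), ⟨p, hq, rfl⟩⟩
    rintro _ ⟨p', hp', rfl⟩
    exact ⟨u p', hp', rfl⟩
  · obtain ⟨T, u, hu, ⟨p, rfl⟩, hub⟩ := hloc q
    have : IsIso (b.stalkMap (u p) ≫ u.stalkMap p) := by
      rw [← Scheme.Hom.stalkMap_comp]
      exact (IsOpenImmersion.iff_isIso_stalkMap.mp hub).2 p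
    exact IsIso.of_isIso_comp_right _ (u.stalkMap p)

lemma nonZeroDivisors_of_flat {B E : CommRingCat.{0}} (β : B ⟶ E) [h : Flat (Spec.map β)] {b : B}
    (hb : b ∈ nonZeroDivisors B) : β b ∈ nonZeroDivisors E := by
  have hf : β.hom.Flat := Flat.SpecMap_iff.mp h
  algebraize [β.hom]
  have h1 : IsSMulRegular B b := fun u v e ↦
    mul_cancel_left_mem_nonZeroDivisors hb |>.mp e
  have h2 : IsSMulRegular E (algebraMap B E b) := h1.of_flat
  refine mem_nonZeroDivisors_iff_right.mpr fun c hc ↦ h2 ?_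
  change β b * c = β b * 0
  rw [mul_zero, mul_comm, hc]

section Chart

variable {Z X : Scheme.{0}} {π : Z ⟶ X} {I : X.IdealSheafData} (hπ : IsBlowup π I)
  {A B : CommRingCat.{0}} (ι : Spec A ⟶ X) [IsOpenImmersion ι] {x y : A}
  (hI : specIdeal (I.comap ι) = Ideal.span {x, y}) {φ : A ⟶ B} {s : B}
  (hB : IsQuotRing φ x y s) (b : Spec B ⟶ Z) (hb : b ≫ π = Spec.map φ ≫ ι)

include hπ hI hB hb

omit [IsOpenImmersion ι] in
-- Where `x` is a multiple of the non-zero-divisor `y`, the ideal `(x, y) = (y)` is invertible, so a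
-- morphism to `Z` is determined by its composite with `π`.
lemma exists_factor_chart {D : CommRingCat.{0}} (j : Spec D ⟶ Z) (ρ : A ⟶ D)
    (hj : j ≫ π = Spec.map ρ ≫ ι) (d : D) (hd : ρ x = d * ρ y)
    (hy : ρ y ∈ nonZeroDivisors D) : ∃ r : B ⟶ D, φ ≫ r = ρ ∧ Spec.map r ≫ b = j := by
  obtain ⟨r, hr⟩ := hB.lift ρ d hd hy
  refine ⟨r, hr, hπ.hom_ext _ _ _ (isInvertibleIdeal_comap_of_eq_mul ι hI ρ d hd hy) ?_ hj⟩
  rw [Category.assoc, hb, ← Spec.map_comp_assoc, hr]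

omit [IsOpenImmersion ι] in
-- After inverting `y'` the quotient `x / y = x' / y'` is a function, and `exists_factor_chart`
-- applies.
lemma exists_factor_chart_of_notMem {D : CommRingCat.{0}} (j : Spec D ⟶ Z) [IsOpenImmersion j]
    (w : Spec D) (ρ : A ⟶ D) (g x' y' : D) (hj : j ≫ π = Spec.map ρ ≫ ι)
    (hg : g ∈ nonZeroDivisors D) (hx' : ρ x = x' * g) (hy' : ρ y = y' * g)
    (hyw : y' ∉ w.asIdeal) : ∃ (D' : CommRingCat.{0}) (j' : Spec D' ⟶ Z) (_ : IsOpenImmersion j')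
      (w' : Spec D') (r : B ⟶ D'), j' w' = j w ∧ Spec.map r ≫ b = j' ∧
      r (φ y) ∈ nonZeroDivisors D' := by
  let D' := CommRingCat.of (Localization.Away y')
  let a : D ⟶ D' := CommRingCat.ofHom (algebraMap D (Localization.Away y'))
  have ha : IsOpenImmersion (Spec.map a) := by
    change IsOpenImmersion (Spec.map (CommRingCat.ofHom (algebraMap D (Localization.Away y'))))
    infer_instance
  have hu : IsUnit (a y') := IsLocalization.Away.algebraMap_isUnit y'
  have hw : w ∈ Set.range (PrimeSpectrum.comap (algebraMap D (Localization.Away y'))) := by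
    rw [PrimeSpectrum.localization_away_comap_range (Localization.Away y') y']
    exact hyw
  obtain ⟨w', hw'⟩ := hw
  have hnz : a (ρ y) ∈ nonZeroDivisors D' := by
    rw [hy', map_mul]
    exact mul_mem hu.mem_nonZeroDivisors (IsLocalization.map_nonZeroDivisors_le
      (Submonoid.powers y') (Localization.Away y') (Submonoid.mem_map_of_mem _ hg))
  obtain ⟨v, hv⟩ := hu.exists_left_inv
  obtain ⟨r, hr, hrb⟩ := exists_factor_chart hπ ι hI hB b hb (Spec.map a ≫ j) (ρ ≫ a)
    (by rw [Category.assoc, hj, Spec.map_comp_assoc]) (a x' * v)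
    (by
      simp only [CommRingCat.hom_comp, RingHom.comp_apply, hx', hy', map_mul]
      linear_combination (-a x' * a g) * hv) hnz
  refine ⟨D', Spec.map a ≫ j, inferInstance, w', r, ?_, hrb, ?_⟩
  · rw [← hw']
    rfl
  · have : r (φ y) = a (ρ y) := congr($(hr).hom y)
    rwa [this]

/-- The point is that `y'` does not vanish at `b q`. The fibre product of `Spec B` and `Spec D` over
`Z` is open in `Spec B`, so `y` is still a non-zero-divisor there. Cancelling `g` gives `x' = s y'`,
and since `x'`, `y'` generate the unit ideal, `y'` is invertible on the fibre product, which has a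
point over `b q`. -/
lemma exists_factor_chart_at (hy : φ y ∈ nonZeroDivisors B) (q : Spec B) :
    ∃ (D' : CommRingCat.{0}) (j' : Spec D' ⟶ Z) (_ : IsOpenImmersion j') (r : B ⟶ D'),
      b q ∈ Set.range j' ∧ Spec.map r ≫ b = j' ∧ r (φ y) ∈ nonZeroDivisors D' := by
  obtain ⟨D, j, hj, w, ρ, g, x', y', a, c, hw, hjρ, hg, hx', hy', hac⟩ :=
    hπ.exists_local_equation ι x y hI (b q)
      ⟨Spec.map φ q, by rw [← Scheme.Hom.comp_apply, ← hb, Scheme.Hom.comp_apply]⟩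
  suffices h : y' ∉ w.asIdeal by
    obtain ⟨D', j', hj', w', r, h1, h2, h3⟩ :=
      exists_factor_chart_of_notMem hπ ι hI hB b hb j w ρ g x' y' hjρ hg hx' hy' h
    exact ⟨D', j', hj', r, ⟨w', by rw [h1, hw]⟩, h2, h3⟩
  obtain ⟨p, hp1, hp2⟩ := Scheme.Pullback.exists_preimage_pullback q w hw.symm
  obtain ⟨E, e, he, p', hp'⟩ := exists_spec_isOpenImmersion p
  obtain ⟨β, hβ⟩ := Spec.map_surjective (e ≫ pullback.fst b j)
  obtain ⟨δ, hδ⟩ := Spec.map_surjective (e ≫ pullback.snd b j)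
  have hflat : Flat (Spec.map β) := by
    rw [hβ]
    infer_instance
  have hβδ : φ ≫ β = ρ ≫ δ := by
    apply Spec.map_injective
    rw [← cancel_mono ι, Spec.map_comp, Spec.map_comp, Category.assoc, Category.assoc, ← hb,
      ← hjρ, hβ, hδ, Category.assoc, Category.assoc, pullback.condition_assoc]
  have hx : β (φ x) = δ (ρ x) := congr($(hβδ).hom x)
  have hy2 : β (φ y) = δ (ρ y) := congr($(hβδ).hom y)
  have hn := nonZeroDivisors_of_flat β hy
  rw [hy2, hy', map_mul] at hn
  have hn' : δ g ∈ nonZeroDivisors _ := (mul_mem_nonZeroDivisors.mp hn).2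
  have e1 : δ x' = β s * δ y' := by
    refine (mem_nonZeroDivisors_iff_right.mp hn' |> fun H ↦ sub_eq_zero.mp (H _ ?_))
    have := congr(β $(hB.eq))
    rw [hx, hx', map_mul, map_mul, hy2, hy', map_mul] at this
    linear_combination this
  have e2 : (δ a * β s + δ c) * δ y' = 1 := by
    have := congr(δ $hac)
    rw [map_add, map_mul, map_mul, map_one, e1] at this
    linear_combination this
  intro hmem
  have hw' : w = Spec.map δ p' := by
    rw [← hp2, ← hp', hδ, Scheme.Hom.comp_apply]
  rw [hw'] at hmem
  have hm : δ y' ∈ p'.asIdeal := hmem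
  exact p'.isPrime.ne_top (Ideal.eq_top_of_isUnit_mem _ hm (.of_mul_eq_one_right _ e2))

/-- A neighbourhood of `b q` maps back to `Spec B` over `Z`, which gives a section of the base
change of `b`. It is a two-sided inverse because two morphisms to `Spec B` which agree over `A` are
equal as long as `y` remains a non-zero-divisor, and this holds on the fibre product by flatness. -/
lemma isOpenImmersion_chart (hy : φ y ∈ nonZeroDivisors B) : IsOpenImmersion b := by
  apply isOpenImmersion_of_forall_isIso
  intro q
  obtain ⟨D, j, hj, r, hq, hrj, hry⟩ := exists_factor_chart_at hπ ι hI hB b hb hy q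
  refine ⟨_, j, hj, hq, pullback.lift (Spec.map r) (𝟙 _) (by rw [hrj, Category.id_comp]), ?_,
    pullback.lift_snd _ _ _⟩
  have key : pullback.snd b j ≫ Spec.map r = pullback.fst b j := by
    apply hom_ext_of_spec
    intro E e he
    obtain ⟨β, hβ⟩ := Spec.map_surjective (e ≫ pullback.fst b j)
    obtain ⟨δ, hδ⟩ := Spec.map_surjective (e ≫ pullback.snd b j)
    have hflat : Flat (Spec.map β) := by
      rw [hβ]
      infer_instance
    have hc := pullback.condition (f := b) (g := j)
    rw [← reassoc_of% hδ, ← hβ, ← Spec.map_comp]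
    congr 1
    symm
    apply hB.hom_ext _ _ _ (nonZeroDivisors_of_flat β hy)
    apply Spec.map_injective
    rw [← cancel_mono ι, Spec.map_comp, Spec.map_comp, Spec.map_comp, Category.assoc,
      Category.assoc, Category.assoc, ← hb, hβ, hδ, reassoc_of% hrj, Category.assoc, Category.assoc,
      reassoc_of% hc]
  apply pullback.hom_ext
  · rw [Category.assoc, pullback.lift_fst, key, Category.id_comp]
  · rw [Category.assoc, pullback.lift_snd, Category.comp_id, Category.id_comp]

end Chart

section Chart

variable {Z X : Scheme.{0}} {π : Z ⟶ X} {I : X.IdealSheafData} (hπ : IsBlowup π I)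
  {A B : CommRingCat.{0}} (ι : Spec A ⟶ X) [IsOpenImmersion ι] {x y : A}
  (hI : specIdeal (I.comap ι) = Ideal.span {x, y}) {φ : A ⟶ B} {s : B}
  (hB : IsQuotRing φ x y s)

include hπ hI hB in
/-- The ring `A[x/y]` gives an open affine subscheme of the blow-up of the ideal `(x, y)`. -/
lemma IsBlowup.exists_chart (hy : φ y ∈ nonZeroDivisors B) :
    ∃ (b : Spec B ⟶ Z), IsOpenImmersion b ∧ b ≫ π = Spec.map φ ≫ ι := by
  obtain ⟨b, hb, -⟩ := hπ.universal (Spec.map φ ≫ ι)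
    (isInvertibleIdeal_comap_of_eq_mul ι hI φ s hB.eq hy)
  exact ⟨b, isOpenImmersion_chart hπ ι hI hB b hb hy, hb⟩

include hπ hI hB in
/-- The two charts of the blow-up of the ideal `(x, y)` cover it. -/
lemma IsBlowup.mem_range_chart_or {B' : CommRingCat.{0}} {φ' : A ⟶ B'} {s' : B'}
    (hB' : IsQuotRing φ' y x s') (b : Spec B ⟶ Z) (hb : b ≫ π = Spec.map φ ≫ ι)
    (b' : Spec B' ⟶ Z) (hb' : b' ≫ π = Spec.map φ' ≫ ι) (z : Z) (hz : π z ∈ Set.range ι) :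
    z ∈ Set.range b ∨ z ∈ Set.range b' := by
  obtain ⟨D, j, hj, w, ρ, g, x', y', a, c, hw, hjρ, hg, hx', hy', hac⟩ :=
    hπ.exists_local_equation ι x y hI z hz
  by_cases h : y' ∈ w.asIdeal
  · right
    have h' : x' ∉ w.asIdeal := fun h' ↦ w.isPrime.ne_top ((Ideal.eq_top_iff_one _).mpr
      (hac ▸ add_mem (Ideal.mul_mem_left _ _ h') (Ideal.mul_mem_left _ _ h)))
    obtain ⟨D', j', hj', w', r, h1, h2, -⟩ := exists_factor_chart_of_notMem hπ ι
      (by rw [hI, Set.pair_comm]) hB' b' hb' j w ρ g y' x' hjρ hg hy' hx' h'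
    exact ⟨Spec.map r w', by rw [← Scheme.Hom.comp_apply, h2, h1, hw]⟩
  · left
    obtain ⟨D', j', hj', w', r, h1, h2, -⟩ :=
      exists_factor_chart_of_notMem hπ ι hI hB b hb j w ρ g x' y' hjρ hg hx' hy' h
    exact ⟨Spec.map r w', by rw [← Scheme.Hom.comp_apply, h2, h1, hw]⟩

end Chart

end AbelianCover

end

/-! ### Morphisms to the projective line in homogeneous coordinates -/

open CategoryTheory CategoryTheory.Limits AlgebraicGeometry
noncomputable section
namespace AbelianCover

attribute [local instance] MvPolynomial.gradedAlgebra

open HomogeneousLocalization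

section

variable {A : Type} [CommRing A] [Algebra ℂ A]

lemma aeval_mul_of_isHomogeneous {p : MvPolynomial (Fin 2) ℂ} {d : ℕ} (hp : p.IsHomogeneous d)
    (u : A) (c : Fin 2 → A) :
    MvPolynomial.aeval (fun i ↦ u * c i) p = u ^ d * MvPolynomial.aeval c p := by
  simp only [MvPolynomial.aeval_def, MvPolynomial.eval₂_eq, Finset.mul_sum]
  refine Finset.sum_congr rfl fun e he ↦ ?_
  have h : e.sum (fun _ k ↦ k) = d := by
    have := hp (MvPolynomial.mem_support_iff.mp he)
    rwa [Finsupp.weight_apply, Finsupp.sum_congr (g2 := fun _ k ↦ k) (by simp)] at this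
  simp only [mul_pow, Finset.prod_mul_distrib, Finset.prod_pow_eq_pow_sum]
  rw [← h, Finsupp.sum]
  ring

/-- The homomorphism `ℂ[x₀, x₁]_(l) → A` given by homogeneous coordinates `c` with `l(c)`
invertible. -/
def coordHom (l : MvPolynomial (Fin 2) ℂ) (c : Fin 2 → A) (hu : IsUnit (MvPolynomial.aeval c l)) :
    Away grading l →+* A :=
  (IsLocalization.Away.lift (S := Localization.Away l) l
    (g := (MvPolynomial.aeval c : MvPolynomial (Fin 2) ℂ →ₐ[ℂ] A).toRingHom) hu).comp
  (algebraMap (Away grading l) (Localization.Away l))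

/-- The formula is free of division, so that identities between such homomorphisms reduce, through
`coordHom_eq`, to cancelling a unit. -/
lemma coordHom_mk {l : MvPolynomial (Fin 2) ℂ} {d : ℕ} (hl : l ∈ grading d) (c : Fin 2 → A)
    (hu : IsUnit (MvPolynomial.aeval c l)) (k : ℕ) (x : MvPolynomial (Fin 2) ℂ)
    (hx : x ∈ grading (k • d)) :
    coordHom l c hu (Away.mk grading hl k x hx) * MvPolynomial.aeval c l ^ k =
      MvPolynomial.aeval c x := by
  have h : (Away.mk grading hl k x hx).val * algebraMap _ _ (l ^ k) =
      algebraMap (MvPolynomial (Fin 2) ℂ) (Localization.Away l) x := by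
    rw [Away.val_mk, Localization.mk_eq_mk']
    exact IsLocalization.mk'_spec (Localization.Away l) x
      (⟨l ^ k, k, rfl⟩ : Submonoid.powers l)
  have h2 := congr((IsLocalization.Away.lift (S := Localization.Away l) l
    (g := (MvPolynomial.aeval c : MvPolynomial (Fin 2) ℂ →ₐ[ℂ] A).toRingHom) hu) $h)
  rw [map_mul, IsLocalization.Away.lift_eq, IsLocalization.Away.lift_eq] at h2
  simpa [coordHom] using h2

lemma coordHom_eq {l : MvPolynomial (Fin 2) ℂ} (hl : l ∈ grading 1) (c : Fin 2 → A)
    (hu : IsUnit (MvPolynomial.aeval c l)) (φ : Away grading l →+* A)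
    (h : ∀ k x hx, φ (Away.mk grading hl k x hx) * MvPolynomial.aeval c l ^ k =
      MvPolynomial.aeval c x) : φ = coordHom l c hu := by
  ext z
  obtain ⟨k, x, hx, rfl⟩ := Away.mk_surjective grading hl z
  exact (hu.pow k).mul_left_injective ((h k x hx).trans (coordHom_mk hl c hu k x hx).symm)

/-- The morphism `Spec A ⟶ ℙ¹` given by homogeneous coordinates `c` with `l(c)` invertible. -/
def coordPoint (l : MvPolynomial (Fin 2) ℂ) (hl : l ∈ grading 1) (c : Fin 2 → A)
    (hu : IsUnit (MvPolynomial.aeval c l)) : Spec (CommRingCat.of A) ⟶ P1 :=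
  Spec.map (CommRingCat.ofHom (coordHom l c hu)) ≫ Proj.awayι grading l hl Nat.one_pos

/-- The point lies in the smaller chart where `l l'` is invertible. That description is symmetric in
`l` and `l'`, whence the independence of `l` in `coordPoint_eq`. -/
lemma coordPoint_eq_mul {l l' : MvPolynomial (Fin 2) ℂ} (hl : l ∈ grading 1)
    (hl' : l' ∈ grading 1) (c : Fin 2 → A) (hu : IsUnit (MvPolynomial.aeval c l))
    (hu' : IsUnit (MvPolynomial.aeval c l')) (x : MvPolynomial (Fin 2) ℂ) (hx : x = l * l')
    (hux : IsUnit (MvPolynomial.aeval c x)) :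
    coordPoint l hl c hu = Spec.map (CommRingCat.ofHom (coordHom x c hux)) ≫
      Proj.awayι grading x (hx ▸ SetLike.mul_mem_graded hl hl') (by decide) := by
  rw [← Proj.SpecMap_awayMap_awayι grading hl Nat.one_pos hl' hx, ← Spec.map_comp_assoc,
    coordPoint, ← CommRingCat.ofHom_comp]
  congr 3
  symm
  apply coordHom_eq hl
  intro k y hy
  apply (hu'.pow k).mul_left_injective
  have h := coordHom_mk (hx ▸ SetLike.mul_mem_graded hl hl') c hux k (y * l' ^ k)
    (by rw [smul_add]; exact SetLike.mul_mem_graded hy (SetLike.pow_mem_graded k hl'))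
  simp only [RingHom.comp_apply, awayMap_mk, map_mul, map_pow] at h ⊢
  rw [← h, mul_assoc, ← mul_pow, ← map_mul]
  congr 2
  exact congrArg _ hx.symm

lemma coordPoint_eq {l l' : MvPolynomial (Fin 2) ℂ} (hl : l ∈ grading 1)
    (hl' : l' ∈ grading 1) (c : Fin 2 → A) (hu : IsUnit (MvPolynomial.aeval c l))
    (hu' : IsUnit (MvPolynomial.aeval c l')) :
    coordPoint l hl c hu = coordPoint l' hl' c hu' := by
  rw [coordPoint_eq_mul hl hl' c hu hu' (l * l') rfl (by simpa using hu.mul hu'),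
    coordPoint_eq_mul hl' hl c hu' hu (l * l') (mul_comm _ _) (by simpa using hu.mul hu')]

/-- Numerator and denominator of a fraction of degree zero are scaled by the same power of `u`. That
`u` is a unit follows from `l(u c) = u l(c)`. -/
lemma coordPoint_scale {l : MvPolynomial (Fin 2) ℂ} (hl : l ∈ grading 1) (c c' : Fin 2 → A) (u : A)
    (hc : ∀ i, c' i = u * c i) (hu : IsUnit (MvPolynomial.aeval c l))
    (hu' : IsUnit (MvPolynomial.aeval c' l)) : coordPoint l hl c hu = coordPoint l hl c' hu' := by
  obtain rfl : c' = fun i ↦ u * c i := funext hc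
  rw [coordPoint, coordPoint]
  congr 3
  symm
  apply coordHom_eq hl
  intro k x hx
  have h := coordHom_mk hl _ hu' k x hx
  have hl1 : l.IsHomogeneous 1 := hl
  have hx1 : x.IsHomogeneous (k • 1) := hx
  rw [aeval_mul_of_isHomogeneous hl1, aeval_mul_of_isHomogeneous hx1] at h
  rw [aeval_mul_of_isHomogeneous hl1, pow_one] at hu'
  have hu2 : IsUnit (u ^ k) := (isUnit_of_mul_isUnit_left hu').pow k
  apply hu2.mul_right_injective
  simp only [smul_eq_mul, mul_one] at h
  change u ^ k * _ = u ^ k * _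
  rw [← h]
  ring

lemma affPoint_eq_coordPoint (a : A) : affPoint a = coordPoint (MvPolynomial.X 0)
    ((MvPolynomial.mem_homogeneousSubmodule 1 _).mpr (MvPolynomial.isHomogeneous_X ℂ 0)) ![1, a]
    (by simp) := rfl

lemma SpecMap_coordPoint {A' : Type} [CommRing A'] [Algebra ℂ A'] (f : A →ₐ[ℂ] A')
    {l : MvPolynomial (Fin 2) ℂ} (hl : l ∈ grading 1) (c : Fin 2 → A)
    (hu : IsUnit (MvPolynomial.aeval c l)) (c' : Fin 2 → A') (hc : ∀ i, f (c i) = c' i)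
    (hu' : IsUnit (MvPolynomial.aeval c' l)) :
    Spec.map (CommRingCat.ofHom f.toRingHom) ≫ coordPoint l hl c hu = coordPoint l hl c' hu' := by
  obtain rfl : (f ∘ c) = c' := funext hc
  rw [coordPoint, coordPoint, ← Spec.map_comp_assoc, ← CommRingCat.ofHom_comp]
  congr 3
  apply coordHom_eq hl
  intro k x hx
  have h := congr(f $(coordHom_mk hl c hu k x hx))
  have key (p : MvPolynomial (Fin 2) ℂ) :
      f (MvPolynomial.aeval c p) = MvPolynomial.aeval (f ∘ c) p :=
    MvPolynomial.comp_aeval_apply c f p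
  rw [map_mul, map_pow, key, key] at h
  exact h

lemma coordPoint_toPt {l : MvPolynomial (Fin 2) ℂ} (hl : l ∈ grading 1) (c : Fin 2 → A)
    (hu : IsUnit (MvPolynomial.aeval c l)) :
    coordPoint l hl c hu ≫ P1.toPt = Spec.map (CommRingCat.ofHom (algebraMap ℂ A)) := by
  rw [coordPoint, P1.toPt, Category.assoc, Proj.awayι_toSpecZero_assoc, ← Spec.map_comp,
    ← Spec.map_comp, ← CommRingCat.ofHom_comp, ← CommRingCat.ofHom_comp]
  congr 2
  ext a
  have h : (fromZeroRingHom grading (Submonoid.powers l) (algebraMap ℂ (grading 0) a)).val =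
      algebraMap (MvPolynomial (Fin 2) ℂ) _ (MvPolynomial.C a) := by
    rw [← Localization.mk_one_eq_algebraMap]
    rfl
  simp only [coordHom, RingHom.comp_apply, HomogeneousLocalization.algebraMap_apply]
  rw [h, IsLocalization.Away.lift_eq]
  simp

/-- In the chart of `l` the open set is defined by the function `l' / l`, whose value is `l'(c)` up
to a unit. -/
lemma coordPoint_mem_basicOpen {l : MvPolynomial (Fin 2) ℂ} (hl : l ∈ grading 1) (c : Fin 2 → A)
    (hu : IsUnit (MvPolynomial.aeval c l)) {l' : MvPolynomial (Fin 2) ℂ} (hl' : l' ∈ grading 1)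
    (p : Spec (CommRingCat.of A)) :
    coordPoint l hl c hu p ∈ Proj.basicOpen grading l' ↔
      MvPolynomial.aeval c l' ∉ p.asIdeal := by
  rw [coordPoint, Scheme.Hom.comp_apply]
  change Spec.map (CommRingCat.ofHom (coordHom l c hu)) p ∈
    Proj.awayι grading l hl Nat.one_pos ⁻¹ᵁ Proj.basicOpen grading l' ↔ _
  rw [Proj.awayι_preimage_basicOpen grading hl Nat.one_pos hl' Nat.one_pos]
  change coordHom l c hu (Away.isLocalizationElem hl hl') ∉ p.asIdeal ↔ _
  rw [Away.isLocalizationElem, not_iff_not]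
  have h := coordHom_mk hl c hu 1 (l' ^ 1) (SetLike.pow_mem_graded 1 hl')
  have e : MvPolynomial.aeval c (l' ^ 1) = MvPolynomial.aeval c l' := by rw [pow_one]
  rw [← e, ← h]
  exact (Ideal.mul_unit_mem_iff_mem _ (hu.pow 1)).symm

end

end AbelianCover

end

/-! ### The three marked points and their permutations -/

open CategoryTheory CategoryTheory.Limits AlgebraicGeometry
noncomputable section
namespace AbelianCover

attribute [local instance] MvPolynomial.gradedAlgebra

open HomogeneousLocalization

/-- The linear forms `x₀`, `-x₁`, `x₁ - x₀` with sum zero. -/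
def sform : Fin 3 → MvPolynomial (Fin 2) ℂ :=
  ![MvPolynomial.X 0, -MvPolynomial.X 1, MvPolynomial.X 1 - MvPolynomial.X 0]

lemma sform_mem (i : Fin 3) : sform i ∈ grading 1 := by
  have h (j : Fin 2) : (MvPolynomial.X j : MvPolynomial (Fin 2) ℂ) ∈ grading 1 :=
    (MvPolynomial.mem_homogeneousSubmodule 1 _).mpr (MvPolynomial.isHomogeneous_X ℂ j)
  fin_cases i
  · exact h 0
  · exact neg_mem (h 1)
  · exact sub_mem (h 1) (h 0)

lemma mark_eq (i : Fin 3) :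
    mark i = ((Proj.basicOpen grading (sform i) : P1.Opens) : Set P1)ᶜ := by
  fin_cases i
  · rfl
  · ext x
    simp only [mark, linForm, sform, Set.mem_compl_iff, SetLike.mem_coe, Proj.mem_basicOpen]
    exact not_congr (not_congr (neg_mem_iff (S := Ideal (MvPolynomial (Fin 2) ℂ))
      (H := x.asHomogeneousIdeal.toIdeal)).symm)
  · rfl

section

variable {A : Type} [CommRing A]

/-- The values of the forms `x₀`, `-x₁`, `x₁ - x₀` at `(1, a)`. -/
def sval (a : A) : Fin 3 → A := ![1, -a, a - 1]

lemma sum_perm_eq_zero {v : Fin 3 → A} (hv : v 0 + v 1 + v 2 = 0) (ρ : Equiv.Perm (Fin 3)) :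
    v (ρ 0) + v (ρ 1) + v (ρ 2) = 0 := by
  have h := Equiv.sum_comp ρ v
  rw [Fin.sum_univ_three, Fin.sum_univ_three] at h
  rw [h, hv]

lemma sval_sum (a : A) : sval a 0 + sval a 1 + sval a 2 = 0 := by
  simp only [sval, Matrix.cons_val]
  ring

/-- Homogeneous coordinates of the image of `(1 : a)` under the automorphism of the projective
line which permutes the three marked points. -/
def permCoord (ρ : Equiv.Perm (Fin 3)) (a : A) : Fin 2 → A := ![sval a (ρ 0), -sval a (ρ 1)]

lemma map_sval {A' : Type} [CommRing A'] (f : A →+* A') (a : A) (i : Fin 3) :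
    f (sval a i) = sval (f a) i := by
  fin_cases i <;> simp [sval]

variable [Algebra ℂ A]

/-- Only two of the values are built into `permCoord`. The third follows because both the forms and
the values sum to zero, which is the reason for the sign in `sform`. -/
lemma aeval_permCoord (ρ : Equiv.Perm (Fin 3)) (a : A) (i : Fin 3) :
    MvPolynomial.aeval (permCoord ρ a) (sform i) = sval a (ρ i) := by
  have h := sum_perm_eq_zero (sval_sum a) ρ
  fin_cases i
  · simp [permCoord, sform]
  · simp [permCoord, sform]
  · simp only [sform, permCoord, Fin.reduceFinMk, Matrix.cons_val, map_sub, MvPolynomial.aeval_X,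
      Matrix.cons_val_one, Matrix.cons_val_zero]
    linear_combination -h

/-- The form of index `ρ⁻¹ 0` takes the value `sval a 0 = 1`. -/
lemma isUnit_aeval_permCoord (ρ : Equiv.Perm (Fin 3)) (a : A) :
    IsUnit (MvPolynomial.aeval (permCoord ρ a) (sform (ρ⁻¹ 0))) := by
  rw [aeval_permCoord]
  simp [sval]

/-- The image of `(1 : a)` under the automorphism of the projective line which permutes the three
marked points. -/
def permPoint (ρ : Equiv.Perm (Fin 3)) (a : A) : Spec (CommRingCat.of A) ⟶ P1 :=
  coordPoint (sform (ρ⁻¹ 0)) (sform_mem _) (permCoord ρ a) (isUnit_aeval_permCoord ρ a)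

lemma permPoint_mem_mark (ρ : Equiv.Perm (Fin 3)) (a : A) (i : Fin 3)
    (p : Spec (CommRingCat.of A)) : permPoint ρ a p ∈ mark i ↔ sval a (ρ i) ∈ p.asIdeal := by
  rw [mark_eq, Set.mem_compl_iff, SetLike.mem_coe, permPoint,
    coordPoint_mem_basicOpen _ _ _ (sform_mem i), aeval_permCoord, not_not]

lemma permPoint_toPt (ρ : Equiv.Perm (Fin 3)) (a : A) :
    permPoint ρ a ≫ P1.toPt = Spec.map (CommRingCat.ofHom (algebraMap ℂ A)) :=
  coordPoint_toPt ..

lemma SpecMap_permPoint {A' : Type} [CommRing A'] [Algebra ℂ A'] (f : A →ₐ[ℂ] A')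
    (ρ : Equiv.Perm (Fin 3)) (a : A) :
    Spec.map (CommRingCat.ofHom f.toRingHom) ≫ permPoint ρ a = permPoint ρ (f a) := by
  refine SpecMap_coordPoint f _ _ _ _ (fun i ↦ ?_) _
  have h (j : Fin 3) := map_sval f.toRingHom a j
  fin_cases i <;> simpa [permCoord] using h _

lemma permPoint_eq_affPoint (ρ : Equiv.Perm (Fin 3)) (a b : A) (hu : IsUnit (sval a (ρ 0)))
    (hb : b * sval a (ρ 0) = - sval a (ρ 1)) : permPoint ρ a = affPoint b := by
  rw [affPoint_eq_coordPoint, permPoint,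
    coordPoint_eq (sform_mem _) (sform_mem 0) _ _ (by rwa [aeval_permCoord])]
  symm
  refine coordPoint_scale _ _ _ (sval a (ρ 0)) (fun i ↦ ?_) _ _
  fin_cases i
  · simp [permCoord]
  · simp [permCoord, ← hb, mul_comm]

end

/-- The degree-zero part of `ℂ[x₀, x₁]` localized at a linear form is a polynomial ring in one
variable. Hence `permPoint ρ X` embeds the affine line as the complement of one marked point. -/
lemma bijective_coordHom_permCoord (ρ : Equiv.Perm (Fin 3)) :
    Function.Bijective (coordHom (sform (ρ⁻¹ 0)) (permCoord ρ (Polynomial.X : Polynomial ℂ))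
      (isUnit_aeval_permCoord ρ _)) := by
  have h1 : MvPolynomial.aeval (permCoord ρ (Polynomial.X : Polynomial ℂ)) (sform (ρ⁻¹ 0)) = 1 := by
    rw [aeval_permCoord]
    simp [sval]
  have hmk := fun k x hx ↦ coordHom_mk (sform_mem (ρ⁻¹ 0)) (permCoord ρ (Polynomial.X : Polynomial ℂ))
    (isUnit_aeval_permCoord ρ _) k x hx
  simp only [h1, one_pow, mul_one] at hmk
  constructor
  · rw [injective_iff_map_eq_zero]
    intro z hz
    obtain ⟨k, x, hx, rfl⟩ := Away.mk_surjective grading (sform_mem (ρ⁻¹ 0)) z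
    rw [hmk] at hz
    set l := sform (ρ⁻¹ 0) with hl
    let L := Localization.Away l
    let u : L := IsLocalization.Away.invSelf l
    have hu : u * algebraMap _ L l = 1 := by
      rw [mul_comm]
      exact IsLocalization.Away.mul_invSelf l
    -- `q` is the affine coordinate viewed in the localization. Substituting `q` for `X` undoes the
    -- substitution of `permCoord` up to the unit `u`, so a form killed by the latter is zero.
    let q : L := - (u * algebraMap _ L (sform (ρ⁻¹ 1)))
    have hq (j : Fin 3) : sval q j = u * algebraMap _ L (sform (ρ⁻¹ j)) := by
      have hs : sform 0 + sform 1 + sform 2 = 0 := by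
        simp only [sform, Matrix.cons_val]
        ring
      have hs' := congr(u * algebraMap _ L $(sum_perm_eq_zero hs ρ⁻¹))
      rw [map_add, map_add, mul_add, mul_add, ← hl, hu, map_zero, mul_zero] at hs'
      fin_cases j
      · exact hu.symm
      · exact neg_neg _
      · simp only [sval, Fin.reduceFinMk, Matrix.cons_val, q]
        linear_combination -hs'
    have h2 := congr(Polynomial.aeval q $hz)
    rw [MvPolynomial.comp_aeval_apply, map_zero] at h2
    have h3 : (fun i ↦ Polynomial.aeval q (permCoord ρ (Polynomial.X : Polynomial ℂ) i)) =
        fun i ↦ u * algebraMap (MvPolynomial (Fin 2) ℂ) L (MvPolynomial.X i) := by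
      have h (j : Fin 3) := map_sval (Polynomial.aeval (R := ℂ) q).toRingHom Polynomial.X j
      simp only [AlgHom.toRingHom_eq_coe, RingHom.coe_coe, Polynomial.aeval_X] at h
      funext i
      fin_cases i
      · simp [permCoord, h, hq, sform]
      · simp only [permCoord, Fin.mk_one, Matrix.cons_val, map_neg, h, hq, Equiv.Perm.inv_def, Equiv.symm_apply_apply,
          sform]
        ring
    have hx1 : x.IsHomogeneous (k • 1) := hx
    rw [h3, aeval_mul_of_isHomogeneous hx1] at h2
    have h4 : MvPolynomial.aeval (fun i : Fin 2 ↦ algebraMap (MvPolynomial (Fin 2) ℂ) L (MvPolynomial.X i)) x =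
        algebraMap _ L x := by
      have := MvPolynomial.comp_aeval_apply
        (MvPolynomial.X : Fin 2 → MvPolynomial (Fin 2) ℂ) (IsScalarTower.toAlgHom ℂ (MvPolynomial (Fin 2) ℂ) L) x
      rw [MvPolynomial.aeval_X_left_apply] at this
      exact this.symm
    rw [h4] at h2
    have hu' : IsUnit (u ^ (k • 1)) := (IsUnit.of_mul_eq_one _ hu).pow _
    have h5 : algebraMap _ L x = 0 := hu'.mul_right_injective (by simpa using h2)
    apply HomogeneousLocalization.val_injective
    rw [Away.val_mk, Localization.mk_eq_mk', HomogeneousLocalization.val_zero,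
      IsLocalization.mk'_eq_mul_mk'_one]
    exact mul_eq_zero_of_left h5 _
  · intro f
    induction f using Polynomial.induction_on' with
    | add f g hf hg =>
      obtain ⟨a, rfl⟩ := hf
      obtain ⟨b, rfl⟩ := hg
      exact ⟨a + b, map_add _ _ _⟩
    | monomial d a =>
      have ha : MvPolynomial.C a ∈ grading (0 • 1) :=
        (MvPolynomial.mem_homogeneousSubmodule _ _).mpr (MvPolynomial.isHomogeneous_C _ _)
      have hT : - sform (ρ⁻¹ 1) ∈ grading (1 • 1) := neg_mem (sform_mem _)
      refine ⟨Away.mk grading (sform_mem (ρ⁻¹ 0)) 0 _ ha *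
        Away.mk grading (sform_mem (ρ⁻¹ 0)) 1 _ hT ^ d, ?_⟩
      rw [map_mul, map_pow, hmk, hmk, map_neg, aeval_permCoord, ← Polynomial.C_mul_X_pow_eq_monomial]
      simp [sval]

instance isOpenImmersion_permPoint (ρ : Equiv.Perm (Fin 3)) :
    IsOpenImmersion (permPoint ρ (Polynomial.X : Polynomial ℂ)) := by
  let e := RingEquiv.ofBijective _ (bijective_coordHom_permCoord ρ)
  have : IsIso (Spec.map (CommRingCat.ofHom (coordHom (sform (ρ⁻¹ 0))
      (permCoord ρ (Polynomial.X : Polynomial ℂ)) (isUnit_aeval_permCoord ρ _)))) :=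
    (Scheme.Spec.mapIso e.toCommRingCatIso.op).isIso_hom
  rw [permPoint, coordPoint]
  infer_instance

lemma range_permPoint (ρ : Equiv.Perm (Fin 3)) :
    Set.range (permPoint ρ (Polynomial.X : Polynomial ℂ)) = (mark (ρ⁻¹ 0))ᶜ := by
  let e := RingEquiv.ofBijective _ (bijective_coordHom_permCoord ρ)
  have : IsIso (Spec.map (CommRingCat.ofHom (coordHom (sform (ρ⁻¹ 0))
      (permCoord ρ (Polynomial.X : Polynomial ℂ)) (isUnit_aeval_permCoord ρ _)))) :=
    (Scheme.Spec.mapIso e.toCommRingCatIso.op).isIso_hom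
  rw [mark_eq, compl_compl, ← Proj.opensRange_awayι grading _ (sform_mem _) Nat.one_pos,
    permPoint, coordPoint]
  exact congrArg (fun U : P1.Opens ↦ (U : Set P1)) (Scheme.Hom.opensRange_comp_of_isIso
    (Spec.map (CommRingCat.ofHom (coordHom (sform (ρ⁻¹ 0))
      (permCoord ρ (Polynomial.X : Polynomial ℂ)) (isUnit_aeval_permCoord ρ _)))) _)

/-- As the three forms sum to zero, any two of them generate both coordinates, hence the irrelevant
ideal, which no point of `Proj` contains. -/
lemma disjoint_mark {i j : Fin 3} (h : i ≠ j) : Disjoint (mark i) (mark j) := by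
  rw [Set.disjoint_left]
  intro x hi hj
  rw [mark_eq, Set.mem_compl_iff, SetLike.mem_coe, Proj.mem_basicOpen, not_not] at hi hj
  set I := x.asHomogeneousIdeal.toIdeal
  replace hi : sform i ∈ I := hi
  replace hj : sform j ∈ I := hj
  have h2 : sform 2 = -(sform 0 + sform 1) := by
    simp only [sform, Matrix.cons_val]
    ring
  have h01 : sform 0 ∈ I ∧ sform 1 ∈ I := by
    have e0 : sform 0 = -(sform 1 + sform 2) := by rw [h2]; ring
    have e1 : sform 1 = -(sform 0 + sform 2) := by rw [h2]; ring
    fin_cases i <;> fin_cases j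
    · exact absurd rfl h
    · exact ⟨hi, hj⟩
    · exact ⟨hi, e1 ▸ neg_mem (add_mem hi hj)⟩
    · exact ⟨hj, hi⟩
    · exact absurd rfl h
    · exact ⟨e0 ▸ neg_mem (add_mem hi hj), hi⟩
    · exact ⟨hj, e1 ▸ neg_mem (add_mem hj hi)⟩
    · exact ⟨e0 ▸ neg_mem (add_mem hj hi), hj⟩
    · exact absurd rfl h
  apply x.not_irrelevant_le
  intro p hp
  change p ∈ I
  have hX : Ideal.span ((MvPolynomial.X : Fin 2 → MvPolynomial (Fin 2) ℂ) '' Set.univ) ≤ I := by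
    rw [Ideal.span_le]
    rintro _ ⟨j, -, rfl⟩
    fin_cases j
    · exact h01.1
    · exact neg_mem_iff.mp h01.2
  apply hX
  rw [MvPolynomial.mem_ideal_span_X_image]
  intro e he
  by_contra! h0
  have he0 : e = 0 := Finsupp.ext fun i ↦ h0 i trivial
  rw [HomogeneousIdeal.mem_irrelevant_iff, GradedRing.proj_apply] at hp
  replace hp := (MvPolynomial.decomposition.decompose'_apply p 0).symm.trans hp
  rw [MvPolynomial.homogeneousComponent_zero] at hp
  rw [MvPolynomial.mem_support_iff, he0] at he
  exact he (by simpa using hp)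

end AbelianCover

end

/-! ### Affine charts of `ℙ¹ × ℙ¹` and the complement of the seven curves -/

open CategoryTheory CategoryTheory.Limits AlgebraicGeometry
noncomputable section
namespace AbelianCover

attribute [local instance] MvPolynomial.gradedAlgebra

section

variable {A : Type} [CommRing A] [Algebra ℂ A]

/-- The point of `ℙ¹ × ℙ¹` whose coordinates are the images of `a` and `b` under the automorphism
of the projective line which permutes the three marked points. -/
def permPoint₂ (ρ : Equiv.Perm (Fin 3)) (a b : A) : Spec (CommRingCat.of A) ⟶ P1xP1 :=
  pullback.lift (permPoint ρ a) (permPoint ρ b) (by rw [permPoint_toPt, permPoint_toPt])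

lemma permPoint₂_fst (ρ : Equiv.Perm (Fin 3)) (a b : A) : permPoint₂ ρ a b ≫ pr₁ = permPoint ρ a :=
  pullback.lift_fst _ _ _

lemma permPoint₂_snd (ρ : Equiv.Perm (Fin 3)) (a b : A) : permPoint₂ ρ a b ≫ pr₂ = permPoint ρ b :=
  pullback.lift_snd _ _ _

lemma SpecMap_permPoint₂ {A' : Type} [CommRing A'] [Algebra ℂ A'] (f : A →ₐ[ℂ] A')
    (ρ : Equiv.Perm (Fin 3)) (a b : A) :
    Spec.map (CommRingCat.ofHom f.toRingHom) ≫ permPoint₂ ρ a b = permPoint₂ ρ (f a) (f b) := by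
  apply pullback.hom_ext
  · rw [Category.assoc, permPoint₂_fst, permPoint₂_fst, SpecMap_permPoint]
  · rw [Category.assoc, permPoint₂_snd, permPoint₂_snd, SpecMap_permPoint]

/-- Every such point is the composite of the morphism `X ↦ c` to the affine line with the open
immersion `permPoint ρ X`, and open immersions are monomorphisms. -/
lemma permPoint_injective (ρ : Equiv.Perm (Fin 3)) {a b : A} (h : permPoint ρ a = permPoint ρ b) :
    a = b := by
  have key (c : A) : permPoint ρ c = Spec.map (CommRingCat.ofHom
      (Polynomial.aeval (R := ℂ) c).toRingHom) ≫ permPoint ρ (Polynomial.X : Polynomial ℂ) := by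
    rw [SpecMap_permPoint, Polynomial.aeval_X]
  rw [key a, key b, cancel_mono] at h
  have := congr($(Spec.map_injective h).hom (Polynomial.X : Polynomial ℂ))
  simpa using this

lemma fst_mem_mark (ρ : Equiv.Perm (Fin 3)) (a b : A) (i : Fin 3) (p : Spec (CommRingCat.of A)) :
    pr₁ (permPoint₂ ρ a b p) ∈ mark i ↔ sval a (ρ i) ∈ p.asIdeal := by
  rw [← Scheme.Hom.comp_apply, permPoint₂_fst, permPoint_mem_mark]

lemma snd_mem_mark (ρ : Equiv.Perm (Fin 3)) (a b : A) (i : Fin 3) (p : Spec (CommRingCat.of A)) :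
    pr₂ (permPoint₂ ρ a b p) ∈ mark i ↔ sval b (ρ i) ∈ p.asIdeal := by
  rw [← Scheme.Hom.comp_apply, permPoint₂_snd, permPoint_mem_mark]

/-- This can be tested over residue fields, where the two coordinates agree as morphisms to `ℙ¹`
exactly when the images of `a` and `b` are equal, by `permPoint_injective`. -/
lemma mem_range_diagonal (ρ : Equiv.Perm (Fin 3)) (a b : A) (p : Spec (CommRingCat.of A)) :
    permPoint₂ ρ a b p ∈ Set.range (pullback.diagonal P1.toPt) ↔ b - a ∈ p.asIdeal := by
  constructor
  · rintro ⟨q, hq⟩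
    obtain ⟨z, hz1, -⟩ := Scheme.Pullback.exists_preimage_pullback p q hq.symm
    let k := (pullback (permPoint₂ ρ a b) (pullback.diagonal P1.toPt)).residueField z
    let e := (pullback (permPoint₂ ρ a b) (pullback.diagonal P1.toPt)).fromSpecResidueField z
    obtain ⟨f, hf⟩ := Spec.map_surjective (e ≫ pullback.fst _ _)
    let : Algebra ℂ k := (f.hom.comp (algebraMap ℂ A)).toAlgebra
    let g : A →ₐ[ℂ] k := { f.hom with commutes' := fun _ ↦ rfl }
    have hg : Spec.map (CommRingCat.ofHom g.toRingHom) = e ≫ pullback.fst _ _ := hf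
    have h1 : permPoint ρ (g a) = permPoint ρ (g b) := by
      rw [← SpecMap_permPoint, ← SpecMap_permPoint, hg, ← permPoint₂_fst ρ a b,
        ← permPoint₂_snd ρ a b, Category.assoc, Category.assoc, pullback.condition_assoc,
        pullback.condition_assoc, pullback.diagonal_fst, pullback.diagonal_snd]
    have h2 := permPoint_injective ρ h1
    have h3 : p = Spec.map f (IsLocalRing.closedPoint k) := by
      refine Eq.trans ?_ (congrArg (fun φ : Spec _ ⟶ Spec (CommRingCat.of A) ↦
        φ (IsLocalRing.closedPoint k)) hf.symm)
      exact hz1.symm.trans (congrArg (pullback.fst (permPoint₂ ρ a b) _)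
        (Scheme.fromSpecResidueField_apply _ _).symm)
    rw [h3]
    change f.hom (b - a) ∈ (IsLocalRing.closedPoint k).asIdeal
    have : f.hom (b - a) = 0 := by
      rw [map_sub, sub_eq_zero]
      exact h2.symm
    rw [this]
    exact zero_mem _
  · intro h
    have := p.isPrime
    let k := p.asIdeal.ResidueField
    let g : A →ₐ[ℂ] k := IsScalarTower.toAlgHom ℂ A k
    have h1 : g a = g b := by
      rw [← sub_eq_zero, ← neg_eq_zero, ← map_sub, ← map_neg, neg_sub]
      exact Ideal.algebraMap_residueField_eq_zero.mpr h
    have h2 : permPoint₂ ρ (g a) (g b) = permPoint ρ (g a) ≫ pullback.diagonal P1.toPt := by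
      apply pullback.hom_ext
      · rw [permPoint₂_fst, Category.assoc, pullback.diagonal_fst, Category.comp_id]
      · rw [permPoint₂_snd, Category.assoc, pullback.diagonal_snd, Category.comp_id, h1]
    have h3 : p = Spec.map (CommRingCat.ofHom g.toRingHom) (IsLocalRing.closedPoint k) := by
      apply PrimeSpectrum.ext
      change _ = (IsLocalRing.maximalIdeal k).comap (algebraMap A k)
      rw [IsLocalRing.maximalIdeal_eq_bot, ← RingHom.ker_eq_comap_bot,
        Ideal.ker_algebraMap_residueField]
    have h4 := (SpecMap_permPoint₂ g ρ a b).trans h2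
    refine ⟨permPoint ρ (g a) (IsLocalRing.closedPoint k), ?_⟩
    exact (congrArg (fun φ : Spec (CommRingCat.of k) ⟶ P1xP1 ↦ φ (IsLocalRing.closedPoint k)) h4).symm.trans
      (congrArg (permPoint₂ ρ a b) h3.symm)

end

/-- The polynomial ring `ℂ[x, y]`. -/
abbrev PolyXY : Type := MvPolynomial (Fin 2) ℂ

/-- The affine chart `𝔸² ⟶ ℙ¹ × ℙ¹` which corresponds to a permutation of the marked points. -/
def permChart (ρ : Equiv.Perm (Fin 3)) : Spec (CommRingCat.of PolyXY) ⟶ P1xP1 :=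
  permPoint₂ ρ (MvPolynomial.X 0 : PolyXY) (MvPolynomial.X 1)

/-- With the affine plane as the product of two affine lines, `permChart` becomes a product of open
immersions. -/
lemma isPushout_polyXY : IsPushout (CommRingCat.ofHom (algebraMap ℂ (Polynomial ℂ)))
    (CommRingCat.ofHom (algebraMap ℂ (Polynomial ℂ)))
    (CommRingCat.ofHom (Polynomial.aeval (R := ℂ) (MvPolynomial.X 0 : PolyXY)).toRingHom)
    (CommRingCat.ofHom (Polynomial.aeval (R := ℂ) (MvPolynomial.X 1 : PolyXY)).toRingHom) := by
  refine ⟨⟨?_⟩, ⟨PushoutCocone.IsColimit.mk _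
    (fun s ↦ CommRingCat.ofHom (MvPolynomial.eval₂Hom (s.inl.hom.comp (algebraMap ℂ (Polynomial ℂ)))
      ![s.inl (Polynomial.X : Polynomial ℂ), s.inr (Polynomial.X : Polynomial ℂ)])) ?_ ?_ ?_⟩⟩
  · rw [← CommRingCat.ofHom_comp, ← CommRingCat.ofHom_comp]
    congr 1
    ext c
    simp
  · intro s
    ext : 1
    apply Polynomial.ringHom_ext
    · intro c
      simp
    · simp
  · intro s
    have h (c : ℂ) := congr($(s.condition).hom c)
    simp only [CommRingCat.hom_comp, CommRingCat.hom_ofHom, RingHom.comp_apply] at h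
    ext : 1
    apply Polynomial.ringHom_ext
    · intro c
      simpa using h c
    · simp
  · intro s m h1 h2
    ext : 1
    apply MvPolynomial.ringHom_ext
    · intro c
      have := congr($(h1).hom (Polynomial.C c))
      simpa using this
    · intro i
      have h1' := congr($(h1).hom (Polynomial.X : Polynomial ℂ))
      have h2' := congr($(h2).hom (Polynomial.X : Polynomial ℂ))
      fin_cases i
      · simpa using h1'
      · simpa using h2'

lemma isPullback_polyXY : IsPullback
    (Spec.map (CommRingCat.ofHom (Polynomial.aeval (R := ℂ) (MvPolynomial.X 0 : PolyXY)).toRingHom))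
    (Spec.map (CommRingCat.ofHom (Polynomial.aeval (R := ℂ) (MvPolynomial.X 1 : PolyXY)).toRingHom))
    (Spec.map (CommRingCat.ofHom (algebraMap ℂ (Polynomial ℂ))))
    (Spec.map (CommRingCat.ofHom (algebraMap ℂ (Polynomial ℂ)))) :=
  isPullback_SpecMap_of_isPushout _ _ _ _ isPushout_polyXY

lemma permChart_eq (ρ : Equiv.Perm (Fin 3)) : permChart ρ = isPullback_polyXY.isoPullback.hom ≫
    pullback.map _ _ _ _ (permPoint ρ (Polynomial.X : Polynomial ℂ))
      (permPoint ρ (Polynomial.X : Polynomial ℂ)) (𝟙 pt)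
      (by rw [permPoint_toPt, Category.comp_id]) (by rw [permPoint_toPt, Category.comp_id]) := by
  apply pullback.hom_ext
  · rw [permChart, permPoint₂_fst, Category.assoc, pullback.lift_fst,
      IsPullback.isoPullback_hom_fst_assoc, SpecMap_permPoint, Polynomial.aeval_X]
  · rw [permChart, permPoint₂_snd, Category.assoc, pullback.lift_snd,
      IsPullback.isoPullback_hom_snd_assoc, SpecMap_permPoint, Polynomial.aeval_X]

instance isOpenImmersion_permChart (ρ : Equiv.Perm (Fin 3)) : IsOpenImmersion (permChart ρ) := by
  rw [permChart_eq]
  infer_instance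

lemma mem_range_permChart (ρ : Equiv.Perm (Fin 3)) (z : P1xP1) :
    z ∈ Set.range (permChart ρ) ↔ pr₁ z ∉ mark (ρ⁻¹ 0) ∧ pr₂ z ∉ mark (ρ⁻¹ 0) := by
  rw [permChart_eq]
  have h := Scheme.Pullback.range_map (f := Spec.map (CommRingCat.ofHom (algebraMap ℂ (Polynomial ℂ))))
    (g := Spec.map (CommRingCat.ofHom (algebraMap ℂ (Polynomial ℂ)))) P1.toPt P1.toPt
      (permPoint ρ (Polynomial.X : Polynomial ℂ))
      (permPoint ρ (Polynomial.X : Polynomial ℂ)) (𝟙 pt)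
      (by rw [permPoint_toPt, Category.comp_id]) (by rw [permPoint_toPt, Category.comp_id])
  rw [range_permPoint] at h
  have h2 : Set.range (isPullback_polyXY.isoPullback.hom ≫
    pullback.map _ _ _ _ (permPoint ρ (Polynomial.X : Polynomial ℂ))
      (permPoint ρ (Polynomial.X : Polynomial ℂ)) (𝟙 pt)
      (by rw [permPoint_toPt, Category.comp_id]) (by rw [permPoint_toPt, Category.comp_id])) =
    Set.range (pullback.map _ _ P1.toPt P1.toPt (permPoint ρ (Polynomial.X : Polynomial ℂ))
      (permPoint ρ (Polynomial.X : Polynomial ℂ)) (𝟙 pt)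
      (by rw [permPoint_toPt, Category.comp_id]) (by rw [permPoint_toPt, Category.comp_id])) :=
    congrArg (fun U : P1xP1.Opens ↦ (U : Set P1xP1)) (Scheme.Hom.opensRange_comp_of_isIso _ _)
  rw [h2, h]
  rfl

/-- If the linear forms `x₀` and so on take the same values at `a`, `a'` up to a unit, then
`a'` is the image of `a` under a permutation of the marked points. -/
lemma permPoint₂_eq_chart {a b : R} (ρ : Equiv.Perm (Fin 3)) (ha : IsUnit (sval a (ρ 0)))
    (hb : IsUnit (sval b (ρ 0))) (hx : xc * sval a (ρ 0) = - sval a (ρ 1))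
    (hy : yc * sval b (ρ 0) = - sval b (ρ 1)) : permPoint₂ ρ a b = chart := by
  apply pullback.hom_ext
  · rw [permPoint₂_fst, permPoint_eq_affPoint ρ a xc ha hx, chart, pullback.lift_fst]
  · rw [permPoint₂_snd, permPoint_eq_affPoint ρ b yc hb hy, chart, pullback.lift_snd]

lemma chart_eq : chart = Spec.map (CommRingCat.ofHom (algebraMap PolyXY R)) ≫ permChart 1 := by
  have h := SpecMap_permPoint₂ (IsScalarTower.toAlgHom ℂ PolyXY R) 1 (MvPolynomial.X 0)
    (MvPolynomial.X 1)
  refine Eq.trans ?_ h.symm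
  symm
  apply permPoint₂_eq_chart
  · simp [sval]
  · simp [sval]
  · simp [sval, xc]
  · simp [sval, yc]

instance isOpenImmersion_chart_p1xp1 : IsOpenImmersion chart := by
  rw [chart_eq]
  have : IsOpenImmersion (Spec.map (CommRingCat.ofHom (algebraMap PolyXY R))) :=
    inferInstanceAs (IsOpenImmersion (Spec.map (CommRingCat.ofHom (algebraMap PolyXY
      (Localization.Away disc)))))
  infer_instance

lemma range_chart : Set.range chart = branchCurvesᶜ := by
  ext z
  -- The two curves at infinity do not meet the standard affine plane; the other five are the zero
  -- loci of the factors of `disc`.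
  have hd (p : Spec (CommRingCat.of PolyXY)) : permChart 1 p ∈ branchCurves ↔
      disc ∈ p.asIdeal := by
    have h0 : (1 : PolyXY) ∉ p.asIdeal := fun h ↦ p.isPrime.ne_top
      ((Ideal.eq_top_iff_one _).mpr h)
    simp only [branchCurves, Set.mem_union, Set.mem_iUnion, Set.mem_preimage, permChart,
      fst_mem_mark, snd_mem_mark, mem_range_diagonal, Fin.exists_fin_succ, sval, disc,
      p.isPrime.mul_mem_iff_mem_or_mem, Equiv.Perm.one_apply]
    simp [h0, or_assoc]
  constructor
  · rintro ⟨q, rfl⟩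
    rw [chart_eq, Scheme.Hom.comp_apply, Set.mem_compl_iff, hd]
    intro h
    change algebraMap PolyXY R disc ∈ q.asIdeal at h
    exact q.isPrime.ne_top (Ideal.eq_top_of_isUnit_mem _ h
      (IsLocalization.Away.algebraMap_isUnit disc))
  · intro hz
    have hz' : z ∈ Set.range (permChart 1) := by
      rw [mem_range_permChart]
      constructor
      · exact fun h ↦ hz (Or.inl (Or.inl (Set.mem_iUnion.mpr ⟨_, h⟩)))
      · exact fun h ↦ hz (Or.inl (Or.inr (Set.mem_iUnion.mpr ⟨_, h⟩)))
    obtain ⟨p, rfl⟩ := hz'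
    rw [Set.mem_compl_iff, hd] at hz
    have hp : p ∈ Set.range (PrimeSpectrum.comap (algebraMap PolyXY R)) := by
      rw [PrimeSpectrum.localization_away_comap_range R disc]
      exact hz
    obtain ⟨q, hq⟩ := hp
    refine ⟨q, ?_⟩
    rw [chart_eq]
    exact congrArg (permChart 1) hq

lemma support_centre : (centre.support : Set P1xP1) = ⋃ i, diagMark i := by
  simp [centre]

/-- An ideal sheaf with empty support is trivial, and the support of `centre` consists of the points
lying over the same mark in both factors. -/
lemma comap_centre_eq_top {W : Scheme.{0}} (f : W ⟶ P1xP1)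
    (h : ∀ w : W, ∀ i, pr₁ (f w) ∈ mark i → pr₂ (f w) ∉ mark i) : centre.comap f = ⊤ := by
  rw [← Scheme.IdealSheafData.support_eq_bot_iff, Scheme.IdealSheafData.support_comap]
  ext w
  simp only [TopologicalSpace.Closeds.coe_bot, Set.mem_empty_iff_false, iff_false]
  intro hw
  have hw' : f w ∈ (centre.support : Set P1xP1) := hw
  rw [support_centre, Set.mem_iUnion] at hw'
  obtain ⟨i, h1, h2⟩ := hw'
  exact h w i h1 h2

lemma comap_chart_centre : centre.comap chart = ⊤ := by
  apply comap_centre_eq_top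
  intro w i h
  have : chart w ∈ branchCurvesᶜ := range_chart ▸ ⟨w, rfl⟩
  exact (this (show chart w ∈ branchCurves from
    Or.inl (Or.inl (Set.mem_iUnion.mpr ⟨i, h⟩)))).elim

end AbelianCover

end

/-! ### Coordinates on localizations of `ℂ[X, Y]` -/

open CategoryTheory CategoryTheory.Limits AlgebraicGeometry
noncomputable section
namespace AbelianCover

lemma span_X_eq_ker : Ideal.span {(MvPolynomial.X 0 : PolyXY), MvPolynomial.X 1} =
    RingHom.ker (MvPolynomial.constantCoeff (σ := Fin 2) (R := ℂ)) := by
  have : ({MvPolynomial.X 0, MvPolynomial.X 1} : Set PolyXY) =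
      (MvPolynomial.X : Fin 2 → PolyXY) '' Set.univ := by
    ext x
    simp [Fin.exists_fin_two, eq_comm]
  ext p
  rw [this, MvPolynomial.mem_ideal_span_X_image, RingHom.mem_ker, MvPolynomial.constantCoeff_eq]
  constructor
  · intro h
    by_contra h0
    obtain ⟨i, -, hi⟩ := h 0 (MvPolynomial.mem_support_iff.mpr h0)
    exact hi rfl
  · intro h e he
    by_contra! h0
    obtain rfl : e = 0 := Finsupp.ext fun i ↦ h0 i trivial
    exact MvPolynomial.mem_support_iff.mp he h

section

variable {h : PolyXY} (hh : MvPolynomial.constantCoeff h ≠ 0) (B : Type) [CommRing B]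
  [Algebra PolyXY B] [IsLocalization.Away h B]

include hh

lemma powers_le_nonZeroDivisors : Submonoid.powers h ≤ nonZeroDivisors PolyXY := by
  apply powers_le_nonZeroDivisors_of_noZeroDivisors
  rintro rfl
  simp at hh

lemma isDomain_localization_of_constantCoeff : IsDomain B :=
  IsLocalization.isDomain_of_le_nonZeroDivisors B (powers_le_nonZeroDivisors hh)

/-- As `h` does not vanish at the origin, its powers avoid every ideal contained in that of the
origin. Thus `(X)`, `(Y)` and `(X, Y)` stay prime in the localization. -/
lemma isPrime_map_of_le {I : Ideal PolyXY} [I.IsPrime]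
    (hI : I ≤ RingHom.ker (MvPolynomial.constantCoeff (σ := Fin 2) (R := ℂ))) :
    (I.map (algebraMap PolyXY B)).IsPrime := by
  apply IsLocalization.isPrime_of_isPrime_disjoint (Submonoid.powers h) B I inferInstance
  rw [Set.disjoint_left]
  rintro _ ⟨k, rfl⟩ hk
  have := hI hk
  rw [RingHom.mem_ker, map_pow] at this
  exact pow_ne_zero k hh this

lemma isPrime_span_pair :
    (Ideal.span {algebraMap PolyXY B (MvPolynomial.X 0), algebraMap PolyXY B (MvPolynomial.X 1)}).IsPrime := by
  have := RingHom.ker_isPrime (MvPolynomial.constantCoeff (σ := Fin 2) (R := ℂ))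
  have h2 := isPrime_map_of_le hh B (I := RingHom.ker MvPolynomial.constantCoeff) le_rfl
  rwa [← span_X_eq_ker, Ideal.map_span, Set.image_pair] at h2

lemma algebraMap_X_ne_zero (i : Fin 2) : algebraMap PolyXY B (MvPolynomial.X i) ≠ 0 := by
  intro h0
  rw [IsLocalization.to_map_eq_zero_iff B (powers_le_nonZeroDivisors hh)] at h0
  exact MvPolynomial.X_ne_zero i h0

lemma prime_algebraMap_X (i : Fin 2) : Prime (algebraMap PolyXY B (MvPolynomial.X i)) := by
  rw [← Ideal.span_singleton_prime (algebraMap_X_ne_zero hh B i)]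
  have : (Ideal.span {(MvPolynomial.X i : PolyXY)}).IsPrime :=
    (Ideal.span_singleton_prime (MvPolynomial.X_ne_zero i)).mpr MvPolynomial.X_prime
  have h2 := isPrime_map_of_le hh B (I := Ideal.span {(MvPolynomial.X i : PolyXY)})
    (by
      rw [Ideal.span_singleton_le_iff_mem, RingHom.mem_ker]
      simp)
  rwa [Ideal.map_span, Set.image_singleton] at h2

end

/-- The elements `a`, `b` are coordinates on `Spec A` which identify it with the complement of the
zero locus of `D` in the affine plane. -/
structure IsCoord {A : Type} [CommRing A] [Algebra ℂ A] (a b : A) (D : PolyXY) : Prop where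
  isUnit : IsUnit (MvPolynomial.aeval ![a, b] D)
  lift : ∀ {T : Type} [CommRing T] [Algebra ℂ T] (a' b' : T),
    IsUnit (MvPolynomial.aeval ![a', b'] D) → ∃ f : A →ₐ[ℂ] T, f a = a' ∧ f b = b'
  ext : ∀ {T : Type} [CommRing T] [Algebra ℂ T] (f g : A →ₐ[ℂ] T), f a = g a → f b = g b → f = g

lemma map_aeval_pair {A T : Type} [CommRing A] [Algebra ℂ A] [CommRing T] [Algebra ℂ T]
    (f : A →ₐ[ℂ] T) (a b : A) (D : PolyXY) :
    f (MvPolynomial.aeval ![a, b] D) = MvPolynomial.aeval ![f a, f b] D := by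
  rw [MvPolynomial.comp_aeval_apply]
  congr 2
  funext i
  fin_cases i <;> rfl

lemma aeval_pair_X {B : Type} [CommRing B] [Algebra ℂ B] [Algebra PolyXY B]
    [IsScalarTower ℂ PolyXY B] (D : PolyXY) : MvPolynomial.aeval
      ![algebraMap PolyXY B (MvPolynomial.X 0), algebraMap PolyXY B (MvPolynomial.X 1)] D =
      algebraMap PolyXY B D := by
  have := map_aeval_pair (IsScalarTower.toAlgHom ℂ PolyXY B) (MvPolynomial.X 0) (MvPolynomial.X 1) D
  have h : MvPolynomial.aeval ![(MvPolynomial.X 0 : PolyXY), MvPolynomial.X 1] D = D := by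
    conv_rhs => rw [← MvPolynomial.aeval_X_left_apply D]
    congr 2
    funext i
    fin_cases i <;> rfl
  rw [h] at this
  exact this.symm

lemma isCoord_localization (D : PolyXY) (B : Type) [CommRing B] [Algebra ℂ B] [Algebra PolyXY B]
    [IsScalarTower ℂ PolyXY B] [IsLocalization.Away D B] :
    IsCoord (algebraMap PolyXY B (MvPolynomial.X 0)) (algebraMap PolyXY B (MvPolynomial.X 1)) D where
  isUnit := by
    rw [aeval_pair_X]
    exact IsLocalization.Away.algebraMap_isUnit D
  lift {T} _ _ a' b' h := by
    let g : PolyXY →ₐ[ℂ] T := MvPolynomial.aeval ![a', b']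
    let f : B →ₐ[ℂ] T :=
      { IsLocalization.Away.lift (S := B) D (g := g.toRingHom) h with
        commutes' := fun c ↦ by
          have := IsLocalization.Away.lift_eq (S := B) D (g := g.toRingHom) h (algebraMap ℂ PolyXY c)
          rw [← IsScalarTower.algebraMap_apply] at this
          exact this.trans (g.commutes c) }
    have hf (p : PolyXY) : f (algebraMap PolyXY B p) = g p :=
      IsLocalization.Away.lift_eq (S := B) D (g := g.toRingHom) h p
    exact ⟨f, by simp [hf, g], by simp [hf, g]⟩
  ext {T} _ _ f g h0 h1 := by
    have h : f.comp (IsScalarTower.toAlgHom ℂ PolyXY B) = g.comp (IsScalarTower.toAlgHom ℂ PolyXY B) := by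
      apply MvPolynomial.algHom_ext
      intro i
      fin_cases i
      · exact h0
      · exact h1
    have h2 : f.toRingHom = g.toRingHom := by
      apply IsLocalization.ringHom_ext (Submonoid.powers D)
      exact congr(($h).toRingHom)
    exact AlgHom.ext fun x ↦ congr($h2 x)

lemma IsCoord.exists_equiv {A : Type} [CommRing A] [Algebra ℂ A] {a b : A} {D : PolyXY}
    (hA : IsCoord a b D) (B : Type) [CommRing B] [Algebra ℂ B] [Algebra PolyXY B]
    [IsScalarTower ℂ PolyXY B] [IsLocalization.Away D B] :
    ∃ e : B ≃ₐ[ℂ] A, e (algebraMap PolyXY B (MvPolynomial.X 0)) = a ∧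
      e (algebraMap PolyXY B (MvPolynomial.X 1)) = b := by
  have hB := isCoord_localization D B
  obtain ⟨f, hf0, hf1⟩ := hB.lift a b hA.isUnit
  obtain ⟨g, hg0, hg1⟩ := hA.lift _ _ hB.isUnit
  exact ⟨AlgEquiv.ofAlgHom f g (hA.ext _ _ (by simp [hf0, hg0]) (by simp [hf1, hg1]))
    (hB.ext _ _ (by simp [hf0, hg0]) (by simp [hf1, hg1])), hf0, hf1⟩

/-- A change of coordinates: by `hback` and `hext`, prescribing values of the new pair amounts to
prescribing values of the old one. -/
lemma IsCoord.of {A : Type} [CommRing A] [Algebra ℂ A] {a b : A} {D : PolyXY}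
    (hA : IsCoord a b D) (a₂ b₂ : A) (D₂ : PolyXY) (hu : IsUnit (MvPolynomial.aeval ![a₂, b₂] D₂))
    (hback : ∀ {T : Type} [CommRing T] [Algebra ℂ T] (a₂' b₂' : T),
      IsUnit (MvPolynomial.aeval ![a₂', b₂'] D₂) → ∃ a' b', IsUnit (MvPolynomial.aeval ![a', b'] D) ∧
        ∀ f : A →ₐ[ℂ] T, f a = a' → f b = b' → f a₂ = a₂' ∧ f b₂ = b₂')
    (hext : ∀ {T : Type} [CommRing T] [Algebra ℂ T] (f g : A →ₐ[ℂ] T), f a₂ = g a₂ → f b₂ = g b₂ →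
      f a = g a ∧ f b = g b) : IsCoord a₂ b₂ D₂ where
  isUnit := hu
  lift a₂' b₂' h := by
    obtain ⟨a', b', h', hf⟩ := hback a₂' b₂' h
    obtain ⟨f, h0, h1⟩ := hA.lift a' b' h'
    exact ⟨f, hf f h0 h1⟩
  ext f g h0 h1 := hA.ext f g (hext f g h0 h1).1 (hext f g h0 h1).2

lemma isCoord_xc_yc : IsCoord xc yc disc := isCoord_localization disc R

/-! ### Möbius transformations and the two forms in permuted coordinates -/

section

variable {A : Type} [CommRing A]

/-- `a'` is the image of `a` under the Möbius transformation with `sval a' j = sval a (σ j) * w`. -/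
def IsMob (σ : Equiv.Perm (Fin 3)) (a a' w : A) : Prop :=
  w * sval a (σ 0) = 1 ∧ a' = -(sval a (σ 1) * w)

variable {σ : Equiv.Perm (Fin 3)} {a a' w : A}

lemma IsMob.sval_eq (h : IsMob σ a a' w) (j : Fin 3) : sval a' j = sval a (σ j) * w := by
  have hs := sum_perm_eq_zero (sval_sum a) σ
  obtain ⟨h1, rfl⟩ := h
  fin_cases j
  · exact (mul_comm _ _).trans h1 |>.symm
  · exact neg_neg _
  · simp only [sval, Fin.reduceFinMk, Matrix.cons_val] at h1 hs ⊢
    linear_combination (-w) * hs + h1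

lemma IsMob.symm (h : IsMob σ a a' w) : IsMob σ⁻¹ a' a (sval a (σ 0)) := by
  refine ⟨?_, ?_⟩
  · rw [h.sval_eq, Equiv.Perm.inv_def, Equiv.apply_symm_apply]
    simpa [sval, mul_comm] using h.1
  · rw [h.sval_eq, Equiv.Perm.inv_def, Equiv.apply_symm_apply, mul_assoc, h.1]
    simp [sval]

lemma IsMob.unique {a'' w' : A} (h : IsMob σ a a' w) (h' : IsMob σ a a'' w') : a' = a'' := by
  have : w = w' := by
    linear_combination w' * h.1 - w * h'.1
  rw [h.2, h'.2, this]

lemma IsMob.map {T : Type} [CommRing T] (f : A →+* T) (h : IsMob σ a a' w) :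
    IsMob σ (f a) (f a') (f w) := by
  refine ⟨?_, ?_⟩
  · rw [← map_sval, ← map_mul, h.1, map_one]
  · rw [← map_sval, ← map_mul, ← map_neg, h.2]

lemma exists_isMob (σ : Equiv.Perm (Fin 3)) (a : A) (h : IsUnit (sval a (σ 0))) :
    ∃ a' w, IsMob σ a a' w := by
  obtain ⟨w, hw⟩ := h.exists_left_inv
  exact ⟨_, w, hw, rfl⟩

lemma IsMob.isUnit (h : IsMob σ a a' w) : IsUnit w := .of_mul_eq_one _ h.1

lemma IsMob.isUnit_sval (h : IsMob σ a a' w) (ha : ∀ j, IsUnit (sval a j)) (j : Fin 3) :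
    IsUnit (sval a' j) := by
  rw [h.sval_eq]
  exact (ha _).mul h.isUnit

/-- Because the three forms sum to zero, all `2 × 2` minors of their values at two points agree up
to sign. -/
lemma exists_sval_sub (i j : Fin 3) (hij : i ≠ j) : ∃ ε : ℤ, IsUnit ε ∧
    ∀ {A : Type} [CommRing A] (a b : A), sval a j * sval b i - sval a i * sval b j = ε * (b - a) := by
  fin_cases i <;> fin_cases j
  · exact absurd rfl hij
  · exact ⟨1, isUnit_one, fun a b ↦ by simp [sval]; ring⟩
  · exact ⟨-1, isUnit_one.neg, fun a b ↦ by simp [sval]⟩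
  · exact ⟨-1, isUnit_one.neg, fun a b ↦ by simp [sval]; ring⟩
  · exact absurd rfl hij
  · exact ⟨1, isUnit_one, fun a b ↦ by simp [sval]; ring⟩
  · exact ⟨1, isUnit_one, fun a b ↦ by simp [sval]⟩
  · exact ⟨-1, isUnit_one.neg, fun a b ↦ by simp [sval]; ring⟩
  · exact absurd rfl hij

/-- The difference of the coordinates is a minor of the values of the forms, so it is scaled by both
factors. This is why the diagonal is preserved. -/
lemma exists_isMob_sub (σ : Equiv.Perm (Fin 3)) : ∃ ε : ℤ, IsUnit ε ∧
    ∀ {A : Type} [CommRing A] {a a' w b b' w' : A}, IsMob σ a a' w → IsMob σ b b' w' →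
      b' - a' = ε * (w * w' * (b - a)) := by
  obtain ⟨ε, hε, h⟩ := exists_sval_sub (σ 0) (σ 1) (by simp)
  refine ⟨ε, hε, fun {A} _ {a a' w b b' w'} h1 h2 ↦ ?_⟩
  have h3 := h a b
  rw [h1.2, h2.2]
  linear_combination w * w' * h3 + sval b (σ 1) * w' * h1.1 - sval a (σ 1) * w * h2.1

lemma isUnit_aeval_disc [Algebra ℂ A] (a b : A) : IsUnit (MvPolynomial.aeval ![a, b] disc) ↔
    (∀ i, IsUnit (sval a i)) ∧ (∀ i, IsUnit (sval b i)) ∧ IsUnit (b - a) := by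
  simp only [disc, map_mul, map_sub, map_one, MvPolynomial.aeval_X, IsUnit.mul_iff,
    Fin.forall_fin_succ, sval]
  simp [and_assoc]

lemma IsMob.isUnit_disc [Algebra ℂ A] {b b' w' : A} (h : IsMob σ a a' w) (h' : IsMob σ b b' w')
    (hu : IsUnit (MvPolynomial.aeval ![a, b] disc)) :
    IsUnit (MvPolynomial.aeval ![a', b'] disc) := by
  rw [isUnit_aeval_disc] at hu ⊢
  obtain ⟨ε, hε, hs⟩ := exists_isMob_sub σ
  refine ⟨h.isUnit_sval hu.1, h'.isUnit_sval hu.2.1, ?_⟩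
  rw [hs h h']
  exact (hε.map (Int.castRingHom A)).mul ((h.isUnit.mul h'.isUnit).mul hu.2.2)

end

/-- The new coordinates are the images of `xc` and `yc` under the transformation of `ρ⁻¹`. It is
applied to both factors, so that it also preserves the diagonal and the complement of the seven
curves. -/
lemma exists_coord (ρ : Equiv.Perm (Fin 3)) : ∃ x' y' w w' : R, IsCoord x' y' disc ∧
    permPoint₂ ρ x' y' = chart ∧ IsMob ρ x' xc w ∧ IsMob ρ y' yc w' := by
  have hu := (isUnit_aeval_disc xc yc).mp isCoord_xc_yc.isUnit
  obtain ⟨x', w, hx⟩ := exists_isMob ρ⁻¹ xc (hu.1 _)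
  obtain ⟨y', w', hy⟩ := exists_isMob ρ⁻¹ yc (hu.2.1 _)
  have hx' := hx.symm
  have hy' := hy.symm
  rw [inv_inv] at hx' hy'
  refine ⟨x', y', _, _, ?_, ?_, hx', hy'⟩
  · refine isCoord_xc_yc.of x' y' disc (hx.isUnit_disc hy isCoord_xc_yc.isUnit) ?_ ?_
    · intro T _ _ a b h
      have h' := (isUnit_aeval_disc a b).mp h
      obtain ⟨a', v, ha⟩ := exists_isMob ρ a (h'.1 _)
      obtain ⟨b', v', hb⟩ := exists_isMob ρ b (h'.2.1 _)
      refine ⟨a', b', ha.isUnit_disc hb h, fun f h0 h1 ↦ ⟨?_, ?_⟩⟩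
      · have := hx.map f.toRingHom
        simp only [AlgHom.toRingHom_eq_coe, RingHom.coe_coe, h0] at this
        exact this.unique ha.symm
      · have := hy.map f.toRingHom
        simp only [AlgHom.toRingHom_eq_coe, RingHom.coe_coe, h1] at this
        exact this.unique hb.symm
    · intro T _ _ f g h0 h1
      have h2 := hx'.map f.toRingHom
      have h3 := hy'.map f.toRingHom
      simp only [AlgHom.toRingHom_eq_coe, RingHom.coe_coe, h0, h1] at h2 h3
      exact ⟨h2.unique (hx'.map g.toRingHom), h3.unique (hy'.map g.toRingHom)⟩
  · have h (a a' w : R) (hm : IsMob ρ a a' w) : IsUnit (sval a (ρ 0)) ∧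
        a' * sval a (ρ 0) = -sval a (ρ 1) :=
      ⟨.of_mul_eq_one_right _ hm.1, by rw [hm.2]; linear_combination (-sval a (ρ 1)) * hm.1⟩
    exact permPoint₂_eq_chart ρ (h _ _ _ hx').1 (h _ _ _ hy').1 (h _ _ _ hx').2 (h _ _ _ hy').2

/-- The product of powers of the linear forms in `x`, in `y`, and of `y - x`. -/
def prodForm {A : Type} [CommRing A] (a b : Fin 3 → ℕ) (e : ℕ) (x y : A) : A :=
  (∏ j, sval x j ^ a j) * (∏ j, sval y j ^ b j) * (y - x) ^ e

lemma map_prodForm {A A' : Type} [CommRing A] [CommRing A'] (f : A →+* A') (a b : Fin 3 → ℕ)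
    (e : ℕ) (x y : A) : f (prodForm a b e x y) = prodForm a b e (f x) (f y) := by
  simp [prodForm, map_sval]

/-- Each linear form in `x` or `y` contributes a factor `w` or `w'`, and each `y - x` contributes
both. As the degrees in `x` and in `y` are divisible by `n`, these factors form an `n`-th power. -/
lemma prodForm_mob {A : Type} [CommRing A] (ρ : Equiv.Perm (Fin 3)) {x x' w y y' w' : A}
    (hx : IsMob ρ x' x w) (hy : IsMob ρ y' y w') (a b : Fin 3 → ℕ) (e n : ℕ)
    (ha : ∑ j, a j + e = n) (hb : n ∣ ∑ j, b j + e) :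
    ∃ (c : A) (ε : ℤ), IsUnit c ∧ IsUnit ε ∧
      prodForm a b e x y = c ^ n * (ε * prodForm (a ∘ (ρ⁻¹ : Equiv.Perm (Fin 3)))
        (b ∘ (ρ⁻¹ : Equiv.Perm (Fin 3))) e x' y') := by
  obtain ⟨ε, hε, hs⟩ := exists_isMob_sub ρ
  obtain ⟨q, hq⟩ := hb
  have key (a : Fin 3 → ℕ) (x x' w : A) (hx : IsMob ρ x' x w) : ∏ j, sval x j ^ a j =
      (∏ j, sval x' j ^ (a ∘ (ρ⁻¹ : Equiv.Perm (Fin 3))) j) * w ^ ∑ j, a j := by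
    rw [← Equiv.prod_comp ρ (fun j ↦ sval x' j ^ _), ← Finset.prod_pow_eq_pow_sum, ← Finset.prod_mul_distrib]
    refine Finset.prod_congr rfl fun j _ ↦ ?_
    rw [hx.sval_eq, mul_pow]
    simp
  -- The degree in `y` is `n q`. It will be `n` for the first form and `0` for the second, which
  -- does not involve `y`.
  refine ⟨w * w' ^ q, ε ^ e, hx.isUnit.mul (hy.isUnit.pow q), hε.pow e, ?_⟩
  have hc : (w * w' ^ q) ^ n = w ^ n * w' ^ (∑ j, b j + e) := by
    rw [mul_pow, ← pow_mul, mul_comm q n, ← hq]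
  rw [prodForm, prodForm, key a x x' w hx, key b y y' w' hy, hs hx hy, hc, ← ha]
  generalize y' - x' = D
  push_cast
  ring

/-- `X` as an element of a localization of `ℂ[X, Y]`. -/
abbrev sX (B : Type) [CommRing B] [Algebra PolyXY B] : B := algebraMap PolyXY B (MvPolynomial.X 0)

/-- `Y` as an element of a localization of `ℂ[X, Y]`. -/
abbrev sY (B : Type) [CommRing B] [Algebra PolyXY B] : B := algebraMap PolyXY B (MvPolynomial.X 1)

/-- The functions `f`, `g` on the complement of the seven curves are, up to `n`-th powers and up to
invertible functions on `Spec B`, monomials in `s`, `t ∈ B` whose matrix of exponents has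
determinant prime to `n`. -/
def IsMonomialPair (n : ℕ) {B : Type} [CommRing B] (i : B →+* R) (s t : B) (f g : R) : Prop :=
  ∃ (c c' : R) (u v : B) (a b d e : ℕ), IsUnit c ∧ IsUnit c' ∧ IsUnit u ∧ IsUnit v ∧
    f = c ^ n * i (u * s ^ a * t ^ b) ∧ g = c' ^ n * i (v * s ^ d * t ^ e) ∧
    IsCoprime ((a : ℤ) * e - b * d) n

/-- The point `z` has an affine open neighbourhood `Spec B`, with `B` a localization of
`ℂ[s, t]`, on which the inverse image of the seven curves is the divisor `s t = 0`, and `f`, `g` are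
monomials as above. -/
def HasCorner {Z : Scheme.{0}} (π : Z ⟶ P1xP1) (n : ℕ) (f g : R) (z : Z) : Prop :=
  ∃ (h : PolyXY) (i : Localization.Away h →ₐ[ℂ] R)
    (b : Spec (CommRingCat.of (Localization.Away h)) ⟶ Z),
    MvPolynomial.constantCoeff h ≠ 0 ∧ IsOpenImmersion b ∧ z ∈ Set.range b ∧
    Spec.map (CommRingCat.ofHom i.toRingHom) ≫ b ≫ π = chart ∧
    IsCoord (i (sX _)) (i (sY _)) (h * MvPolynomial.X 0 * MvPolynomial.X 1) ∧
    IsMonomialPair n i.toRingHom (sX _) (sY _) f g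

lemma IsMonomialPair.comp {n : ℕ} {B B' : Type} [CommRing B] [CommRing B'] {i : B →+* R}
    {s t : B} {f g : R} (h : IsMonomialPair n i s t f g) (i' : B' →+* R) (j : B →+* B') (s' t' : B')
    (hi : i'.comp j = i) (hs : j s = s') (ht : j t = t') : IsMonomialPair n i' s' t' f g := by
  obtain ⟨c, c', u, v, a, b, d, e, hc, hc', hu, hv, hf, hg, hco⟩ := h
  refine ⟨c, c', j u, j v, a, b, d, e, hc, hc', hu.map j, hv.map j, ?_, ?_, hco⟩
  · rw [hf, ← hi, ← hs, ← ht]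
    simp
  · rw [hg, ← hi, ← hs, ← ht]
    simp

/-- A chart of `Z` on which the forms become monomials gives a corner. -/
lemma HasCorner.mk {Z : Scheme.{0}} {π : Z ⟶ P1xP1} {n : ℕ} {f g : R} {z : Z} (h : PolyXY)
    (hh : MvPolynomial.constantCoeff h ≠ 0) (B : Type) [CommRing B] [Algebra ℂ B]
    [Algebra PolyXY B] [IsScalarTower ℂ PolyXY B] [IsLocalization.Away h B]
    (β : Spec (CommRingCat.of B) ⟶ Z) [IsOpenImmersion β] (hz : z ∈ Set.range β)
    (ρ : Equiv.Perm (Fin 3)) (x y : B) (hb : β ≫ π = permPoint₂ ρ x y)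
    {x' y' : R} (hchart : permPoint₂ ρ x' y' = chart)
    (s' t' : R) (hst : IsCoord s' t' (h * MvPolynomial.X 0 * MvPolynomial.X 1))
    (hxy : ∀ i : B →ₐ[ℂ] R, i (sX B) = s' → i (sY B) = t' → i x = x' ∧ i y = y')
    {af bf ag bg : Fin 3 → ℕ} {ef eg : ℕ} {cf cg : R} {εf εg : ℤ} (hcf : IsUnit cf) (hcg : IsUnit cg)
    (hεf : IsUnit εf) (hεg : IsUnit εg)
    (hf : f = cf ^ n * (εf * prodForm af bf ef x' y'))
    (hg : g = cg ^ n * (εg * prodForm ag bg eg x' y'))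
    (u v : B) (a b d e : ℕ) (hu : IsUnit u) (hv : IsUnit v)
    (hfB : prodForm af bf ef x y = u * sX B ^ a * sY B ^ b)
    (hgB : prodForm ag bg eg x y = v * sX B ^ d * sY B ^ e)
    (hco : IsCoprime ((a : ℤ) * e - b * d) n) : HasCorner π n f g z := by
  have hu' := hst.isUnit
  simp only [map_mul, IsUnit.mul_iff] at hu'
  obtain ⟨i, hi0, hi1⟩ := (isCoord_localization h B).lift s' t' hu'.1.1
  obtain ⟨hix, hiy⟩ := hxy i hi0 hi1
  obtain ⟨e', he0, he1⟩ := (isCoord_localization h B).exists_equiv (Localization.Away h)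
  have hiso : IsIso (Spec.map (CommRingCat.ofHom e'.symm.toAlgHom.toRingHom)) :=
    (Scheme.Spec.mapIso e'.symm.toRingEquiv.toCommRingCatIso.op).isIso_hom
  have hcomp : (i.comp e'.toAlgHom).toRingHom.comp e'.symm.toAlgHom.toRingHom = i.toRingHom := by
    ext r
    simp
  refine ⟨h, i.comp e'.toAlgHom, Spec.map (CommRingCat.ofHom e'.symm.toAlgHom.toRingHom) ≫ β, hh,
    inferInstance, ?_, ?_, ?_, ?_⟩
  · obtain ⟨q, rfl⟩ := hz
    refine ⟨inv (Spec.map (CommRingCat.ofHom e'.symm.toAlgHom.toRingHom)) q, ?_⟩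
    rw [← Scheme.Hom.comp_apply, IsIso.inv_hom_id_assoc]
  · rw [Category.assoc, hb, ← Spec.map_comp_assoc, ← CommRingCat.ofHom_comp, hcomp,
      SpecMap_permPoint₂, hix, hiy, hchart]
  · convert! hst
    · simpa [he0] using hi0
    · simpa [he1] using hi1
  · have : IsMonomialPair n i.toRingHom (sX B) (sY B) f g := by
      have hi (a b : Fin 3 → ℕ) (e : ℕ) : prodForm a b e x' y' = i (prodForm a b e x y) := by
        rw [← hix, ← hiy]
        exact (map_prodForm i.toRingHom a b e x y).symm
      refine ⟨cf, cg, εf * u, εg * v, a, b, d, e, hcf, hcg,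
        (hεf.map (Int.castRingHom B)).mul hu, (hεg.map (Int.castRingHom B)).mul hv, ?_, ?_, hco⟩
      · rw [hf, hi, hfB]
        simp [mul_assoc]
      · rw [hg, hi, hgB]
        simp [mul_assoc]
    exact this.comp _ e'.symm.toAlgHom.toRingHom _ _ hcomp
      (e'.symm_apply_eq.mpr he0.symm) (e'.symm_apply_eq.mpr he1.symm)

/-- The numerical conditions on the exponents of the two forms. -/
structure GoodExponents (n : ℕ) (m : Fin 4 → ℕ) (k : Fin 3 → ℕ) : Prop where
  m_sum : ∑ j, m j = n
  k_sum : ∑ i, k i = n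
  m_coprime : ∀ j, (m j).Coprime n
  k_coprime : ∀ i, (k i).Coprime n
  m3_coprime : ∀ i : Fin 3, (m i.castSucc + m 3).Coprime n

/-- The exponents of the linear forms in `x` of `formZ`. -/
def expX (n : ℕ) (m : Fin 4 → ℕ) : Fin 3 → ℕ := ![n - m 3, 0, 0]

/-- The first form has degree `n` in `x` and in `y`, the second has degree `n` in `x` and zero in
`y`, so `prodForm_mob` applies to both. The powers of `-1` come from the sign of the form `-x₁`. -/
lemma exists_coord_forms {n : ℕ} {m : Fin 4 → ℕ} {k : Fin 3 → ℕ} (hG : GoodExponents n m k)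
    (ρ : Equiv.Perm (Fin 3)) : ∃ (x' y' cf cg : R) (εf εg : ℤ), IsCoord x' y' disc ∧
      permPoint₂ ρ x' y' = chart ∧ IsUnit cf ∧ IsUnit cg ∧ IsUnit εf ∧ IsUnit εg ∧
      formZ n m 1 xc 1 yc = cf ^ n * (εf * prodForm (expX n m ∘ (ρ⁻¹ : Equiv.Perm (Fin 3)))
        ((fun j ↦ m j.castSucc) ∘ (ρ⁻¹ : Equiv.Perm (Fin 3))) (m 3) x' y') ∧
      formW k 1 xc = cg ^ n * (εg * prodForm (k ∘ (ρ⁻¹ : Equiv.Perm (Fin 3))) 0 0 x' y') := by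
  obtain ⟨x', y', w, w', hco, hch, hx, hy⟩ := exists_coord ρ
  have hm := hG.m_sum
  have hk := hG.k_sum
  rw [Fin.sum_univ_four] at hm
  obtain ⟨cf, εf, hcf, hεf, hf⟩ := prodForm_mob ρ hx hy (expX n m) (fun j ↦ m j.castSucc) (m 3) n
    -- The subtraction in `n - m 3` is not truncated, because all the `m j` sum to `n`.
    (by simp [Fin.sum_univ_three, expX]; omega)
    (by
      rw [Fin.sum_univ_three]
      exact dvd_of_eq hm.symm)
  obtain ⟨cg, εg, hcg, hεg, hg⟩ := prodForm_mob ρ hx hy k 0 0 n hk (by simp)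
  refine ⟨x', y', cf, cg, (-1) ^ m 1 * εf, (-1) ^ k 1 * εg, hco, hch, hcf, hcg,
    (isUnit_one.neg.pow _).mul hεf, (isUnit_one.neg.pow _).mul hεg, ?_, ?_⟩
  · have : formZ n m 1 xc 1 yc = (-1) ^ m 1 *
        prodForm (expX n m) (fun j ↦ m j.castSucc) (m 3) xc yc := by
      simp only [formZ, prodForm, Fin.prod_univ_three, expX, sval]
      simp only [one_pow, Matrix.cons_val, Fin.castSucc_zero, Fin.castSucc_one, one_mul, mul_one,
        pow_zero]
      rw [neg_pow yc]
      have h1 : ((-1 : R) ^ m 1) * (-1) ^ m 1 = 1 := by rw [← mul_pow]; simp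
      have h2 : m (Fin.castSucc 2) = m 2 := rfl
      rw [h2]
      linear_combination (-(yc ^ m 1 * (yc - 1) ^ m 2 * (yc - xc) ^ m 3)) * h1
    rw [this, hf]
    push_cast
    ring
  · have : formW k 1 xc = (-1) ^ k 1 * prodForm k 0 0 xc yc := by
      simp only [formW, prodForm, Fin.prod_univ_three, sval]
      simp only [one_pow, Matrix.cons_val, one_mul, mul_one, pow_zero, Pi.zero_apply]
      rw [neg_pow xc]
      have h1 : ((-1 : R) ^ k 1) * (-1) ^ k 1 = 1 := by rw [← mul_pow]; simp
      linear_combination (-(xc ^ k 1 * (xc - 1) ^ k 2)) * h1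
    have h0 : (0 : Fin 3 → ℕ) ∘ (ρ⁻¹ : Equiv.Perm (Fin 3)) = 0 := rfl
    rw [this, hg, h0]
    push_cast
    ring

/-! ### Corners at `x = xᵢ`, `y = yⱼ` with `i ≠ j` -/

/-- The polynomial whose zero locus is removed from the affine plane for the chart
`x = s`, `y = 1 - t`. -/
def sepPoly : PolyXY := (1 - MvPolynomial.X 0) * (1 - MvPolynomial.X 1) *
  (1 - MvPolynomial.X 0 - MvPolynomial.X 1)

lemma IsCoord.sep {x y : R} (h : IsCoord x y disc) :
    IsCoord x (1 - y) (sepPoly * MvPolynomial.X 0 * MvPolynomial.X 1) := by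
  have key {T : Type} [CommRing T] [Algebra ℂ T] (a b : T) :
      MvPolynomial.aeval ![a, 1 - b] disc =
        MvPolynomial.aeval ![a, b] (sepPoly * MvPolynomial.X 0 * MvPolynomial.X 1) := by
    simp only [disc, sepPoly, map_mul, map_sub, map_one, MvPolynomial.aeval_X, Matrix.cons_val]
    ring
  refine h.of _ _ _ ?_ ?_ ?_
  · rw [← key, sub_sub_cancel]
    exact h.isUnit
  · intro T _ _ a b hu
    refine ⟨a, 1 - b, by rwa [key], fun f h0 h1 ↦ ⟨h0, by rw [map_sub, map_one, h1, sub_sub_cancel]⟩⟩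
  · intro T _ _ f g h0 h1
    refine ⟨h0, ?_⟩
    rw [map_sub, map_sub, map_one, map_one] at h1
    exact sub_right_injective h1

/-- The involution `(x, y) ↦ (x, 1 - y)` of the affine plane. -/
def reflectHom : PolyXY →ₐ[ℂ] PolyXY := MvPolynomial.aeval ![MvPolynomial.X 0, 1 - MvPolynomial.X 1]

lemma reflectHom_reflectHom : reflectHom.comp reflectHom = AlgHom.id ℂ PolyXY := by
  apply MvPolynomial.algHom_ext
  intro i
  fin_cases i <;> simp [reflectHom]

instance : IsIso (Spec.map (CommRingCat.ofHom reflectHom.toRingHom)) := by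
  have : Spec.map (CommRingCat.ofHom reflectHom.toRingHom) ≫
      Spec.map (CommRingCat.ofHom reflectHom.toRingHom) = 𝟙 _ := by
    rw [← Spec.map_comp, ← CommRingCat.ofHom_comp, ← Spec.map_id, ← CommRingCat.ofHom_id]
    exact congrArg (fun f : PolyXY →ₐ[ℂ] PolyXY ↦ Spec.map (CommRingCat.ofHom f.toRingHom))
      reflectHom_reflectHom
  exact ⟨_, this, this⟩

/-- The chart of `ℙ¹ × ℙ¹` at the intersection of two curves `x = xᵢ`, `y = yⱼ` with `i ≠ j`. -/
def sepChart (ρ : Equiv.Perm (Fin 3)) : Spec (CommRingCat.of (Localization.Away sepPoly)) ⟶ P1xP1 :=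
  permPoint₂ ρ (sX _) (1 - sY _)

lemma sepChart_eq (ρ : Equiv.Perm (Fin 3)) : sepChart ρ =
    Spec.map (CommRingCat.ofHom (algebraMap PolyXY (Localization.Away sepPoly))) ≫
      Spec.map (CommRingCat.ofHom reflectHom.toRingHom) ≫ permChart ρ := by
  have h1 := SpecMap_permPoint₂ reflectHom ρ (MvPolynomial.X 0) (MvPolynomial.X 1)
  have h2 := SpecMap_permPoint₂ (IsScalarTower.toAlgHom ℂ PolyXY (Localization.Away sepPoly)) ρ
    (reflectHom (MvPolynomial.X 0)) (reflectHom (MvPolynomial.X 1))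
  rw [permChart, h1]
  refine Eq.trans ?_ h2.symm
  simp [sepChart, reflectHom]

instance (ρ : Equiv.Perm (Fin 3)) : IsOpenImmersion (sepChart ρ) := by
  rw [sepChart_eq]
  infer_instance

lemma mem_range_sepChart (ρ : Equiv.Perm (Fin 3)) (z : P1xP1) (h1 : pr₁ z ∈ mark (ρ⁻¹ 1))
    (h2 : pr₂ z ∈ mark (ρ⁻¹ 2)) : z ∈ Set.range (sepChart ρ) := by
  have hz : z ∈ Set.range (permChart ρ) := by
    rw [mem_range_permChart]
    exact ⟨Set.disjoint_left.mp (disjoint_mark (by simp)) h1,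
      Set.disjoint_left.mp (disjoint_mark (by simp)) h2⟩
  obtain ⟨p, rfl⟩ := hz
  rw [permChart, fst_mem_mark] at h1
  rw [permChart, snd_mem_mark] at h2
  rw [Equiv.Perm.inv_def, Equiv.apply_symm_apply] at h1 h2
  replace h1 := neg_mem h1
  simp only [sval, Matrix.cons_val, neg_neg] at h1 h2
  rw [sepChart_eq]
  let q := Spec.map (CommRingCat.ofHom reflectHom.toRingHom) p
  have hq : Spec.map (CommRingCat.ofHom reflectHom.toRingHom) q = p := by
    have : Spec.map (CommRingCat.ofHom (reflectHom.comp reflectHom).toRingHom) p = p := by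
      rw [reflectHom_reflectHom]
      exact congrArg (fun f : Spec (CommRingCat.of PolyXY) ⟶ Spec (CommRingCat.of PolyXY) ↦ f p)
        (Spec.map_id _)
    exact this
  have hq' : q ∈ Set.range (PrimeSpectrum.comap (algebraMap PolyXY (Localization.Away sepPoly))) := by
    rw [PrimeSpectrum.localization_away_comap_range (Localization.Away sepPoly) sepPoly]
    intro h
    replace h : reflectHom sepPoly ∈ p.asIdeal := h
    have h3 : reflectHom sepPoly = (1 - MvPolynomial.X 0) * MvPolynomial.X 1 *
        (MvPolynomial.X 1 - MvPolynomial.X 0) := by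
      simp only [reflectHom, sepPoly, map_mul, map_sub, map_one, MvPolynomial.aeval_X,
        Matrix.cons_val]
      ring
    refine p.isPrime.ne_top ((Ideal.eq_top_iff_one _).mpr ?_)
    rw [h3] at h
    -- Modulo `p` one has `X₀ = 0` and `X₁ = 1`, where the product takes the value `1`; the
    -- multipliers turn this into a combination equal to `1`.
    have h4 := p.asIdeal.add_mem (p.asIdeal.add_mem h (p.asIdeal.mul_mem_left
      (MvPolynomial.X 1 ^ 2 + MvPolynomial.X 1 - MvPolynomial.X 0 * MvPolynomial.X 1) h1))
        (p.asIdeal.mul_mem_left (-(1 + MvPolynomial.X 1)) h2)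
    convert! h4 using 1
    ring
  obtain ⟨w, hw⟩ := hq'
  refine ⟨w, ?_⟩
  rw [← hq]
  exact congrArg (Spec.map (CommRingCat.ofHom reflectHom.toRingHom) ≫ permChart ρ) hw

lemma exists_perm {i j : Fin 3} (h : i ≠ j) : ∃ ρ : Equiv.Perm (Fin 3), ρ⁻¹ 1 = i ∧ ρ⁻¹ 2 = j := by
  revert i j
  decide

/-- The points of the blow-up over the intersection of the curves `x = xᵢ`, `y = yⱼ` have corners. -/
lemma hasCorner_of_mem_mark {n : ℕ} {m : Fin 4 → ℕ} {k : Fin 3 → ℕ} (hG : GoodExponents n m k)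
    {Z : Scheme.{0}} {π : Z ⟶ P1xP1} (hπ : IsBlowup π centre) (z : Z) {i j : Fin 3} (hij : i ≠ j)
    (h1 : pr₁ (π z) ∈ mark i) (h2 : pr₂ (π z) ∈ mark j) :
    HasCorner π n (formZ n m 1 xc 1 yc) (formW k 1 xc) z := by
  obtain ⟨ρ, rfl, rfl⟩ := exists_perm hij
  obtain ⟨x', y', cf, cg, εf, εg, hco, hch, hcf, hcg, hεf, hεg, hf, hg⟩ := exists_coord_forms hG ρ
  let B := Localization.Away sepPoly
  have hB := isCoord_localization sepPoly B
  have hu := hB.isUnit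
  rw [aeval_pair_X] at hu
  simp only [sepPoly, map_mul, map_sub, map_one, IsUnit.mul_iff] at hu
  obtain ⟨⟨hu0, hu1⟩, hu2⟩ := hu
  -- The chart avoids the three centres, so it lifts to an open subscheme of the blow-up.
  have hI : centre.comap (sepChart ρ) = ⊤ := by
    apply comap_centre_eq_top
    intro w i hi hi'
    rw [sepChart, fst_mem_mark] at hi
    rw [sepChart, snd_mem_mark] at hi'
    have hne := w.isPrime.ne_top
    generalize ρ i = i at hi hi'
    fin_cases i
    · exact hne ((Ideal.eq_top_iff_one _).mpr hi)
    · refine hne (Ideal.eq_top_of_isUnit_mem _ ?_ hu2)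
      convert! sub_mem hi hi' using 1
      simp [sval]
      ring
    · refine hne (Ideal.eq_top_of_isUnit_mem _ ?_ hu0)
      convert! neg_mem hi using 1
      simp [sval]
      rfl
  obtain ⟨l, hl⟩ := hπ.exists_isPullback (sepChart ρ) hI
  have hlo : IsOpenImmersion l := MorphismProperty.of_isPullback hl inferInstance
  obtain ⟨w, hw⟩ := mem_range_sepChart ρ (π z) h1 h2
  obtain ⟨w', -, hw'⟩ := Scheme.exists_preimage_of_isPullback hl w z hw
  have hprod (a b : Fin 3 → ℕ) (e : ℕ) : ∃ u : B, IsUnit u ∧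
      prodForm a b e (sX B) (1 - sY B) = u * sX B ^ a 1 * sY B ^ b 2 := by
    refine ⟨(-1) ^ a 1 * (-(1 - sX B)) ^ a 2 * (-(1 - sY B)) ^ b 1 * (-1) ^ b 2 *
      (1 - sX B - sY B) ^ e, ?_, ?_⟩
    · exact ((((isUnit_one.neg.pow _).mul (hu0.neg.pow _)).mul (hu1.neg.pow _)).mul
        (isUnit_one.neg.pow _)).mul (hu2.pow _)
    · have h1 : -sX B = (-1) * sX B := by ring
      have h2 : 1 - sY B - 1 = (-1) * sY B := by ring
      have h3 : 1 - sY B - sX B = 1 - sX B - sY B := by ring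
      have h4 : sX B - 1 = -(1 - sX B) := by ring
      simp only [prodForm, Fin.prod_univ_three, sval, Matrix.cons_val, one_pow, one_mul]
      rw [h1, h2, h3, h4, mul_pow, mul_pow]
      generalize -(1 - sX B) = A1
      generalize -(1 - sY B) = A2
      generalize 1 - sX B - sY B = A3
      ring
  obtain ⟨u, hu, hfB⟩ := hprod (expX n m ∘ (ρ⁻¹ : Equiv.Perm (Fin 3)))
    ((fun j ↦ m j.castSucc) ∘ (ρ⁻¹ : Equiv.Perm (Fin 3))) (m 3)
  obtain ⟨v, hv, hgB⟩ := hprod (k ∘ (ρ⁻¹ : Equiv.Perm (Fin 3))) 0 0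
  refine HasCorner.mk sepPoly (by simp [sepPoly]) B l ⟨w', hw'⟩ ρ (sX B) (1 - sY B) ?_ hch x' (1 - y')
    hco.sep ?_ hcf hcg hεf hεg hf hg u v _ _ _ _ hu hv hfB hgB ?_
  · rw [← hl.w, Category.id_comp, sepChart]
  · intro i h0 h1
    refine ⟨h0, ?_⟩
    rw [map_sub, map_one, h1, sub_sub_cancel]
  -- The second form has no factor in `y`, so the matrix of exponents has a zero entry and its
  -- determinant is minus the product of one exponent `m` and one exponent `k`.
  · have h1 := Nat.isCoprime_iff_coprime.mpr (hG.m_coprime (ρ⁻¹ 2).castSucc)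
    have h2 := Nat.isCoprime_iff_coprime.mpr (hG.k_coprime (ρ⁻¹ 1))
    simpa using (h1.mul_left h2).neg_left

/-! ### Corners over a neighbourhood of a centre -/

/-- The polynomial whose zero locus is removed from the affine plane for the neighbourhood of a
centre of the blow-up. -/
def exPoly : PolyXY := (1 - MvPolynomial.X 0) * (1 - MvPolynomial.X 1)

/-- The chart of `ℙ¹ × ℙ¹` around a centre of the blow-up. -/
def exChart (ρ : Equiv.Perm (Fin 3)) : Spec (CommRingCat.of (Localization.Away exPoly)) ⟶ P1xP1 :=
  permPoint₂ ρ (sX _) (sY _)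

lemma exChart_eq (ρ : Equiv.Perm (Fin 3)) : exChart ρ =
    Spec.map (CommRingCat.ofHom (algebraMap PolyXY (Localization.Away exPoly))) ≫ permChart ρ :=
  (SpecMap_permPoint₂ (IsScalarTower.toAlgHom ℂ PolyXY (Localization.Away exPoly)) ρ
    (MvPolynomial.X 0) (MvPolynomial.X 1)).symm

instance (ρ : Equiv.Perm (Fin 3)) : IsOpenImmersion (exChart ρ) := by
  rw [exChart_eq]
  infer_instance

lemma mem_range_exChart (ρ : Equiv.Perm (Fin 3)) (z : P1xP1)
    (h : ∀ i ≠ ρ⁻¹ 1, pr₁ z ∉ mark i ∧ pr₂ z ∉ mark i) : z ∈ Set.range (exChart ρ) := by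
  have hz : z ∈ Set.range (permChart ρ) := by
    rw [mem_range_permChart]
    exact h _ (by simp)
  obtain ⟨p, rfl⟩ := hz
  have h2 := h (ρ⁻¹ 2) (by simp)
  rw [permChart, fst_mem_mark, snd_mem_mark, Equiv.Perm.inv_def, Equiv.apply_symm_apply] at h2
  simp only [sval, Matrix.cons_val] at h2
  have hp : p ∈ Set.range (PrimeSpectrum.comap (algebraMap PolyXY (Localization.Away exPoly))) := by
    rw [PrimeSpectrum.localization_away_comap_range (Localization.Away exPoly) exPoly]
    intro h3
    rcases p.isPrime.mem_or_mem h3 with h4 | h4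
    · exact h2.1 (by simpa using neg_mem h4)
    · exact h2.2 (by simpa using neg_mem h4)
  obtain ⟨w, hw⟩ := hp
  refine ⟨w, ?_⟩
  rw [exChart_eq]
  exact congrArg (permChart ρ) hw

lemma isUnit_aeval_exPoly {A : Type} [CommRing A] [Algebra ℂ A] (a b : A) :
    IsUnit (MvPolynomial.aeval ![a, b] exPoly) ↔ IsUnit (1 - a) ∧ IsUnit (1 - b) := by
  simp [exPoly, IsUnit.mul_iff]

/-- Without the lines `x = 1` and `y = 1`, the only centre left in the chart is the origin. The
ideal `(x, y)` is prime, hence it is the whole vanishing ideal of the origin. -/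
lemma specIdeal_comap_exChart (ρ : Equiv.Perm (Fin 3)) :
    specIdeal (centre.comap (exChart ρ)) = Ideal.span
      {(sX (Localization.Away exPoly) : CommRingCat.of (Localization.Away exPoly)), sY _} := by
  have hB := isCoord_localization exPoly (Localization.Away exPoly)
  obtain ⟨hu0, hu1⟩ := (isUnit_aeval_exPoly _ _).mp hB.isUnit
  rw [centre, specIdeal_comap_vanishingIdeal]
  have h : (exChart ρ ⁻¹' ⋃ i, diagMark i) =
      PrimeSpectrum.zeroLocus ({sX (Localization.Away exPoly), sY _} : Set _) := by
    ext p
    simp only [diagMark, Set.mem_preimage, Set.mem_iUnion, Set.mem_inter_iff, exChart, fst_mem_mark,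
      snd_mem_mark]
    have hp : p ∈ PrimeSpectrum.zeroLocus ({sX (Localization.Away exPoly), sY _} : Set _) ↔
        sX _ ∈ p.asIdeal ∧ sY _ ∈ p.asIdeal :=
      (PrimeSpectrum.mem_zeroLocus _ _).trans
        (Set.insert_subset_iff.trans (and_congr_right' Set.singleton_subset_iff))
    refine Iff.trans ?_ hp.symm
    constructor
    · rintro ⟨i, h1, h2⟩
      generalize ρ i = i at h1 h2
      fin_cases i
      · exact (p.isPrime.ne_top ((Ideal.eq_top_iff_one _).mpr h1)).elim
      · exact ⟨by simpa [sval] using neg_mem h1, by simpa [sval] using neg_mem h2⟩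
      · refine (p.isPrime.ne_top (Ideal.eq_top_of_isUnit_mem _ ?_ hu0)).elim
        convert! neg_mem h1 using 1
        simp [sval]
    · rintro ⟨h1, h2⟩
      refine ⟨ρ⁻¹ 1, ?_⟩
      rw [Equiv.Perm.inv_def, Equiv.apply_symm_apply]
      exact ⟨neg_mem h1, neg_mem h2⟩
  have hP := isPrime_span_pair (h := exPoly) (by simp [exPoly]) (Localization.Away exPoly)
  refine (congrArg PrimeSpectrum.vanishingIdeal h).trans ?_
  rw [← PrimeSpectrum.zeroLocus_span, PrimeSpectrum.vanishingIdeal_zeroLocus_eq_radical]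
  exact hP.radical

/-- The identity, or `d ↦ 1 - d`. -/
def flip {A : Type} [Ring A] (fl : Bool) (d : A) : A := bif fl then 1 - d else d

lemma flip_flip {A : Type} [Ring A] (fl : Bool) (d : A) : flip fl (flip fl d) = d := by
  cases fl <;> simp [flip]

lemma map_flip {A A' : Type} [Ring A] [Ring A'] (f : A →+* A') (fl : Bool) (d : A) :
    f (flip fl d) = flip fl (f d) := by
  cases fl <;> simp [flip]

/-- The polynomial whose zero locus is removed from the affine plane for the chart of a blow-up. -/
def blPoly (fl : Bool) : PolyXY :=
  (1 - flip fl (MvPolynomial.X 0) * MvPolynomial.X 1) * (1 - MvPolynomial.X 1)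

lemma isUnit_aeval_blPoly {A : Type} [CommRing A] [Algebra ℂ A] (fl : Bool) (a b : A) :
    IsUnit (MvPolynomial.aeval ![a, b] (blPoly fl)) ↔
      IsUnit (1 - flip fl a * b) ∧ IsUnit (1 - b) := by
  have := map_flip (MvPolynomial.aeval ![a, b] : PolyXY →ₐ[ℂ] A).toRingHom fl (MvPolynomial.X 0)
  simp only [AlgHom.toRingHom_eq_coe, RingHom.coe_coe, MvPolynomial.aeval_X] at this
  simp [blPoly, IsUnit.mul_iff, this]

/-- A value `d` of the slope `x / y` prescribes `flip fl d` for `s`. The loci removed on both sides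
match, because `1 - x` and `1 - y` become `1 - flip fl s * t` and `1 - t`. -/
lemma isQuotRing_of_isCoord {A B : Type} [CommRing A] [CommRing B] [Algebra ℂ A] [Algebra ℂ B]
    {x y : A} {s t : B} {fl : Bool} (hA : IsCoord x y exPoly) (hB : IsCoord s t (blPoly fl))
    (φ : A →ₐ[ℂ] B) (hx : φ x = flip fl s * t) (hy : φ y = t) :
    IsQuotRing (CommRingCat.ofHom φ.toRingHom) x y (flip fl s) where
  eq := by
    change φ x = flip fl s * φ y
    rw [hx, hy]
  lift {D} ρ d hd hn := by
    let : Algebra ℂ D := (ρ.hom.comp (algebraMap ℂ A)).toAlgebra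
    let ρ' : A →ₐ[ℂ] D := { ρ.hom with commutes' := fun _ ↦ rfl }
    have hxd : ρ' x = d * ρ' y := hd
    obtain ⟨r, hr0, hr1⟩ := hB.lift (flip fl d) (ρ' y) (by
      have h := (isUnit_aeval_exPoly (ρ' x) (ρ' y)).mp (by
        rw [← map_aeval_pair]
        exact hA.isUnit.map ρ')
      rw [isUnit_aeval_blPoly, flip_flip, ← hxd]
      exact h)
    refine ⟨CommRingCat.ofHom r.toRingHom, ?_⟩
    have hflip := map_flip r.toRingHom fl s
    simp only [AlgHom.toRingHom_eq_coe, RingHom.coe_coe, hr0, flip_flip] at hflip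
    have : r.comp φ = ρ' := hA.ext _ _ (by simp [hx, hr1, hflip, hxd]) (by simp [hy, hr1])
    ext a
    exact congr($this a)
  ext {D} r r' he hs := by
    let : Algebra ℂ D := (r.hom.comp (algebraMap ℂ B)).toAlgebra
    have he' (a : A) : r.hom (φ a) = r'.hom (φ a) := congr($(he).hom a)
    let r₁ : B →ₐ[ℂ] D := { r.hom with commutes' := fun _ ↦ rfl }
    let r₂ : B →ₐ[ℂ] D :=
      { r'.hom with
        commutes' := fun c ↦ by
          have := he' (algebraMap ℂ A c)
          rw [AlgHom.commutes] at this
          exact this.symm }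
    have : r₁ = r₂ := by
      refine hB.ext _ _ ?_ ?_
      · have h0 : flip fl (r.hom s) = flip fl (r'.hom s) := by
          rw [← map_flip, ← map_flip]
          exact hs
        have := congrArg (flip fl) h0
        rwa [flip_flip, flip_flip] at this
      · have := he' y
        rwa [hy] at this
    ext b
    exact congr($this b)

/-- The exponent of `t` is the multiplicity of the form at the centre. That of `s` belongs to the
strict transform of `x = 0`, or to that of the diagonal if `fl` is true. -/
lemma exists_unit_prodForm {B : Type} [CommRing B] (fl : Bool) (s t : B) (h1 : IsUnit (1 - s))
    (h2 : IsUnit (1 - flip fl s * t)) (h3 : IsUnit (1 - t)) (a b : Fin 3 → ℕ) (e : ℕ) :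
    ∃ u : B, IsUnit u ∧ prodForm a b e (flip fl s * t) t =
      u * s ^ (bif fl then e else a 1) * t ^ (a 1 + b 1 + e) := by
  cases fl
  · refine ⟨(-1) ^ (a 1 + a 2 + b 1 + b 2) * (1 - s) ^ e * (1 - s * t) ^ a 2 * (1 - t) ^ b 2,
      (((isUnit_one.neg.pow _).mul (h1.pow e)).mul (h2.pow _)).mul (h3.pow _), ?_⟩
    simp only [prodForm, Fin.prod_univ_three, sval, Matrix.cons_val, one_pow, one_mul, flip,
      cond_false]
    have e1 : -(s * t) = (-1) * s * t := by ring
    have e2 : s * t - 1 = (-1) * (1 - s * t) := by ring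
    have e3 : t - 1 = (-1) * (1 - t) := by ring
    have e4 : t - s * t = (1 - s) * t := by ring
    have e5 : -t = (-1) * t := by ring
    rw [e1, e2, e3, e4, e5]
    generalize 1 - s = A1
    generalize 1 - s * t = A2
    generalize 1 - t = A3
    ring
  · simp only [flip, cond_true] at h2
    refine ⟨(-1) ^ (a 1 + a 2 + b 1 + b 2) * (1 - s) ^ a 1 * (1 - (1 - s) * t) ^ a 2 *
      (1 - t) ^ b 2,
      (((isUnit_one.neg.pow _).mul (h1.pow _)).mul (h2.pow _)).mul (h3.pow _), ?_⟩
    simp only [prodForm, Fin.prod_univ_three, sval, Matrix.cons_val, one_pow, one_mul, flip,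
      cond_true]
    have e1 : -((1 - s) * t) = (-1) * (1 - s) * t := by ring
    have e2 : (1 - s) * t - 1 = (-1) * (1 - (1 - s) * t) := by ring
    have e3 : t - 1 = (-1) * (1 - t) := by ring
    have e4 : t - (1 - s) * t = s * t := by ring
    have e5 : -t = (-1) * t := by ring
    rw [e1, e2, e3, e4, e5]
    generalize 1 - (1 - s) * t = A2
    generalize 1 - s = A1
    generalize 1 - t = A3
    ring

lemma prodForm_swap {B : Type} [CommRing B] (a b : Fin 3 → ℕ) (e : ℕ) (x y : B) :
    prodForm a b e x y = (-1) ^ e * prodForm b a e y x := by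
  have : y - x = (-1) * (x - y) := by ring
  rw [prodForm, prodForm, this, mul_pow]
  ring

lemma IsCoord.swap {A : Type} [CommRing A] [Algebra ℂ A] {x y : A} {D : PolyXY} (h : IsCoord x y D)
    (hD : ∀ {T : Type} [CommRing T] [Algebra ℂ T] (a b : T),
      IsUnit (MvPolynomial.aeval ![a, b] D) → IsUnit (MvPolynomial.aeval ![b, a] D)) :
    IsCoord y x D :=
  h.of _ _ _ (hD _ _ h.isUnit) (fun a b hu ↦ ⟨b, a, hD _ _ hu, fun _ h0 h1 ↦ ⟨h1, h0⟩⟩)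
    fun _ _ h0 h1 ↦ ⟨h1, h0⟩

lemma isUnit_aeval_disc_swap {T : Type} [CommRing T] [Algebra ℂ T] (a b : T)
    (h : IsUnit (MvPolynomial.aeval ![a, b] disc)) : IsUnit (MvPolynomial.aeval ![b, a] disc) := by
  rw [isUnit_aeval_disc] at h ⊢
  exact ⟨h.2.1, h.1, by simpa using h.2.2.neg⟩

lemma isUnit_aeval_exPoly_swap {T : Type} [CommRing T] [Algebra ℂ T] (a b : T)
    (h : IsUnit (MvPolynomial.aeval ![a, b] exPoly)) : IsUnit (MvPolynomial.aeval ![b, a] exPoly) := by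
  rw [isUnit_aeval_exPoly] at h ⊢
  exact h.symm

lemma isUnit_aeval_blPoly_iff {T : Type} [CommRing T] [Algebra ℂ T] (fl : Bool) (a b : T) :
    IsUnit (MvPolynomial.aeval ![a, b]
      (blPoly fl * (1 - MvPolynomial.X 0) * MvPolynomial.X 0 * MvPolynomial.X 1)) ↔
      IsUnit (MvPolynomial.aeval ![flip fl a * b, b] disc) := by
  have h := isUnit_aeval_blPoly fl a b
  simp only [map_mul, map_sub, map_one, MvPolynomial.aeval_X, IsUnit.mul_iff, h, Matrix.cons_val,
    disc]
  have h3 : IsUnit (flip fl a * b - 1) ↔ IsUnit (1 - flip fl a * b) := by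
    rw [← IsUnit.neg_iff, neg_sub]
  have h4 : IsUnit (b - 1) ↔ IsUnit (1 - b) := by
    rw [← IsUnit.neg_iff, neg_sub]
  have h5 : IsUnit (b - flip fl a * b) ↔ IsUnit (1 - flip fl a) ∧ IsUnit b := by
    rw [← IsUnit.mul_iff, sub_mul, one_mul]
  have h6 : IsUnit (flip fl a) ∧ IsUnit (1 - flip fl a) ↔ IsUnit a ∧ IsUnit (1 - a) := by
    cases fl
    · rfl
    · simp [flip, and_comm]
  rw [h3, h4, h5]
  tauto

/-- On the complement of the curves `y` is invertible, so `x` and `x / y` determine each other. Of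
the two strict transforms visible in the chart, one is `s = 0`, and the other is removed by the
factor `1 - X₀`. -/
lemma IsCoord.blow {x y w : R} (h : IsCoord x y disc) (fl : Bool) (hw : w * y = 1) :
    IsCoord (flip fl (x * w)) y
      (blPoly fl * (1 - MvPolynomial.X 0) * MvPolynomial.X 0 * MvPolynomial.X 1) := by
  refine h.of _ _ _ ?_ ?_ ?_
  · rw [isUnit_aeval_blPoly_iff, flip_flip, mul_assoc, hw, mul_one]
    exact h.isUnit
  · intro T _ _ a b hu
    refine ⟨flip fl a * b, b, (isUnit_aeval_blPoly_iff fl a b).mp hu, fun f h0 h1 ↦ ⟨?_, h1⟩⟩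
    have hf := map_flip f.toRingHom fl (x * w)
    simp only [AlgHom.toRingHom_eq_coe, RingHom.coe_coe, map_mul] at hf
    have hw' := congr(f $hw)
    rw [map_mul, map_one, h1] at hw'
    rw [hf, h0, mul_assoc, mul_comm b, hw', mul_one, flip_flip]
  · intro T _ _ f g h0 h1
    refine ⟨?_, h1⟩
    have hf := map_flip f.toRingHom fl (x * w)
    have hg := map_flip g.toRingHom fl (x * w)
    simp only [AlgHom.toRingHom_eq_coe, RingHom.coe_coe] at hf hg
    have h2 : f (x * w) = g (x * w) := by
      have := congrArg (flip fl) (hf.symm.trans (h0.trans hg))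
      rwa [flip_flip, flip_flip] at this
    have h3 : x = x * w * y := by rw [mul_assoc, hw, mul_one]
    rw [h3, map_mul, h2, h1, ← map_mul]

section Blow

variable {n : ℕ} {m : Fin 4 → ℕ} {k : Fin 3 → ℕ} (hG : GoodExponents n m k) (fl : Bool)

/-- The ring of the chart of the blow-up. -/
abbrev BlRing (fl : Bool) : Type := Localization.Away (blPoly fl)

include hG

/-- The two strict transforms in the chart, `s = 0` and `s = 1`, are disjoint. Inverting `1 - s`
leaves `s = 0` and the exceptional curve `t = 0`, and the forms become monomials up to units. -/
lemma hasCorner_of_chart {Z : Scheme.{0}} {π : Z ⟶ P1xP1} (ρ : Equiv.Perm (Fin 3)) (sw : Bool)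
    (b : Spec (CommRingCat.of (BlRing fl)) ⟶ Z) [IsOpenImmersion b]
    (hb : b ≫ π = bif sw then permPoint₂ ρ (sY (BlRing fl)) (flip fl (sX _) * sY _)
      else permPoint₂ ρ (flip fl (sX (BlRing fl)) * sY _) (sY _))
    (q : Spec (CommRingCat.of (BlRing fl))) (hq : 1 - sX (BlRing fl) ∉ q.asIdeal) :
    HasCorner π n (formZ n m 1 xc 1 yc) (formW k 1 xc) (b q) := by
  obtain ⟨x', y', cf, cg, εf, εg, hco, hch, hcf, hcg, hεf, hεg, hf, hg⟩ := exists_coord_forms hG ρ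
  let B := Localization.Away (1 - sX (BlRing fl))
  have hloc : IsLocalization.Away (blPoly fl * (1 - MvPolynomial.X 0)) B := by
    have : IsLocalization.Away (algebraMap PolyXY (BlRing fl) (1 - MvPolynomial.X 0)) B := by
      rw [map_sub, map_one]
      infer_instance
    rw [mul_comm]
    exact IsLocalization.Away.mul (BlRing fl) B _ _
  have hB := isCoord_localization (blPoly fl * (1 - MvPolynomial.X 0)) B
  have hu := hB.isUnit
  rw [map_mul, IsUnit.mul_iff, isUnit_aeval_blPoly] at hu
  obtain ⟨⟨hu1, hu2⟩, hu3⟩ := hu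
  simp only [map_sub, map_one, MvPolynomial.aeval_X, Matrix.cons_val] at hu3
  have hh : MvPolynomial.constantCoeff (blPoly fl * (1 - MvPolynomial.X 0)) ≠ 0 := by
    simp [blPoly]
  let β : Spec (CommRingCat.of B) ⟶ Z :=
    Spec.map (CommRingCat.ofHom (algebraMap (BlRing fl) B)) ≫ b
  have hz : b q ∈ Set.range β := by
    have hr : q ∈ Set.range (PrimeSpectrum.comap (algebraMap (BlRing fl) B)) := by
      rw [PrimeSpectrum.localization_away_comap_range B (1 - sX (BlRing fl))]
      exact hq
    obtain ⟨w, hw⟩ := hr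
    exact ⟨w, congrArg b hw⟩
  have hβ : IsOpenImmersion β := inferInstance
  have hmap (a c : BlRing fl) := SpecMap_permPoint₂ (IsScalarTower.toAlgHom ℂ (BlRing fl) B) ρ a c
  have hs : algebraMap (BlRing fl) B (sX _) = sX B :=
    (IsScalarTower.algebraMap_apply PolyXY (BlRing fl) B _).symm
  have ht : algebraMap (BlRing fl) B (sY _) = sY B :=
    (IsScalarTower.algebraMap_apply PolyXY (BlRing fl) B _).symm
  have hfs : algebraMap (BlRing fl) B (flip fl (sX _)) = flip fl (sX B) := by
    rw [map_flip, hs]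
  have hmk := Nat.isCoprime_iff_coprime.mpr (hG.k_coprime (ρ⁻¹ 1))
  have hmm := Nat.isCoprime_iff_coprime.mpr (hG.m_coprime (ρ⁻¹ 1).castSucc)
  have hm3 := Nat.isCoprime_iff_coprime.mpr (hG.m_coprime 3)
  have hmm3 := Nat.isCoprime_iff_coprime.mpr (hG.m3_coprime (ρ⁻¹ 1))
  have hxyi (i : B →ₐ[ℂ] R) (x w y : R) (hw : w * y = 1) (h0 : i (sX B) = flip fl (x * w))
      (h1 : i (sY B) = y) : i (flip fl (sX B) * sY B) = x := by
    have := map_flip i.toRingHom fl (sX B)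
    simp only [AlgHom.toRingHom_eq_coe, RingHom.coe_coe] at this
    rw [map_mul, this, h0, h1, flip_flip, mul_assoc, hw, mul_one]
  have hdisc := (isUnit_aeval_disc _ _).mp hco.isUnit
  have hu1' : IsUnit (sval x' 1) := hdisc.1 1
  have hu2' : IsUnit (sval y' 1) := hdisc.2.1 1
  simp only [sval, Matrix.cons_val, IsUnit.neg_iff] at hu1' hu2'
  cases sw
  · obtain ⟨w, hw⟩ := hu2'.exists_left_inv
    obtain ⟨u, hu, hfB⟩ := exists_unit_prodForm fl (sX B) (sY B) hu3 hu1 hu2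
      (expX n m ∘ (ρ⁻¹ : Equiv.Perm (Fin 3)))
      ((fun j ↦ m j.castSucc) ∘ (ρ⁻¹ : Equiv.Perm (Fin 3))) (m 3)
    obtain ⟨v, hv, hgB⟩ := exists_unit_prodForm fl (sX B) (sY B) hu3 hu1 hu2
      (k ∘ (ρ⁻¹ : Equiv.Perm (Fin 3))) 0 0
    refine HasCorner.mk _ hh B β hz ρ (flip fl (sX B) * sY B) (sY B) ?_ hch
      _ _ (hco.blow fl hw) ?_ hcf hcg hεf hεg hf hg u v _ _ _ _ hu hv hfB hgB ?_
    · rw [Category.assoc, hb]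
      refine (hmap _ _).trans ?_
      simp only [IsScalarTower.coe_toAlgHom', map_mul, hfs, ht]
    · exact fun i h0 h1 ↦ ⟨hxyi i _ w _ hw h0 h1, h1⟩
    -- Here `s = 0` is the strict transform of `x = xᵢ` or, for `fl = true`, of the diagonal. In the
    -- first case the exponent of the form in `x` cancels, leaving the determinant `-(mᵢ + m₃) kᵢ`;
    -- in the second it is `m₃ kᵢ`.
    · cases fl
      · have h := (hmm3.mul_left hmk).neg_left
        convert! h using 1
        simp
        ring
      · have h := hm3.mul_left hmk
        convert! h using 1
  · obtain ⟨w, hw⟩ := hu1'.exists_left_inv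
    obtain ⟨u, hu, hfB⟩ := exists_unit_prodForm fl (sX B) (sY B) hu3 hu1 hu2
      ((fun j ↦ m j.castSucc) ∘ (ρ⁻¹ : Equiv.Perm (Fin 3)))
      (expX n m ∘ (ρ⁻¹ : Equiv.Perm (Fin 3))) (m 3)
    obtain ⟨v, hv, hgB⟩ := exists_unit_prodForm fl (sX B) (sY B) hu3 hu1 hu2
      0 (k ∘ (ρ⁻¹ : Equiv.Perm (Fin 3))) 0
    have hass (ε u S T : B) : ε * (u * S * T) = ε * u * S * T := by ring
    refine HasCorner.mk _ hh B β hz ρ (sY B) (flip fl (sX B) * sY B) ?_ hch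
      _ _ ((hco.swap isUnit_aeval_disc_swap).blow fl hw) ?_ hcf hcg
      hεf hεg hf hg ((-1) ^ m 3 * u) ((-1) ^ 0 * v) _ _ _ _ ((isUnit_one.neg.pow _).mul hu)
      ((isUnit_one.neg.pow _).mul hv) ((prodForm_swap ..).trans (by rw [hfB]; exact hass ..))
      ((prodForm_swap ..).trans (by rw [hgB]; exact hass ..)) ?_
    · rw [Category.assoc, hb]
      refine (hmap _ _).trans ?_
      simp only [IsScalarTower.coe_toAlgHom', map_mul, hfs, ht]
    · exact fun i h0 h1 ↦ ⟨h1, hxyi i _ w _ hw h0 h1⟩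
    -- Now `s = 0` is the strict transform of `y = yᵢ` or of the diagonal. The second form contains
    -- no power of `s`, and the determinants are `mᵢ kᵢ` and `m₃ kᵢ`.
    · cases fl
      · have h := hmm.mul_left hmk
        convert! h using 1
        simp
      · have h := hm3.mul_left hmk
        convert! h using 1
        simp

end Blow

/-- The map from the chart around a centre of the blow-up to the chart of the blow-up. -/
lemma exists_blowHom (fl sw : Bool) : ∃ φ : Localization.Away exPoly →ₐ[ℂ] BlRing fl,
    φ (sX _) = (bif sw then sY _ else flip fl (sX _) * sY _) ∧
    φ (sY _) = (bif sw then flip fl (sX _) * sY _ else sY _) := by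
  have hA := isCoord_localization exPoly (Localization.Away exPoly)
  have h := (isUnit_aeval_blPoly fl _ _).mp (isCoord_localization (blPoly fl) (BlRing fl)).isUnit
  cases sw
  · exact hA.lift _ _ ((isUnit_aeval_exPoly _ _).mpr h)
  · exact hA.lift _ _ ((isUnit_aeval_exPoly _ _).mpr h.symm)

/-- The coordinates of the chart around a centre of the blow-up, in one of the two orders. -/
def exCoord (sw : Bool) : Localization.Away exPoly := bif sw then sY _ else sX _

lemma isCoord_exCoord (sw : Bool) : IsCoord (exCoord sw) (exCoord !sw) exPoly := by
  have hA := isCoord_localization exPoly (Localization.Away exPoly)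
  cases sw
  · exact hA
  · exact hA.swap isUnit_aeval_exPoly_swap

lemma isQuotRing_blowHom (fl sw : Bool) (φ : Localization.Away exPoly →ₐ[ℂ] BlRing fl)
    (hx : φ (sX _) = (bif sw then sY _ else flip fl (sX _) * sY _))
    (hy : φ (sY _) = (bif sw then flip fl (sX _) * sY _ else sY _)) :
    IsQuotRing (CommRingCat.ofHom φ.toRingHom) (exCoord sw) (exCoord !sw)
      (flip fl (sX (BlRing fl))) := by
  refine isQuotRing_of_isCoord (isCoord_exCoord sw) (isCoord_localization (blPoly fl) (BlRing fl))
    φ ?_ ?_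
  · cases sw
    · exact hx
    · exact hy
  · cases sw
    · exact hy
    · exact hx

lemma specIdeal_comap_exChart' (ρ : Equiv.Perm (Fin 3)) (sw : Bool) :
    specIdeal (centre.comap (exChart ρ)) = Ideal.span
      {(exCoord sw : CommRingCat.of (Localization.Away exPoly)), exCoord !sw} := by
  rw [specIdeal_comap_exChart]
  cases sw
  · rfl
  · exact congrArg Ideal.span (Set.pair_comm _ _)

lemma constantCoeff_blPoly (fl : Bool) : MvPolynomial.constantCoeff (blPoly fl) ≠ 0 := by
  simp [blPoly]

/-- `sw` exchanges the roles of `x` and `y`, while `fl` replaces the slope by one minus the slope,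
which turns the strict transform of the diagonal into `s = 0`. -/
lemma exists_blowChart {Z : Scheme.{0}} {π : Z ⟶ P1xP1} (hπ : IsBlowup π centre)
    (ρ : Equiv.Perm (Fin 3)) (fl sw : Bool) :
    ∃ (φ : Localization.Away exPoly →ₐ[ℂ] BlRing fl) (b : Spec (CommRingCat.of (BlRing fl)) ⟶ Z),
      IsOpenImmersion b ∧
      b ≫ π = Spec.map (CommRingCat.ofHom φ.toRingHom) ≫ exChart ρ ∧
      φ (exCoord !sw) = sY _ ∧
      IsQuotRing (CommRingCat.ofHom φ.toRingHom) (exCoord sw) (exCoord !sw)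
        (flip fl (sX (BlRing fl))) ∧
      b ≫ π = bif sw then permPoint₂ ρ (sY (BlRing fl)) (flip fl (sX _) * sY _)
        else permPoint₂ ρ (flip fl (sX (BlRing fl)) * sY _) (sY _) := by
  obtain ⟨φ, hx, hy⟩ := exists_blowHom fl sw
  have hQ := isQuotRing_blowHom fl sw φ hx hy
  have hφ : φ (exCoord !sw) = sY _ := by
    cases sw
    · exact hy
    · exact hx
  have hdom := isDomain_localization_of_constantCoeff (constantCoeff_blPoly fl) (BlRing fl)
  have hnz : sY (BlRing fl) ∈ nonZeroDivisors (BlRing fl) :=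
    mem_nonZeroDivisors_of_ne_zero (algebraMap_X_ne_zero (constantCoeff_blPoly fl) _ 1)
  obtain ⟨b, hbo, hb⟩ := hπ.exists_chart (exChart ρ) (specIdeal_comap_exChart' ρ sw) hQ (by
    change φ (exCoord !sw) ∈ nonZeroDivisors (BlRing fl)
    rwa [hφ])
  refine ⟨φ, b, hbo, hb, hφ, hQ, ?_⟩
  rw [hb]
  refine (SpecMap_permPoint₂ φ ρ _ _).trans ?_
  rw [hx, hy]
  cases sw <;> rfl

/-- On the strict transform of the diagonal, where `s = 1`, one has to pass to the chart with `fl =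
true`. The first chart factors through it by `exists_factor_chart`, and the slopes correspond. -/
lemma hasCorner_of_mem_range {n : ℕ} {m : Fin 4 → ℕ} {k : Fin 3 → ℕ} (hG : GoodExponents n m k)
    {Z : Scheme.{0}} {π : Z ⟶ P1xP1} (hπ : IsBlowup π centre) (ρ : Equiv.Perm (Fin 3)) (sw : Bool)
    (b : Spec (CommRingCat.of (BlRing false)) ⟶ Z) [IsOpenImmersion b]
    (hb : b ≫ π = bif sw then permPoint₂ ρ (sY (BlRing false)) (flip false (sX _) * sY _)
        else permPoint₂ ρ (flip false (sX (BlRing false)) * sY _) (sY _))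
    (φ : Localization.Away exPoly →ₐ[ℂ] BlRing false) (hφ : φ (exCoord !sw) = sY _)
    (hbφ : b ≫ π = Spec.map (CommRingCat.ofHom φ.toRingHom) ≫ exChart ρ)
    (hQ : IsQuotRing (CommRingCat.ofHom φ.toRingHom) (exCoord sw) (exCoord !sw)
        (flip false (sX (BlRing false))))
    (q : Spec (CommRingCat.of (BlRing false))) :
    HasCorner π n (formZ n m 1 xc 1 yc) (formW k 1 xc) (b q) := by
  by_cases hq : 1 - sX (BlRing false) ∈ q.asIdeal
  swap
  · exact hasCorner_of_chart hG false ρ sw b hb q hq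
  have hq' : sX (BlRing false) ∉ q.asIdeal := fun h ↦ q.isPrime.ne_top
    ((Ideal.eq_top_iff_one _).mpr (by simpa using add_mem hq h))
  obtain ⟨φ', b', hbo', hbφ', hφ', hQ', hb'⟩ := exists_blowChart hπ ρ true sw
  have hdom := isDomain_localization_of_constantCoeff (constantCoeff_blPoly false) (BlRing false)
  have hne : sY (BlRing false) ≠ 0 := algebraMap_X_ne_zero (constantCoeff_blPoly false) _ 1
  have hφy : CommRingCat.ofHom φ.toRingHom (exCoord !sw) = sY (BlRing false) := hφ
  obtain ⟨r, hr, hrb⟩ := exists_factor_chart hπ (exChart ρ) (specIdeal_comap_exChart' ρ sw) hQ' b'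
    hbφ' b (CommRingCat.ofHom φ.toRingHom) hbφ (flip false (sX (BlRing false))) hQ.eq (by
      rw [hφy]
      exact mem_nonZeroDivisors_of_ne_zero hne)
  have hrs : r (flip true (sX (BlRing true))) = flip false (sX (BlRing false)) := by
    have h1 := congr(r $(hQ'.eq))
    have h2 (a) : r (CommRingCat.ofHom φ'.toRingHom a) = CommRingCat.ofHom φ.toRingHom a :=
      congr($(hr).hom a)
    rw [map_mul, h2, h2, hφy, hQ.eq, hφy] at h1
    exact (mul_right_cancel₀ hne h1).symm
  have hz : b q = b' (Spec.map r q) :=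
    (congrArg (fun f : Spec (CommRingCat.of (BlRing false)) ⟶ Z ↦ f q) hrb).symm
  rw [hz]
  refine hasCorner_of_chart hG true ρ sw b' hb' _ ?_
  change r (flip true (sX (BlRing true))) ∉ q.asIdeal
  rw [hrs]
  exact hq'

/-- The points of the blow-up over a neighbourhood of one of the centres have corners. -/
lemma hasCorner_of_notMem_mark {n : ℕ} {m : Fin 4 → ℕ} {k : Fin 3 → ℕ} (hG : GoodExponents n m k)
    {Z : Scheme.{0}} {π : Z ⟶ P1xP1} (hπ : IsBlowup π centre) (z : Z) (i : Fin 3)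
    (h : ∀ j ≠ i, pr₁ (π z) ∉ mark j ∧ pr₂ (π z) ∉ mark j) :
    HasCorner π n (formZ n m 1 xc 1 yc) (formW k 1 xc) z := by
  obtain ⟨ρ, rfl⟩ : ∃ ρ : Equiv.Perm (Fin 3), ρ⁻¹ 1 = i := ⟨(Equiv.swap 1 i)⁻¹, by simp⟩
  obtain ⟨φ, b, hbo, hbφ, hφ, hQ, hb⟩ := exists_blowChart hπ ρ false false
  obtain ⟨φ', b', hbo', hbφ', hφ', hQ', hb'⟩ := exists_blowChart hπ ρ false true
  rcases hπ.mem_range_chart_or (exChart ρ) (specIdeal_comap_exChart' ρ false) hQ hQ' b hbφ b' hbφ' z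
    (mem_range_exChart ρ _ h) with ⟨q, rfl⟩ | ⟨q, rfl⟩
  · exact hasCorner_of_mem_range hG hπ ρ false b hb φ hφ hbφ hQ q
  · exact hasCorner_of_mem_range hG hπ ρ true b' hb' φ' hφ' hbφ' hQ' q

/-- Either the two coordinates lie at different marked points, or at most one marked point occurs
among them. In the latter case the chart around the corresponding centre contains the image of `z`,
whether or not it is that centre. -/
lemma hasCorner {n : ℕ} {m : Fin 4 → ℕ} {k : Fin 3 → ℕ} (hG : GoodExponents n m k)
    {Z : Scheme.{0}} {π : Z ⟶ P1xP1} (hπ : IsBlowup π centre) (z : Z) :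
    HasCorner π n (formZ n m 1 xc 1 yc) (formW k 1 xc) z := by
  by_cases h : ∃ i j, i ≠ j ∧ pr₁ (π z) ∈ mark i ∧ pr₂ (π z) ∈ mark j
  · obtain ⟨i, j, hij, h1, h2⟩ := h
    exact hasCorner_of_mem_mark hG hπ z hij h1 h2
  push Not at h
  have hd {p : P1} {i j : Fin 3} (h1 : p ∈ mark i) (hij : j ≠ i) : p ∉ mark j :=
    Set.disjoint_left.mp (disjoint_mark hij.symm) h1
  by_cases h1 : ∃ i, pr₁ (π z) ∈ mark i
  · obtain ⟨i, hi⟩ := h1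
    exact hasCorner_of_notMem_mark hG hπ z i fun j hj ↦ ⟨hd hi hj, h i j hj.symm hi⟩
  push Not at h1
  by_cases h2 : ∃ i, pr₂ (π z) ∈ mark i
  · obtain ⟨i, hi⟩ := h2
    exact hasCorner_of_notMem_mark hG hπ z i fun j hj ↦ ⟨h1 j, hd hi hj⟩
  push Not at h2
  exact hasCorner_of_notMem_mark hG hπ z 0 fun j _ ↦ ⟨h1 j, h2 j⟩

end AbelianCover

end

/-! ### Kummer extensions by roots of prime elements -/

open CategoryTheory CategoryTheory.Limits AlgebraicGeometry
open scoped TensorProduct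
noncomputable section
namespace AbelianCover

/-- A ring with a prime non-zero-divisor `p` such that the powers of `p` intersect in zero is a
domain. -/
lemma isDomain_of_isPrime_span {A : Type} [CommRing A] (p : A) (hp : (Ideal.span {p}).IsPrime)
    (hn : p ∈ nonZeroDivisors A) (hs : ∀ x : A, (∀ k : ℕ, p ^ k ∣ x) → x = 0) : IsDomain A := by
  have : Nontrivial A := by
    by_contra h
    rw [not_nontrivial_iff_subsingleton] at h
    exact hp.ne_top (Subsingleton.elim _ _)
  -- Splitting off the largest power of `p` reduces a vanishing product to one of two elements not
  -- divisible by `p`, which contradicts primality.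
  have key (x : A) (hx : x ≠ 0) : ∃ (k : ℕ) (y : A), x = p ^ k * y ∧ ¬ p ∣ y := by
    have h : ∃ k : ℕ, ¬ p ^ k ∣ x := by
      by_contra! h
      exact hx (hs x h)
    classical
    have h1 := Nat.find_spec h
    rcases hk : Nat.find h with _ | k
    · rw [hk, pow_zero] at h1
      exact (h1 (one_dvd _)).elim
    · have h2 := Nat.find_min h (m := k) (by omega)
      rw [not_not] at h2
      obtain ⟨y, hy⟩ := h2
      refine ⟨k, y, hy, ?_⟩
      rintro ⟨c, rfl⟩
      rw [hk, hy] at h1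
      exact h1 ⟨c, by ring⟩
  have : NoZeroDivisors A := by
    refine ⟨fun {x y} h ↦ ?_⟩
    by_contra! h0
    obtain ⟨k, x', rfl, hx⟩ := key x h0.1
    obtain ⟨l, y', rfl, hy⟩ := key y h0.2
    have h1 : x' * y' * p ^ (k + l) = 0 := by
      rw [← h]
      ring
    have h2 := mem_nonZeroDivisors_iff_right.mp (pow_mem hn (k + l)) _ h1
    have h3 : x' * y' ∈ Ideal.span {p} := by
      rw [h2]
      exact zero_mem _
    rcases hp.mem_or_mem h3 with h4 | h4
    · exact hx (Ideal.mem_span_singleton.mp h4)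
    · exact hy (Ideal.mem_span_singleton.mp h4)
  exact NoZeroDivisors.to_isDomain A

section Cyc

variable {A : Type} [CommRing A] {n : ℕ} (hn : n ≠ 0) (s : A)

lemma Cyc.root_pow : (AdjoinRoot.root (Polynomial.X ^ n - Polynomial.C s) : Cyc A n s) ^ n =
    algebraMap A (Cyc A n s) s := by
  have h := AdjoinRoot.eval₂_root (Polynomial.X ^ n - Polynomial.C s : Polynomial A)
  rw [Polynomial.eval₂_sub, Polynomial.eval₂_X_pow, Polynomial.eval₂_C, sub_eq_zero] at h
  exact h

lemma Cyc.exists_lift {T : Type} [CommRing T] [Algebra A T] (a : T) (h : a ^ n = algebraMap A T s) :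
    ∃ φ : Cyc A n s →ₐ[A] T, φ (AdjoinRoot.root _) = a := by
  refine ⟨AdjoinRoot.liftAlgHom _ (Algebra.ofId A T) a ?_, AdjoinRoot.liftAlgHom_root ..⟩
  have h1 : Polynomial.eval₂ (algebraMap A T) a (Polynomial.X ^ n - Polynomial.C s) = 0 := by
    rw [Polynomial.eval₂_sub, Polynomial.eval₂_X_pow, Polynomial.eval₂_C, h, sub_self]
  exact h1

include hn

lemma Cyc.monic : (Polynomial.X ^ n - Polynomial.C s).Monic := Polynomial.monic_X_pow_sub_C s hn

lemma Cyc.free : Module.Free A (Cyc A n s) := (Cyc.monic hn s).free_adjoinRoot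

lemma Cyc.finite : Module.Finite A (Cyc A n s) := (Cyc.monic hn s).finite_adjoinRoot

lemma Cyc.algebraMap_injective : Function.Injective (algebraMap A (Cyc A n s)) := by
  rw [injective_iff_map_eq_zero]
  intro a ha
  by_contra h0
  have : Nontrivial A := ⟨a, 0, h0⟩
  rw [AdjoinRoot.algebraMap_eq, ← AdjoinRoot.mk_C, AdjoinRoot.mk_eq_zero] at ha
  refine (Cyc.monic hn s).not_dvd_of_degree_lt (Polynomial.C_ne_zero.mpr h0) ?_ ha
  rw [Polynomial.degree_C h0, Polynomial.degree_X_pow_sub_C (Nat.pos_of_ne_zero hn)]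
  exact_mod_cast Nat.pos_of_ne_zero hn

/-- Modulo the root, a polynomial in it is congruent to its constant term, and `s` is a power of the
root. So the quotient by the root is `A / s`, which makes the root prime if `s` is. -/
lemma Cyc.ker_eq_span : RingHom.ker (AdjoinRoot.lift (Ideal.Quotient.mk (Ideal.span {s})) 0 (by
      simp [hn]) : Cyc A n s →+* A ⧸ Ideal.span {s}) =
    Ideal.span {AdjoinRoot.root _} := by
  apply le_antisymm
  · intro x hx
    obtain ⟨P, rfl⟩ := AdjoinRoot.mk_surjective x
    rw [RingHom.mem_ker, AdjoinRoot.lift_mk, ← Polynomial.coe_eval₂RingHom] at hx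
    rw [← Polynomial.divX_mul_X_add P] at hx ⊢
    simp only [map_add, map_mul, Polynomial.coe_eval₂RingHom, Polynomial.eval₂_X, mul_zero, zero_add,
      Polynomial.eval₂_C, Ideal.Quotient.eq_zero_iff_mem] at hx
    obtain ⟨c, hc⟩ := Ideal.mem_span_singleton'.mp hx
    rw [map_add]
    refine Ideal.add_mem _ ?_ ?_
    · rw [map_mul, AdjoinRoot.mk_X]
      exact Ideal.mul_mem_left _ _ (Ideal.mem_span_singleton_self _)
    · rw [← hc, map_mul, map_mul]
      apply Ideal.mul_mem_left
      rw [AdjoinRoot.mk_C]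
      have h := Cyc.root_pow (n := n) s
      rw [AdjoinRoot.algebraMap_eq] at h
      rw [← h]
      exact Ideal.pow_mem_of_mem _ (Ideal.mem_span_singleton_self _) n (Nat.pos_of_ne_zero hn)
  · rw [Ideal.span_singleton_le_iff_mem, RingHom.mem_ker]
    exact AdjoinRoot.lift_root _

lemma Cyc.isPrime_span_root (hs : (Ideal.span {s}).IsPrime) :
    (Ideal.span {(AdjoinRoot.root _ : Cyc A n s)}).IsPrime := by
  rw [← Cyc.ker_eq_span hn s]
  exact RingHom.ker_isPrime _

/-- The root generates a prime ideal and is a non-zero-divisor, because its `n`-th power `s` is one.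
An element divisible by all its powers has coordinates, in a basis over `A`, divisible by all powers
of `s`; in a Noetherian domain these vanish. -/
lemma Cyc.isDomain [IsDomain A] [IsNoetherianRing A] (hs : Prime s) : IsDomain (Cyc A n s) := by
  have hfree := Cyc.free hn s
  have hsn : algebraMap A (Cyc A n s) s ∈ nonZeroDivisors (Cyc A n s) := by
    refine mem_nonZeroDivisors_iff_right.mpr fun x hx ↦ ?_
    rw [mul_comm, ← Algebra.smul_def] at hx
    exact (smul_eq_zero.mp hx).resolve_left hs.ne_zero
  refine isDomain_of_isPrime_span (AdjoinRoot.root _)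
    (Cyc.isPrime_span_root hn s ((Ideal.span_singleton_prime hs.ne_zero).mpr hs)) ?_ ?_
  · refine mem_nonZeroDivisors_iff_right.mpr fun x hx ↦ ?_
    refine mem_nonZeroDivisors_iff_right.mp hsn x ?_
    have h1 := mul_pow_sub_one hn (AdjoinRoot.root _ : Cyc A n s)
    rw [Cyc.root_pow] at h1
    rw [← h1, ← mul_assoc, hx, zero_mul]
  · intro x hx
    let b := Module.Free.chooseBasis A (Cyc A n s)
    apply b.repr.injective
    ext i
    rw [map_zero, Finsupp.zero_apply]
    by_contra h0
    have hfm := FiniteMultiplicity.of_prime_left hs h0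
    obtain ⟨l, hl⟩ := hfm
    apply hl
    obtain ⟨c, hc⟩ := hx (n * (l + 1))
    rw [pow_mul, Cyc.root_pow, ← map_pow, ← Algebra.smul_def] at hc
    rw [hc, map_smul, Finsupp.smul_apply, smul_eq_mul]
    exact dvd_mul_right _ _

lemma Cyc.prime_root [IsDomain A] [IsNoetherianRing A] (hs : Prime s) :
    Prime (AdjoinRoot.root _ : Cyc A n s) := by
  have := Cyc.isDomain hn s hs
  refine (Ideal.span_singleton_prime ?_).mp
    (Cyc.isPrime_span_root hn s ((Ideal.span_singleton_prime hs.ne_zero).mpr hs))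
  intro h
  have h2 := Cyc.root_pow (n := n) s
  rw [h, zero_pow hn] at h2
  exact hs.ne_zero (Cyc.algebraMap_injective hn s (by rw [← h2, map_zero]))

/-- If `s` is prime modulo the prime element `t`, then `t` remains prime in `A[p] / (p ^ n - s)`. -/
lemma Cyc.prime_algebraMap [IsDomain A] [IsNoetherianRing A] (hs : Prime s) {t : A} (ht : Prime t)
    (hts : ¬ t ∣ s) (hst : (Ideal.span {s, t}).IsPrime) : Prime (algebraMap A (Cyc A n s) t) := by
  have := Cyc.isDomain hn s hs
  have hfree := Cyc.free hn s
  have htp : (Ideal.span {t}).IsPrime := (Ideal.span_singleton_prime ht.ne_zero).mpr ht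
  -- The quotient of the extension by `t` is the Kummer extension of `A / t` by a root of the image
  -- of `s`. This image is prime, so the quotient is a domain.
  let q := Ideal.Quotient.mk (Ideal.span {t})
  have hq : Prime (q s) := by
    rw [← Ideal.span_singleton_prime]
    · have h : Ideal.span {q s} = (Ideal.span {s, t}).map q := by
        rw [Ideal.map_span, Set.image_pair]
        have h0 : q t = 0 := Ideal.Quotient.eq_zero_iff_mem.mpr (Ideal.mem_span_singleton_self t)
        rw [h0, Set.pair_comm, Ideal.span_insert_zero]
      rw [h]
      refine Ideal.map_isPrime_of_surjective Ideal.Quotient.mk_surjective ?_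
      rw [Ideal.mk_ker]
      exact Ideal.span_mono (by simp)
    · rw [Ne, Ideal.Quotient.eq_zero_iff_mem, Ideal.mem_span_singleton]
      exact hts
  rw [← Ideal.span_singleton_prime]
  · have hdom := Cyc.isDomain hn (q s) hq
    let e := AdjoinRoot.quotAdjoinRootEquivQuotPolynomialQuot (Ideal.span {t})
      (Polynomial.X ^ n - Polynomial.C s)
    have h1 : (Polynomial.X ^ n - Polynomial.C s).map q = Polynomial.X ^ n - Polynomial.C (q s) := by
      simp
    have h2 : IsDomain (Polynomial (A ⧸ Ideal.span {t}) ⧸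
        Ideal.span {(Polynomial.X ^ n - Polynomial.C s).map q}) := by
      rw [h1]
      exact hdom
    have h3 := e.toMulEquiv.isDomain _
    have h4 : (Ideal.span {t}).map (AdjoinRoot.of (Polynomial.X ^ n - Polynomial.C s)) =
        Ideal.span {algebraMap A (Cyc A n s) t} := by
      rw [Ideal.map_span, Set.image_singleton]
      rfl
    rw [← h4]
    exact (Ideal.Quotient.isDomain_iff_prime _).mp h3
  · rw [Ne, FaithfulSMul.algebraMap_eq_zero_iff]
    exact ht.ne_zero

end Cyc

/-- The `A`-algebra `C` is generated by `p`, `q` with the relations `p ^ n = f`, `q ^ n = g`. -/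
structure IsBikummer {A C : Type} [CommRing A] [CommRing C] [Algebra A C] (n : ℕ) (f g : A)
    (p q : C) : Prop where
  pow_fst : p ^ n = algebraMap A C f
  pow_snd : q ^ n = algebraMap A C g
  adjoin_eq_top : Algebra.adjoin A {p, q} = ⊤
  lift : ∀ {T : Type} [CommRing T] [Algebra A T] (a b : T), a ^ n = algebraMap A T f →
    b ^ n = algebraMap A T g → ∃ φ : C →ₐ[A] T, φ p = a ∧ φ q = b

section Bikummer

variable {A C : Type} [CommRing A] [CommRing C] [Algebra A C] {n : ℕ} {f g : A} {p q : C}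

lemma IsBikummer.symm (h : IsBikummer n f g p q) : IsBikummer n g f q p where
  pow_fst := h.pow_snd
  pow_snd := h.pow_fst
  adjoin_eq_top := by rw [Set.pair_comm, h.adjoin_eq_top]
  lift a b ha hb := by
    obtain ⟨φ, h1, h2⟩ := h.lift b a hb ha
    exact ⟨φ, h2, h1⟩

lemma algHom_ext_of_adjoin_pair {T : Type} [CommRing T] [Algebra A T]
    (h : Algebra.adjoin A {p, q} = ⊤) {φ ψ : C →ₐ[A] T} (hp : φ p = ψ p) (hq : φ q = ψ q) : φ = ψ := by
  apply AlgHom.ext_of_adjoin_eq_top h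
  rintro x (rfl | rfl)
  · exact hp
  · exact hq

lemma IsBikummer.exists_equiv (h : IsBikummer n f g p q) {C' : Type} [CommRing C'] [Algebra A C']
    {p' q' : C'} (h' : IsBikummer n f g p' q') : ∃ e : C ≃ₐ[A] C', e p = p' ∧ e q = q' := by
  obtain ⟨φ, h1, h2⟩ := h.lift p' q' h'.pow_fst h'.pow_snd
  obtain ⟨ψ, h3, h4⟩ := h'.lift p q h.pow_fst h.pow_snd
  exact ⟨AlgEquiv.ofAlgHom φ ψ
    (algHom_ext_of_adjoin_pair h'.adjoin_eq_top (by simp [h1, h3]) (by simp [h2, h4]))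
    (algHom_ext_of_adjoin_pair h.adjoin_eq_top (by simp [h1, h3]) (by simp [h2, h4])), h1, h2⟩

/-- The ring `A[p, q] / (p ^ n - f, q ^ n - g)`, as a tower of two extensions. -/
abbrev Cyc₂ (A : Type) [CommRing A] (n : ℕ) (f g : A) : Type :=
  Cyc (Cyc A n f) n (algebraMap A (Cyc A n f) g)

lemma isBikummer_cyc₂ (A : Type) [CommRing A] (n : ℕ) (f g : A) :
    IsBikummer n f g (algebraMap (Cyc A n f) (Cyc₂ A n f g) (AdjoinRoot.root _))
      (AdjoinRoot.root _ : Cyc₂ A n f g) where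
  pow_fst := by
    rw [← map_pow, Cyc.root_pow, ← IsScalarTower.algebraMap_apply]
  pow_snd := by
    rw [Cyc.root_pow, ← IsScalarTower.algebraMap_apply]
  adjoin_eq_top := by
    set S := Algebra.adjoin A {algebraMap (Cyc A n f) (Cyc₂ A n f g) (AdjoinRoot.root _),
      (AdjoinRoot.root _ : Cyc₂ A n f g)} with hS
    have h1 (c : Cyc A n f) : algebraMap (Cyc A n f) (Cyc₂ A n f g) c ∈ S := by
      have hc : c ∈ Algebra.adjoin A {AdjoinRoot.root (Polynomial.X ^ n - Polynomial.C f)} := by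
        rw [AdjoinRoot.adjoinRoot_eq_top]
        trivial
      have h2 : algebraMap _ _ c ∈ Subalgebra.map
          (IsScalarTower.toAlgHom A (Cyc A n f) (Cyc₂ A n f g)) _ := ⟨c, hc, rfl⟩
      rw [AlgHom.map_adjoin, Set.image_singleton] at h2
      exact Algebra.adjoin_mono (Set.singleton_subset_iff.mpr (Set.mem_insert _ _)) h2
    rw [eq_top_iff]
    intro x _
    have hx : x ∈ Algebra.adjoin (Cyc A n f) {(AdjoinRoot.root _ : Cyc₂ A n f g)} := by
      rw [AdjoinRoot.adjoinRoot_eq_top]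
      trivial
    induction hx using Algebra.adjoin_induction with
    | mem x hx =>
      rw [Set.mem_singleton_iff.mp hx]
      exact Algebra.subset_adjoin (Set.mem_insert_of_mem _ rfl)
    | algebraMap c => exact h1 c
    | add x y _ _ hx hy => exact add_mem (hx trivial) (hy trivial)
    | mul x y _ _ hx hy => exact mul_mem (hx trivial) (hy trivial)
  lift {T} _ _ a b ha hb := by
    obtain ⟨φ, hφ⟩ := Cyc.exists_lift f a ha
    let : Algebra (Cyc A n f) T := φ.toRingHom.toAlgebra
    have : IsScalarTower A (Cyc A n f) T := .of_algebraMap_eq fun x ↦ (φ.commutes x).symm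
    obtain ⟨ψ, hψ⟩ := Cyc.exists_lift (algebraMap A (Cyc A n f) g) b
      (by rw [hb, ← IsScalarTower.algebraMap_apply])
    exact ⟨ψ.restrictScalars A, (ψ.commutes _).trans hφ, hψ⟩

section Prime

variable [IsDomain A] [IsNoetherianRing A] (h : IsBikummer n f g p q) (hn : n ≠ 0) (hf : Prime f)
  (hg : Prime g) (hgf : ¬ g ∣ f) (hfg : (Ideal.span {f, g}).IsPrime)

include h hn hf hg hgf hfg

/-- The roots are adjoined one after the other. The element `g` remains prime once the root of `f`
is adjoined, so the one-step result applies twice. -/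
lemma IsBikummer.isDomain : IsDomain C := by
  obtain ⟨e, -⟩ := h.exists_equiv (isBikummer_cyc₂ A n f g)
  have := Cyc.isDomain hn f hf
  have := Cyc.finite hn f
  have := isNoetherian_of_isNoetherianRing_of_finite A (Cyc A n f)
  have : IsNoetherianRing (Cyc A n f) := isNoetherian_of_tower A this
  have h1 := Cyc.isDomain hn _ (Cyc.prime_algebraMap hn f hf hg hgf hfg)
  exact e.toMulEquiv.isDomain _

lemma IsBikummer.prime_snd : Prime q := by
  obtain ⟨e, -, he⟩ := h.exists_equiv (isBikummer_cyc₂ A n f g)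
  have := Cyc.isDomain hn f hf
  have := Cyc.finite hn f
  have := isNoetherian_of_isNoetherianRing_of_finite A (Cyc A n f)
  have : IsNoetherianRing (Cyc A n f) := isNoetherian_of_tower A this
  have h1 := Cyc.prime_root hn _ (Cyc.prime_algebraMap hn f hf hg hgf hfg)
  rw [← he] at h1
  exact (MulEquiv.prime_iff e).mp h1

lemma IsBikummer.prime_fst : Prime p := by
  refine h.symm.prime_snd hn hg hf ?_ (by rwa [Set.pair_comm])
  intro hd
  exact hgf (hf.irreducible.dvd_comm hg.irreducible |>.mp hd)

end Prime

lemma IsBikummer.isIntegral (h : IsBikummer n f g p q) (hn : n ≠ 0) : Algebra.IsIntegral A C := by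
  have h1 : ∀ x ∈ ({p, q} : Set C), IsIntegral A x := by
    rintro x (rfl | rfl)
    · refine IsIntegral.of_pow (Nat.pos_of_ne_zero hn) ?_
      rw [h.pow_fst]
      exact isIntegral_algebraMap
    · refine IsIntegral.of_pow (Nat.pos_of_ne_zero hn) ?_
      rw [h.pow_snd]
      exact isIntegral_algebraMap
  refine ⟨fun x ↦ ?_⟩
  have hx : x ∈ Algebra.adjoin A {p, q} := h.adjoin_eq_top ▸ trivial
  have := Algebra.IsIntegral.adjoin h1
  exact (this.isIntegral ⟨x, hx⟩).map (Algebra.adjoin A {p, q}).val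

lemma IsBikummer.finitePresentation (h : IsBikummer n f g p q) : Algebra.FinitePresentation A C := by
  obtain ⟨e, -⟩ := h.exists_equiv (isBikummer_cyc₂ A n f g)
  have : Algebra.FinitePresentation A (Cyc A n f) := inferInstance
  have : Algebra.FinitePresentation A (Cyc₂ A n f g) :=
    Algebra.FinitePresentation.trans A (Cyc A n f) _
  exact Algebra.FinitePresentation.equiv e.symm

lemma IsBikummer.algebraMap_injective (h : IsBikummer n f g p q) (hn : n ≠ 0) :
    Function.Injective (algebraMap A C) := by
  obtain ⟨e, -⟩ := h.exists_equiv (isBikummer_cyc₂ A n f g)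
  have h1 := (Cyc.algebraMap_injective hn (algebraMap A (Cyc A n f) g)).comp
    (Cyc.algebraMap_injective hn f)
  rw [← RingHom.coe_comp, ← IsScalarTower.algebraMap_eq] at h1
  rw [← e.toAlgHom.comp_algebraMap, RingHom.coe_comp] at h1
  exact h1.of_comp

/-- The ring of the étale cover. -/
lemma isBikummer_tensor (A : Type) [CommRing A] (n : ℕ) (f g : A) :
    IsBikummer (C := Cyc A n f ⊗[A] Cyc A n g) n f g
      (Algebra.TensorProduct.includeLeft (R := A) (S := A) (AdjoinRoot.root _))
      (Algebra.TensorProduct.includeRight (AdjoinRoot.root _)) where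
  pow_fst := by
    rw [← map_pow, Cyc.root_pow, AlgHom.commutes]
  pow_snd := by
    rw [← map_pow, Cyc.root_pow, AlgHom.commutes]
  adjoin_eq_top := by
    rw [eq_top_iff]
    intro x _
    induction x with
    | zero => exact zero_mem _
    | add x y hx hy => exact add_mem (hx trivial) (hy trivial)
    | tmul x y =>
      have hx : x ∈ Algebra.adjoin A {AdjoinRoot.root (Polynomial.X ^ n - Polynomial.C f)} := by
        rw [AdjoinRoot.adjoinRoot_eq_top]
        trivial
      have hy : y ∈ Algebra.adjoin A {AdjoinRoot.root (Polynomial.X ^ n - Polynomial.C g)} := by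
        rw [AdjoinRoot.adjoinRoot_eq_top]
        trivial
      have hx' : x ⊗ₜ[A] 1 ∈ Subalgebra.map (Algebra.TensorProduct.includeLeft :
          Cyc A n f →ₐ[A] Cyc A n f ⊗[A] Cyc A n g) _ := ⟨x, hx, rfl⟩
      have hy' : 1 ⊗ₜ[A] y ∈ Subalgebra.map (Algebra.TensorProduct.includeRight :
          Cyc A n g →ₐ[A] Cyc A n f ⊗[A] Cyc A n g) _ := ⟨y, hy, rfl⟩
      rw [AlgHom.map_adjoin, Set.image_singleton] at hx' hy'
      have : x ⊗ₜ[A] y = (x ⊗ₜ[A] 1 : Cyc A n f ⊗[A] Cyc A n g) * (1 ⊗ₜ[A] y) := by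
        rw [Algebra.TensorProduct.tmul_mul_tmul, one_mul, mul_one]
      rw [this]
      exact mul_mem (Algebra.adjoin_mono (Set.singleton_subset_iff.mpr (by simp)) hx')
        (Algebra.adjoin_mono (Set.singleton_subset_iff.mpr (by simp)) hy')
  lift {T} _ _ a b ha hb := by
    obtain ⟨φ, hφ⟩ := Cyc.exists_lift f a ha
    obtain ⟨ψ, hψ⟩ := Cyc.exists_lift g b hb
    exact ⟨Algebra.TensorProduct.productMap φ ψ, by simp [hφ], by simp [hψ]⟩

end Bikummer

end AbelianCover

end

/-! ### The integral closure in the ring of the étale cover -/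

open CategoryTheory CategoryTheory.Limits AlgebraicGeometry
noncomputable section
namespace AbelianCover

/-- If `P` is prime in `C` and `P * y ∈ C`, where `y` is integral over `C`, then `y ∈ C`. -/
lemma mem_range_of_prime_mul {C K : Type} [CommRing C] [CommRing K] [IsDomain K] [Algebra C K]
    (hinj : Function.Injective (algebraMap C K)) {P : C} (hP : Prime P) {y : K} (hy : IsIntegral C y)
    (h : algebraMap C K P * y ∈ (algebraMap C K).range) : y ∈ (algebraMap C K).range := by
  obtain ⟨c, hc⟩ := h
  obtain ⟨F, hF, hFy⟩ := hy
  -- Scaling the roots of a monic equation of `y` by `P` gives a monic equation of `c = P y` whose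
  -- lower coefficients are divisible by `P`. Hence `P` divides a power of `c`, and so `c` itself.
  have h1 : Polynomial.eval₂ (algebraMap C K) (algebraMap C K P * y) (F.scaleRoots P) = 0 :=
    Polynomial.scaleRoots_eval₂_eq_zero (algebraMap C K) hFy
  rw [← hc, Polynomial.eval₂_at_apply, ← map_zero (algebraMap C K)] at h1
  have h2 := hinj h1
  have hdvd : P ∣ c := by
    refine hP.dvd_of_dvd_pow (n := F.natDegree) ?_
    rw [Polynomial.eval_eq_sum_range, Polynomial.natDegree_scaleRoots, Finset.sum_range_succ] at h2
    have h3 : (F.scaleRoots P).coeff F.natDegree = 1 := by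
      rw [Polynomial.coeff_scaleRoots_natDegree, hF]
    rw [h3, one_mul] at h2
    have h4 : P ∣ ∑ i ∈ Finset.range F.natDegree, (F.scaleRoots P).coeff i * c ^ i := by
      refine Finset.dvd_sum fun i hi ↦ ?_
      rw [Polynomial.coeff_scaleRoots]
      refine Dvd.dvd.mul_right (Dvd.dvd.mul_left (dvd_pow_self P ?_) _) _
      have := Finset.mem_range.mp hi
      omega
    exact (dvd_add_right h4).mp (h2 ▸ dvd_zero P)
  obtain ⟨d, rfl⟩ := hdvd
  refine ⟨d, ?_⟩
  rw [map_mul] at hc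
  exact mul_left_cancel₀ (fun h0 ↦ hP.ne_zero (hinj (h0.trans (map_zero _).symm))) hc

/-- A ring in which `p`, `q` are prime is integrally closed in the ring obtained by inverting
`p` and `q`. -/
lemma mem_range_of_isIntegral {C K : Type} [CommRing C] [CommRing K] [IsDomain K] [Algebra C K]
    (hinj : Function.Injective (algebraMap C K)) {p q : C} (hp : Prime p) (hq : Prime q) (y : K)
    (hy : IsIntegral C y)
    (h : ∃ i j : ℕ, algebraMap C K (p ^ i * q ^ j) * y ∈ (algebraMap C K).range) :
    y ∈ (algebraMap C K).range := by
  obtain ⟨i, j, h⟩ := h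
  induction i with
  | zero =>
    rw [pow_zero, one_mul] at h
    induction j with
    | zero => simpa using h
    | succ j ih =>
      apply ih
      refine mem_range_of_prime_mul hinj hq (isIntegral_algebraMap.mul hy) ?_
      rw [← mul_assoc, ← map_mul, ← pow_succ']
      exact h
  | succ i ih =>
    apply ih
    refine mem_range_of_prime_mul hinj hp (isIntegral_algebraMap.mul hy) ?_
    rw [← mul_assoc, ← map_mul, ← mul_assoc, ← pow_succ']
    exact h

section

variable {B R' C K : Type} [CommRing B] [IsDomain B] [IsNoetherianRing B] [CommRing R']
  [CommRing C] [CommRing K] [Algebra B R'] [Algebra B C] [Algebra B K] [Algebra R' K] [Algebra C K]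
  [IsScalarTower B R' K] [IsScalarTower B C K] {n : ℕ} {s t : B} {p q : C}
  (h : IsBikummer n s t p q) (hn : n ≠ 0) (hs : Prime s) (ht : Prime t) (hts : ¬ t ∣ s)
  (hst : (Ideal.span {s, t}).IsPrime) (hBK : Function.Injective (algebraMap B K))

include h hn hs ht hts hst hBK in
-- In a domain integral over `B`, an ideal that contracts to zero is zero; the kernel does so
-- because `B` embeds in `K`.
lemma IsBikummer.algebraMap_injective_of_isIntegral : Function.Injective (algebraMap C K) := by
  have := h.isDomain hn hs ht hts hst
  have := h.isIntegral hn
  rw [RingHom.injective_iff_ker_eq_bot]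
  apply Ideal.eq_bot_of_comap_eq_bot (R := B)
  rw [RingHom.comap_ker, ← IsScalarTower.algebraMap_eq]
  exact (RingHom.injective_iff_ker_eq_bot _).mp hBK

omit [IsDomain B] [IsNoetherianRing B] in
include h in
/-- Every element of the étale cover becomes an element of `C` after multiplication by a power of
`p q`. -/
lemma IsBikummer.exists_mul_mem_range [IsLocalization.Away (s * t) R']
    (hK : Algebra.adjoin R' {algebraMap C K p, algebraMap C K q} = ⊤) (y : K) :
    ∃ k : ℕ, algebraMap C K ((p * q) ^ k) * y ∈ (algebraMap C K).range := by
  have key (k l : ℕ) (hkl : k ≤ l) (y : K)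
      (hy : algebraMap C K ((p * q) ^ k) * y ∈ (algebraMap C K).range) :
      algebraMap C K ((p * q) ^ l) * y ∈ (algebraMap C K).range := by
    obtain ⟨d, rfl⟩ := Nat.exists_eq_add_of_le' hkl
    rw [pow_add, map_mul, mul_assoc]
    exact mul_mem ⟨_, rfl⟩ hy
  have hy : y ∈ Algebra.adjoin R' {algebraMap C K p, algebraMap C K q} := hK ▸ trivial
  induction hy using Algebra.adjoin_induction with
  | mem x hx =>
    refine ⟨0, ?_⟩
    rw [pow_zero, map_one, one_mul]
    rcases hx with rfl | rfl
    · exact ⟨_, rfl⟩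
    · exact ⟨_, rfl⟩
  | algebraMap r =>
    obtain ⟨l, b, hb⟩ := IsLocalization.Away.surj (s * t) r
    refine ⟨n * l, algebraMap B C b, ?_⟩
    have h1 : (p * q) ^ n = algebraMap B C (s * t) := by
      rw [mul_pow, h.pow_fst, h.pow_snd, map_mul]
    rw [pow_mul, h1, ← map_pow, ← IsScalarTower.algebraMap_apply, ← IsScalarTower.algebraMap_apply,
      IsScalarTower.algebraMap_apply B R' K, IsScalarTower.algebraMap_apply B R' K, ← hb, map_mul,
      map_pow, map_pow, map_pow, mul_comm]
  | add x y _ _ hx hy =>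
    obtain ⟨k, hk⟩ := hx
    obtain ⟨l, hl⟩ := hy
    refine ⟨max k l, ?_⟩
    rw [mul_add]
    exact add_mem (key _ _ (le_max_left _ _) _ hk) (key _ _ (le_max_right _ _) _ hl)
  | mul x y _ _ hx hy =>
    obtain ⟨k, hk⟩ := hx
    obtain ⟨l, hl⟩ := hy
    refine ⟨k + l, ?_⟩
    rw [pow_add, map_mul, mul_mul_mul_comm]
    exact mul_mem hk hl

include h hn hs ht hts hst hBK in
-- Every element of `K` comes from the domain `C` after multiplication by a power of `p q`, which is
-- invertible in `K`.
lemma IsBikummer.isDomain_of_isLocalization [IsLocalization.Away (s * t) R']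
    (hK : Algebra.adjoin R' {algebraMap C K p, algebraMap C K q} = ⊤) : IsDomain K := by
  have hinj := h.algebraMap_injective_of_isIntegral hn hs ht hts hst hBK
  have := h.isDomain hn hs ht hts hst
  have hunit : IsUnit (algebraMap C K (p * q)) := by
    rw [← isUnit_pow_iff hn, ← map_pow, mul_pow, h.pow_fst, h.pow_snd, ← map_mul,
      ← IsScalarTower.algebraMap_apply, IsScalarTower.algebraMap_apply B R' K]
    exact (IsLocalization.Away.algebraMap_isUnit (s * t)).map _
  have : Nontrivial K := hinj.nontrivial
  have : NoZeroDivisors K := by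
    refine ⟨fun {x y} hxy ↦ ?_⟩
    obtain ⟨k, c, hc⟩ := h.exists_mul_mem_range (R' := R') hK x
    obtain ⟨l, d, hd⟩ := h.exists_mul_mem_range (R' := R') hK y
    have h0 : c * d = 0 := by
      apply hinj
      rw [map_mul, hc, hd, mul_mul_mul_comm, hxy, mul_zero, map_zero]
    rw [map_pow] at hc hd
    rcases mul_eq_zero.mp h0 with rfl | rfl
    · left
      rw [map_zero, eq_comm] at hc
      exact (hunit.pow k).mul_right_eq_zero.mp hc
    · right
      rw [map_zero, eq_comm] at hd
      exact (hunit.pow l).mul_right_eq_zero.mp hd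
  exact NoZeroDivisors.to_isDomain K

include h hn hs ht hts hst hBK in
/-- `C` is the integral closure of `B` in the ring of the étale cover. -/
lemma IsBikummer.mem_range_of_isIntegral [IsLocalization.Away (s * t) R']
    (hK : Algebra.adjoin R' {algebraMap C K p, algebraMap C K q} = ⊤) (y : K)
    (hy : IsIntegral B y) : y ∈ (algebraMap C K).range := by
  have := h.isDomain_of_isLocalization (R' := R') hn hs ht hts hst hBK hK
  refine AbelianCover.mem_range_of_isIntegral
    (h.algebraMap_injective_of_isIntegral hn hs ht hts hst hBK)
    (h.prime_fst hn hs ht hts hst) (h.prime_snd hn hs ht hts hst) y hy.tower_top ?_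
  obtain ⟨k, hk⟩ := h.exists_mul_mem_range (R' := R') hK y
  exact ⟨k, k, by rwa [← mul_pow]⟩

end

/-! ### Roots of the local equations as monomials in `z` and `w` -/

section Exponents

/-- `D` inverts the determinant modulo `n`, so `D` times the adjugate matrix inverts the matrix of
exponents modulo `n`; its rows are the exponents of `z`, `w` in `p`, `q`. The factors `s ^ (-k)` and
`t ^ (-k)` remove the surplus `n k` in `1 + n k`. -/
lemma exists_roots_of_commGroup {G : Type} [CommGroup G] {z w u v s t : G} {n a b d e D k : ℤ}
    (hz : z ^ n = u * s ^ a * t ^ b) (hw : w ^ n = v * s ^ d * t ^ e)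
    (hD : (a * e - b * d) * D = 1 + n * k) :
    let p := z ^ (e * D) * w ^ (-(b * D)) * s ^ (-k)
    let q := z ^ (-(d * D)) * w ^ (a * D) * t ^ (-k)
    p ^ n = u ^ (e * D) * v ^ (-(b * D)) * s ∧ q ^ n = u ^ (-(d * D)) * v ^ (a * D) * t ∧
      z = p ^ a * q ^ b * u ^ (-k) ∧ w = p ^ d * q ^ e * v ^ (-k) := by
  -- Written additively, these are linear identities with integral coefficients.
  have key {A : Type} [AddCommGroup A] {z w u v s t : A} (hz : n • z = u + a • s + b • t)
      (hw : n • w = v + d • s + e • t) :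
      let p := (e * D) • z + (-(b * D)) • w + (-k) • s
      let q := (-(d * D)) • z + (a * D) • w + (-k) • t
      n • p = (e * D) • u + (-(b * D)) • v + s ∧ n • q = (-(d * D)) • u + (a * D) • v + t ∧
        z = a • p + b • q + (-k) • u ∧ w = d • p + e • q + (-k) • v := by
    refine ⟨?_, ?_, ?_, ?_⟩
    · linear_combination (norm := module) (e * D) • hz - (b * D) • hw + hD • s
    · linear_combination (norm := module) (-(d * D)) • hz + (a * D) • hw + hD • t
    · linear_combination (norm := module) -k • hz - hD • z
    · linear_combination (norm := module) -k • hw - hD • w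
  exact key (A := Additive G) (z := Additive.ofMul z) (w := Additive.ofMul w)
    (u := Additive.ofMul u) (v := Additive.ofMul v) (s := Additive.ofMul s) (t := Additive.ofMul t)
    hz hw

lemma map_root_of_commGroup {G : Type} [CommGroup G] {z w s ζ : G} (σ : G →* G) {i j x y k : ℤ}
    (hz : σ z = ζ ^ i * z) (hw : σ w = ζ ^ j * w) (hs : σ s = s) :
    σ (z ^ x * w ^ y * s ^ k) = ζ ^ (x * i + y * j) * (z ^ x * w ^ y * s ^ k) := by
  rw [map_mul, map_mul, map_zpow, map_zpow, map_zpow, hz, hw, hs, mul_zpow, mul_zpow, zpow_add,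
    mul_comm x, mul_comm y, zpow_mul, zpow_mul]
  simp only [mul_assoc, mul_left_comm]

variable {B R' K : Type} [CommRing B] [CommRing R'] [CommRing K] [Algebra B R'] [Algebra R' K]
  [Algebra B K] [IsScalarTower B R' K]

/-- The ring of the étale cover contains `n`-th roots `p`, `q` of `s`, `t` up to units, which are
monomials in its generators `z`, `w`. -/
lemma exists_roots {n : ℕ} (hn : n ≠ 0) {f g : R'} {z w : K} (hzw : Algebra.adjoin R' {z, w} = ⊤)
    (hz : z ^ n = algebraMap R' K f) (hw : w ^ n = algebraMap R' K g) {s t : B}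
    (hs : IsUnit (algebraMap B R' s)) (ht : IsUnit (algebraMap B R' t))
    {c c' : R'} {u v : B} {a b d e : ℕ} (hc : IsUnit c) (hc' : IsUnit c') (hu : IsUnit u)
    (hv : IsUnit v) (hf : f = c ^ n * algebraMap B R' (u * s ^ a * t ^ b))
    (hg : g = c' ^ n * algebraMap B R' (v * s ^ d * t ^ e)) {D k : ℤ}
    (hD : ((a : ℤ) * e - b * d) * D = 1 + n * k) :
    ∃ (u' v' : Bˣ) (p q : K), p ^ n = algebraMap B K (u' * s) ∧ q ^ n = algebraMap B K (v' * t) ∧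
      Algebra.adjoin R' {p, q} = ⊤ ∧
      ∀ (σ : K →ₐ[R'] K) (ζ : Kˣ) (i j : ℤ), σ z = ↑(ζ ^ i) * z → σ w = ↑(ζ ^ j) * w →
        σ p = ↑(ζ ^ (e * D * i + -(b * D) * j)) * p ∧
        σ q = ↑(ζ ^ (-(d * D) * i + a * D * j)) * q := by
  obtain ⟨u, rfl⟩ := hu
  obtain ⟨v, rfl⟩ := hv
  obtain ⟨c, rfl⟩ := hc
  obtain ⟨c', rfl⟩ := hc'
  obtain ⟨s', hs'⟩ := hs
  obtain ⟨t', ht'⟩ := ht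
  have hfu : IsUnit f := by
    rw [hf, map_mul, map_mul, map_pow, map_pow, ← hs', ← ht']
    exact (c.isUnit.pow n).mul (((u.isUnit.map _).mul (s'.isUnit.pow a)).mul (t'.isUnit.pow b))
  have hgu : IsUnit g := by
    rw [hg, map_mul, map_mul, map_pow, map_pow, ← hs', ← ht']
    exact (c'.isUnit.pow n).mul (((v.isUnit.map _).mul (s'.isUnit.pow d)).mul (t'.isUnit.pow e))
  -- Everything is invertible on the étale cover, so the computation takes place in the group `Kˣ`,
  -- where negative exponents make sense.
  obtain ⟨z, rfl⟩ : IsUnit z := by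
    rw [← isUnit_pow_iff hn, hz]
    exact hfu.map _
  obtain ⟨w, rfl⟩ : IsUnit w := by
    rw [← isUnit_pow_iff hn, hw]
    exact hgu.map _
  let r : R'ˣ →* Kˣ := Units.map (algebraMap R' K)
  let r' : Bˣ →* Kˣ := Units.map (algebraMap B K)
  have hr' (x : B) : algebraMap B K x = algebraMap R' K (algebraMap B R' x) :=
    IsScalarTower.algebraMap_apply B R' K x
  have hz' : (z * (r c)⁻¹) ^ (n : ℤ) = r' u * (r s') ^ (a : ℤ) * (r t') ^ (b : ℤ) := by
    rw [zpow_natCast, zpow_natCast, zpow_natCast, mul_pow, inv_pow, mul_inv_eq_iff_eq_mul]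
    ext
    simp only [Units.val_mul, Units.val_pow_eq_pow_val, hz, hf, r, r', Units.coe_map, MonoidHom.coe_coe,
      hs', ht', map_mul, map_pow, hr']
    ring
  have hw' : (w * (r c')⁻¹) ^ (n : ℤ) = r' v * (r s') ^ (d : ℤ) * (r t') ^ (e : ℤ) := by
    rw [zpow_natCast, zpow_natCast, zpow_natCast, mul_pow, inv_pow, mul_inv_eq_iff_eq_mul]
    ext
    simp only [Units.val_mul, Units.val_pow_eq_pow_val, hw, hg, r, r', Units.coe_map, MonoidHom.coe_coe,
      hs', ht', map_mul, map_pow, hr']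
    ring
  obtain ⟨h1, h2, h3, h4⟩ := exists_roots_of_commGroup hz' hw' hD
  set p := (z * (r c)⁻¹) ^ ((e : ℤ) * D) * (w * (r c')⁻¹) ^ (-((b : ℤ) * D)) * (r s') ^ (-k)
  set q := (z * (r c)⁻¹) ^ (-((d : ℤ) * D)) * (w * (r c')⁻¹) ^ ((a : ℤ) * D) * (r t') ^ (-k)
  refine ⟨u ^ ((e : ℤ) * D) * v ^ (-((b : ℤ) * D)), u ^ (-((d : ℤ) * D)) * v ^ ((a : ℤ) * D), p, q,
    ?_, ?_, ?_, ?_⟩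
  · have := congrArg Units.val h1
    rw [zpow_natCast, Units.val_pow_eq_pow_val] at this
    rw [this, ← map_zpow, ← map_zpow, ← map_mul, Units.val_mul, map_mul (algebraMap B K), hr' s, ← hs']
    rfl
  · have := congrArg Units.val h2
    rw [zpow_natCast, Units.val_pow_eq_pow_val] at this
    rw [this, ← map_zpow, ← map_zpow, ← map_mul, Units.val_mul, map_mul (algebraMap B K), hr' t, ← ht']
    rfl
  -- Conversely `z` and `w` are monomials in `p`, `q` up to units of `R'`, so `p` and `q` generate
  -- the same algebra.
  · have hmem (x : Kˣ) (c : R'ˣ) (u : Bˣ) (i j : ℕ)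
        (h : x * (r c)⁻¹ = p ^ (i : ℤ) * q ^ (j : ℤ) * (r' u) ^ (-k)) :
        (x : K) ∈ Algebra.adjoin R' {(p : K), (q : K)} := by
      rw [mul_inv_eq_iff_eq_mul, zpow_natCast, zpow_natCast, ← map_zpow] at h
      rw [h]
      simp only [Units.val_mul, Units.val_pow_eq_pow_val]
      refine mul_mem (mul_mem (mul_mem (pow_mem (Algebra.subset_adjoin (by simp)) _)
        (pow_mem (Algebra.subset_adjoin (by simp)) _)) ?_) (Subalgebra.algebraMap_mem _ _)
      change algebraMap B K _ ∈ _
      rw [hr']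
      exact Subalgebra.algebraMap_mem _ _
    rw [eq_top_iff, ← hzw]
    apply Algebra.adjoin_le
    rintro x (rfl | rfl)
    · exact hmem z c u a b h3
    · exact hmem w c' v d e h4
  · intro σ ζ i j hi hj
    let τ : Kˣ →* Kˣ := Units.map σ
    have hτ (x : R'ˣ) : τ (r x) = r x := Units.ext (σ.commutes _)
    have hi' : τ (z * (r c)⁻¹) = ζ ^ i * (z * (r c)⁻¹) := by
      rw [map_mul, map_inv, hτ, ← mul_assoc]
      congr 1
      exact Units.ext hi
    have hj' : τ (w * (r c')⁻¹) = ζ ^ j * (w * (r c')⁻¹) := by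
      rw [map_mul, map_inv, hτ, ← mul_assoc]
      congr 1
      exact Units.ext hj
    exact ⟨congrArg Units.val (map_root_of_commGroup τ hi' hj' (hτ s')),
      congrArg Units.val (map_root_of_commGroup τ hi' hj' (hτ t'))⟩

end Exponents

end AbelianCover

end

/-! ### Smoothness, étaleness and ramification of Kummer extensions -/

open CategoryTheory CategoryTheory.Limits AlgebraicGeometry
open scoped TensorProduct
noncomputable section
namespace AbelianCover

lemma one_add_pow_of_sq_eq_zero {T : Type} [CommRing T] {x : T} (hx : x * x = 0) (n : ℕ) :
    (1 + x) ^ n = 1 + n * x := by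
  induction n with
  | zero => simp
  | succ n ih =>
    rw [pow_succ, ih]
    push_cast
    linear_combination n * hx

/-- If `p ^ n` agrees with `u s` modulo an ideal of square zero, then one can change `s`, and
thereafter `p`, such that equality holds, whatever the change of `u` which this entails. -/
lemma exists_root_lift {T : Type} [CommRing T] {I : Ideal T} (hI : ∀ x ∈ I, ∀ y ∈ I, x * y = 0)
    {n : ℕ} {m p u v s : T} (hm : m * n = 1) (hv : v * u = 1) (h : p ^ n - u * s ∈ I) (e : T)
    (he : e ∈ I) : ∃ p', p' - p ∈ I ∧ p' ^ n = (u + e) * (s + v * (p ^ n - u * s)) := by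
  have hx : m * v * e ∈ I := I.mul_mem_left _ he
  refine ⟨p * (1 + m * v * e), ?_, ?_⟩
  · rw [mul_add, mul_one, add_sub_cancel_left]
    exact I.mul_mem_left _ hx
  · rw [mul_pow, one_add_pow_of_sq_eq_zero (hI _ hx _ hx)]
    have h1 := hI _ he _ h
    generalize p ^ n = P at h1 ⊢
    linear_combination (P * v * e) * hm + (s * e - (P - u * s)) * hv

lemma mul_eq_zero_of_sq_eq_bot {T : Type} [CommRing T] {I : Ideal T} (hI : I ^ 2 = ⊥) :
    ∀ x ∈ I, ∀ y ∈ I, x * y = 0 := by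
  intro x hx y hy
  have := Ideal.mul_mem_mul hx hy
  rwa [← pow_two, hI, Ideal.mem_bot] at this

section

variable {B C : Type} [CommRing B] [CommRing C] [Algebra B C] {n : ℕ} {p q : C}

lemma IsBikummer.ringHom_ext {f g : B} (h : IsBikummer n f g p q) {T : Type} [CommRing T]
    {φ ψ : C →+* T} (hB : φ.comp (algebraMap B C) = ψ.comp (algebraMap B C)) (hp : φ p = ψ p)
    (hq : φ q = ψ q) : φ = ψ := by
  let : Algebra B T := (φ.comp (algebraMap B C)).toAlgebra
  let φ' : C →ₐ[B] T := { φ with commutes' := fun _ ↦ rfl }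
  let ψ' : C →ₐ[B] T := { ψ with commutes' := fun x ↦ congr($hB x).symm }
  have : φ' = ψ' := algHom_ext_of_adjoin_pair h.adjoin_eq_top hp hq
  ext x
  exact congr($this x)

variable [Algebra ℂ B] [Algebra ℂ C] [IsScalarTower ℂ B C]

/-- The ring `B[p, q] / (p ^ n - u s, q ^ n - v t)`, where `s`, `t` are coordinates on `B` and
`u`, `v` are units, is formally smooth. -/
lemma IsBikummer.formallySmooth {s t : B} {D : PolyXY} (hB : IsCoord s t D) {u v : Bˣ}
    (h : IsBikummer n (u * s) (v * t) p q) (hn : n ≠ 0) : Algebra.FormallySmooth ℂ C := by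
  refine .of_comp_surjective fun T _ _ I hI φ ↦ ?_
  have hI' := mul_eq_zero_of_sq_eq_bot hI
  let mk := Ideal.Quotient.mkₐ ℂ I
  have hmk (x y : T) : mk x = mk y ↔ x - y ∈ I := Ideal.Quotient.eq
  let φB : B →ₐ[ℂ] T ⧸ I := φ.comp (IsScalarTower.toAlgHom ℂ B C)
  have hlift (a b : T) (ha : mk a = φB s) (hb : mk b = φB t) :
      ∃ β : B →ₐ[ℂ] T, β s = a ∧ β t = b ∧ mk.comp β = φB := by
    obtain ⟨β, h1, h2⟩ := hB.lift a b (by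
      refine (IsNilpotent.isUnit_quotient_mk_iff ⟨2, hI⟩).mp ?_
      change IsUnit (mk _)
      rw [map_aeval_pair, ha, hb, ← map_aeval_pair]
      exact hB.isUnit.map φB)
    exact ⟨β, h1, h2, hB.ext _ _ (by simp [h1, ha]) (by simp [h2, hb])⟩
  obtain ⟨a, ha⟩ := Ideal.Quotient.mk_surjective (φB s)
  obtain ⟨b, hb⟩ := Ideal.Quotient.mk_surjective (φB t)
  obtain ⟨p₀, hp₀⟩ := Ideal.Quotient.mk_surjective (φ p)
  obtain ⟨q₀, hq₀⟩ := Ideal.Quotient.mk_surjective (φ q)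
  obtain ⟨β₀, h1, h2, h3⟩ := hlift a b ha hb
  have h3' (x : B) : mk (β₀ x) = φB x := congr($h3 x)
  have hroot (r : C) (r₀ : T) (x : B) (hr : r ^ n = algebraMap B C x) (hr₀ : mk r₀ = φ r) :
      r₀ ^ n - β₀ x ∈ I := by
    rw [← hmk, map_pow, hr₀, h3', ← map_pow, hr]
    rfl
  have hA := hroot p p₀ _ h.pow_fst hp₀
  have hA' := hroot q q₀ _ h.pow_snd hq₀
  rw [map_mul] at hA hA'
  have hus : β₀ ↑u⁻¹ * β₀ u = 1 := by rw [← map_mul, Units.inv_mul, map_one]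
  have hvs : β₀ ↑v⁻¹ * β₀ v = 1 := by rw [← map_mul, Units.inv_mul, map_one]
  -- The images of `s` and `t` can be changed freely by elements of `I`, so they are adjusted to the
  -- chosen lifts of `p` and `q`. This also moves the images of the units `u`, `v`, which is
  -- compensated below by changing the lifts of `p`, `q`.
  obtain ⟨β, h4, h5, h6⟩ := hlift (β₀ s + β₀ ↑u⁻¹ * (p₀ ^ n - β₀ u * β₀ s))
    (β₀ t + β₀ ↑v⁻¹ * (q₀ ^ n - β₀ v * β₀ t))
    (by
      rw [← h3', hmk, add_sub_cancel_left]
      exact I.mul_mem_left _ hA)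
    (by
      rw [← h3', hmk, add_sub_cancel_left]
      exact I.mul_mem_left _ hA')
  have h6' (x : B) : mk (β x) = φB x := congr($h6 x)
  have he (x : B) : β x - β₀ x ∈ I := by rw [← hmk, h3', h6']
  have hninv : algebraMap ℂ T (n : ℂ)⁻¹ * n = 1 := by
    rw [← map_natCast (algebraMap ℂ T) n, ← map_mul, inv_mul_cancel₀ (Nat.cast_ne_zero.mpr hn),
      map_one]
  obtain ⟨p', hp1, hp2⟩ := exists_root_lift hI' hninv hus hA _ (he u)
  obtain ⟨q', hq1, hq2⟩ := exists_root_lift hI' hninv hvs hA' _ (he v)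
  rw [add_sub_cancel, ← h4, ← map_mul] at hp2
  rw [add_sub_cancel, ← h5, ← map_mul] at hq2
  let : Algebra B T := β.toRingHom.toAlgebra
  obtain ⟨ψ, h7, h8⟩ := h.lift p' q' hp2 hq2
  let ψ' : C →ₐ[ℂ] T := { ψ with
    commutes' := fun c ↦ by
      rw [IsScalarTower.algebraMap_apply ℂ B C]
      exact (ψ.commutes _).trans (β.commutes c) }
  refine ⟨ψ', ?_⟩
  have : (mk.comp ψ').toRingHom = φ.toRingHom := by
    refine h.ringHom_ext ?_ ?_ ?_
    · ext x
      refine Eq.trans ?_ (h6' x)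
      exact congrArg mk (ψ.commutes x)
    · change mk (ψ p) = φ p
      rw [h7, ← hp₀]
      exact (hmk _ _).mpr hp1
    · change mk (ψ q) = φ q
      rw [h8, ← hq₀]
      exact (hmk _ _).mpr hq1
  exact AlgHom.ext fun x ↦ congr($this x)

end

/-- The dimension of a smooth surface which is finite over the affine plane. -/
lemma rank_kaehlerDifferential_eq_two (C : Type) [CommRing C] [IsDomain C] [Algebra ℂ C]
    [Algebra PolyXY C] [IsScalarTower ℂ PolyXY C] [FaithfulSMul PolyXY C]
    [Algebra.IsAlgebraic PolyXY C] [Module.Free C Ω[C⁄ℂ]] : Module.rank C Ω[C⁄ℂ] = 2 := by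
  let L := FractionRing C
  let F := FractionRing PolyXY
  have : FaithfulSMul PolyXY L := by
    rw [faithfulSMul_iff_algebraMap_injective, IsScalarTower.algebraMap_eq PolyXY C L]
    exact (IsFractionRing.injective C L).comp (FaithfulSMul.algebraMap_injective PolyXY C)
  let : Algebra F L := FractionRing.liftAlgebra PolyXY L
  have : Algebra.IsAlgebraic C L := IsLocalization.isAlgebraic _ (nonZeroDivisors C)
  have : Algebra.IsAlgebraic PolyXY L := Algebra.IsAlgebraic.trans PolyXY C L
  have : Algebra.IsAlgebraic F L := Algebra.IsAlgebraic.extendScalars (IsFractionRing.injective PolyXY F)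
  have : CharZero F := charZero_of_injective_algebraMap (algebraMap ℂ F).injective
  have : Algebra.FormallyEtale F L := Algebra.FormallyEtale.of_isSeparable F L
  have : Algebra.FormallyEtale PolyXY F := .of_isLocalization (nonZeroDivisors PolyXY)
  have : Algebra.FormallyEtale PolyXY L := .comp PolyXY F L
  have : Algebra.FormallyEtale C L := .of_isLocalization (nonZeroDivisors C)
  -- `L` is formally étale over both rings, by separability in characteristic zero. So both modules
  -- of differentials become that of `L` over `ℂ` after base change, and the rank is that of the
  -- affine plane.
  have e1 := KaehlerDifferential.tensorKaehlerEquivOfFormallyEtale ℂ PolyXY L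
  have e2 := KaehlerDifferential.tensorKaehlerEquivOfFormallyEtale ℂ C L
  have b := (KaehlerDifferential.mvPolynomialBasis ℂ (Fin 2)).baseChange L
  have h1 : Module.rank L (L ⊗[PolyXY] Ω[PolyXY⁄ℂ]) = 2 := by
    rw [rank_eq_card_basis b]
    simp
  rw [(e1.trans e2.symm).rank_eq, Module.rank_baseChange] at h1
  simpa using h1

/-- A smooth algebra is standard smooth on a cover by basic open sets, where the relative dimension
is the rank of the differentials. Zero is discarded from the cover so that the localizations are
domains. -/
lemma smoothOfRelativeDimension_two (C : Type) [CommRing C] [IsDomain C] [Algebra ℂ C]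
    [Algebra PolyXY C] [IsScalarTower ℂ PolyXY C] [FaithfulSMul PolyXY C]
    [Algebra.IsAlgebraic PolyXY C] [Algebra.FormallySmooth ℂ C] [Algebra.FinitePresentation ℂ C] :
    SmoothOfRelativeDimension 2 (Spec.map (CommRingCat.ofHom (algebraMap ℂ C))) := by
  rw [HasRingHomProperty.Spec_iff (P := @SmoothOfRelativeDimension 2)]
  have : Algebra.Smooth ℂ C := {}
  obtain ⟨s, hs, h⟩ := Algebra.Smooth.exists_span_eq_top_isStandardSmooth ℂ C
  refine ⟨s \ {0}, ?_, fun t ht ↦ ?_⟩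
  · rw [Ideal.span_sdiff_singleton_zero, hs]
  have hst := h t ht.1
  have h0 : t ≠ 0 := ht.2
  have hle : Submonoid.powers t ≤ nonZeroDivisors C := powers_le_nonZeroDivisors_of_noZeroDivisors h0
  have : IsDomain (Localization.Away t) := IsLocalization.isDomain_localization hle
  have : FaithfulSMul PolyXY (Localization.Away t) := by
    rw [faithfulSMul_iff_algebraMap_injective, IsScalarTower.algebraMap_eq PolyXY C]
    exact (IsLocalization.injective _ hle).comp (FaithfulSMul.algebraMap_injective PolyXY C)
  have : Algebra.IsAlgebraic C (Localization.Away t) :=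
    IsLocalization.isAlgebraic _ (Submonoid.powers t)
  have : Algebra.IsAlgebraic PolyXY (Localization.Away t) := Algebra.IsAlgebraic.trans PolyXY C _
  have h2 : (algebraMap C (Localization.Away t)).comp (algebraMap ℂ C) =
      algebraMap ℂ (Localization.Away t) := (IsScalarTower.algebraMap_eq ..).symm
  change RingHom.IsStandardSmoothOfRelativeDimension 2
    ((algebraMap C (Localization.Away t)).comp (algebraMap ℂ C))
  rw [h2, RingHom.isStandardSmoothOfRelativeDimension_algebraMap,
    Algebra.IsStandardSmoothOfRelativeDimension.iff_of_isStandardSmooth]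
  exact rank_kaehlerDifferential_eq_two _

section

variable {B C : Type} [CommRing B] [CommRing C] [Algebra B C] {n : ℕ} {p q : C}

/-- Kummer extensions by roots of units are étale. -/
lemma IsBikummer.etale {f g : B} (h : IsBikummer n f g p q) (hn : IsUnit (n : B)) (hn0 : n ≠ 0)
    (hf : IsUnit f) (hg : IsUnit g) : Algebra.Etale B C := by
  have hfp := h.finitePresentation
  suffices Algebra.FormallyEtale B C from {}
  rw [Algebra.FormallyEtale.iff_comp_bijective]
  intro T _ _ I hI
  have hI' := mul_eq_zero_of_sq_eq_bot hI
  -- Two roots of the same unit which agree modulo `I` differ by a factor `1 + x` with `x ^ 2 = 0`;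
  -- its `n`-th power `1 + n x` is `1` only if `x = 0`.
  have key : ∀ {r : C} {f : B}, IsUnit f → r ^ n = algebraMap B C f →
      ∀ φ ψ : C →ₐ[B] T, φ r - ψ r ∈ I → φ r = ψ r := by
    intro r f hf hr φ ψ hd
    have h1 : φ r ^ n = ψ r ^ n := by rw [← map_pow, ← map_pow, hr, φ.commutes, ψ.commutes]
    have hu : IsUnit (ψ r) := by
      rw [← isUnit_pow_iff hn0, ← map_pow, hr, ψ.commutes]
      exact hf.map _
    obtain ⟨u, hu⟩ := hu
    have h2 : φ r = ψ r * (1 + ↑u⁻¹ * (φ r - ψ r)) := by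
      rw [← hu, mul_add, mul_one, ← mul_assoc, Units.mul_inv, one_mul, add_sub_cancel]
    have h3 := hI' _ (I.mul_mem_left (↑u⁻¹) hd) _ (I.mul_mem_left (↑u⁻¹) hd)
    rw [h2, mul_pow, one_add_pow_of_sq_eq_zero h3, ← hu, mul_add, mul_one, add_eq_left] at h1
    have hn' : IsUnit (n : T) := by simpa using hn.map (algebraMap B T)
    have h4 := (u.isUnit.pow n).mul_right_eq_zero.mp h1
    have h5 := u⁻¹.isUnit.mul_right_eq_zero.mp (hn'.mul_right_eq_zero.mp h4)
    rw [← hu] at h2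
    rw [← hu]
    exact sub_eq_zero.mp h5
  have key2 : ∀ {f : B}, IsUnit f → ∀ r : T, r ^ n - algebraMap B T f ∈ I →
      ∃ r', r' - r ∈ I ∧ r' ^ n = algebraMap B T f := by
    intro f hf r hr
    obtain ⟨u, hu⟩ := hf.map (algebraMap B T)
    obtain ⟨ν, hν⟩ := hn.map (algebraMap B T)
    rw [map_natCast] at hν
    -- Here `s = 1` would be corrected by `u⁻¹ (r ^ n - u)`. Changing the unit `u` by `-(r ^ n - u)`
    -- cancels this up to a square, which is zero.
    obtain ⟨r', h1, h2⟩ := exists_root_lift (n := n) (m := ↑ν⁻¹) (p := r) (u := u) (v := ↑u⁻¹)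
      (s := 1) hI' (by rw [← hν, Units.inv_mul]) (by simp) (by rwa [mul_one, hu])
      (-(r ^ n - ↑u)) (by rw [hu]; exact I.neg_mem hr)
    refine ⟨r', h1, ?_⟩
    rw [h2, ← hu]
    have h3 := hI' _ hr _ hr
    have h4 : (u : T) * ↑u⁻¹ = 1 := by simp
    rw [← hu] at h3
    generalize r ^ n = P at h3 ⊢
    linear_combination (P - u) * h4 - (↑u⁻¹ : T) * h3
  constructor
  · intro φ ψ e
    have he : ∀ x, φ x - ψ x ∈ I := fun x ↦ Ideal.Quotient.eq.mp congr($e x)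
    exact algHom_ext_of_adjoin_pair h.adjoin_eq_top (key hf h.pow_fst φ ψ (he p))
      (key hg h.pow_snd φ ψ (he q))
  · intro φ
    obtain ⟨p₀, hp₀⟩ := Ideal.Quotient.mk_surjective (φ p)
    obtain ⟨q₀, hq₀⟩ := Ideal.Quotient.mk_surjective (φ q)
    obtain ⟨p', hp1, hp2⟩ := key2 hf p₀ (by
      rw [← Ideal.Quotient.eq, map_pow, hp₀, ← map_pow, h.pow_fst, φ.commutes]
      rfl)
    obtain ⟨q', hq1, hq2⟩ := key2 hg q₀ (by
      rw [← Ideal.Quotient.eq, map_pow, hq₀, ← map_pow, h.pow_snd, φ.commutes]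
      rfl)
    obtain ⟨ψ, h7, h8⟩ := h.lift p' q' hp2 hq2
    refine ⟨ψ, algHom_ext_of_adjoin_pair h.adjoin_eq_top ?_ ?_⟩
    · rw [← hp₀, AlgHom.comp_apply, h7]
      exact Ideal.Quotient.eq.mpr hp1
    · rw [← hq₀, AlgHom.comp_apply, h8]
      exact Ideal.Quotient.eq.mpr hq1

/-- Kummer extensions are ramified along the zeros of the root. -/
lemma IsBikummer.not_formallyUnramified {f g : B} (h : IsBikummer n f g p q) (hn : 2 ≤ n)
    {L : Type} [Field L] (χ : C →+* L) (hp : χ p = 0) {a : C} (ha : χ a ≠ 0) (C' : Type)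
    [CommRing C'] [Algebra C C'] [Algebra B C'] [IsScalarTower B C C']
    [IsLocalization.Away a C'] : ¬ Algebra.FormallyUnramified B C' := by
  intro hC
  let : Algebra B L := (χ.comp (algebraMap B C)).toAlgebra
  have hT : ∀ b : B, algebraMap B (DualNumber L) b = TrivSqZeroExt.inl (χ (algebraMap B C b)) :=
    fun b ↦ rfl
  have hq : TrivSqZeroExt.inl (χ q) ^ n = algebraMap B (DualNumber L) g := by
    rw [hT, ← h.pow_snd, map_pow, TrivSqZeroExt.inl_pow]
  have hf : (0 : DualNumber L) = algebraMap B (DualNumber L) f := by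
    rw [hT, ← h.pow_fst, map_pow, hp, zero_pow (by lia), TrivSqZeroExt.inl_zero]
  -- In the dual numbers both `0` and `ε` have `n`-th power zero, as `n ≥ 2`. The two resulting
  -- homomorphisms agree modulo `ε` but differ on `p`.
  obtain ⟨φ₁, h1, h2⟩ := h.lift (T := DualNumber L) 0 (TrivSqZeroExt.inl (χ q))
    (by rw [zero_pow (by lia), hf]) hq
  obtain ⟨φ₂, h3, h4⟩ := h.lift (T := DualNumber L) DualNumber.eps (TrivSqZeroExt.inl (χ q))
    (by rw [← hf, ← Nat.sub_add_cancel hn, pow_add, DualNumber.eps_pow_two, mul_zero]) hq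
  let π : DualNumber L →ₐ[B] L := TrivSqZeroExt.fstHom B L L
  have e : π.comp φ₁ = π.comp φ₂ := algHom_ext_of_adjoin_pair h.adjoin_eq_top
    (by simp [π, h1, h3]) (by simp [π, h2, h4])
  have eχ : ∀ x, π (φ₁ x) = χ x := by
    let χ' : C →ₐ[B] L := { χ with commutes' := fun _ ↦ rfl }
    have : π.comp φ₁ = χ' := algHom_ext_of_adjoin_pair h.adjoin_eq_top
      (by simp [π, h1]; exact hp.symm) (by simp [π, h2]; rfl)
    exact fun x ↦ congr($this x)
  have hu : ∀ φ : C →ₐ[B] DualNumber L, π (φ a) = χ a → IsUnit (φ a) := fun φ hφ ↦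
    TrivSqZeroExt.isUnit_iff_isUnit_fst.mpr (by
      change IsUnit (π (φ a))
      rw [hφ]
      exact ha.isUnit)
  have hu1 := hu φ₁ (eχ a)
  have hu2 := hu φ₂ (congr($e a).symm.trans (eχ a))
  let ψ (φ : C →ₐ[B] DualNumber L) (hφ : IsUnit (φ a)) : C' →ₐ[B] DualNumber L :=
    { IsLocalization.Away.lift a (S := C') (g := φ.toRingHom) hφ with
      commutes' := fun b ↦ by
        rw [IsScalarTower.algebraMap_apply B C C']
        exact (IsLocalization.Away.lift_eq a hφ _).trans (φ.commutes b) }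
  have hψ : ∀ φ hφ x, ψ φ hφ (algebraMap C C' x) = φ x := fun φ hφ x ↦
    IsLocalization.Away.lift_eq a hφ x
  have hker : IsNilpotent (RingHom.ker (π : DualNumber L →+* L)) := by
    exact ⟨2, TrivSqZeroExt.kerIdeal_sq L L⟩
  have := Algebra.FormallyUnramified.lift_unique' π hker (ψ φ₁ hu1) (ψ φ₂ hu2) (by
    apply AlgHom.coe_ringHom_injective
    refine IsLocalization.ringHom_ext (Submonoid.powers a) ?_
    ext x
    exact (congrArg π (hψ φ₁ hu1 x)).trans (congr($e x).trans (congrArg π (hψ φ₂ hu2 x)).symm))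
  have h5 : φ₁ p = φ₂ p := by rw [← hψ φ₁ hu1, ← hψ φ₂ hu2, this]
  rw [h1, h3] at h5
  have := congrArg TrivSqZeroExt.snd h5
  simp at this

end

/-! ### The local model with its action of `(ℤ/n)²` -/

/-- The action of `(ℤ/n)²` on the coordinate ring of the étale cover. -/
abbrev actK (n : ℕ) (m : Fin 4 → ℕ) (k : Fin 3 → ℕ) (g : ZMod n × ZMod n) :
    Kummer n m k →ₐ[R] Kummer n m k :=
  Algebra.TensorProduct.map (cycAct n (formZ n m 1 xc 1 yc) g.1) (cycAct n (formW k 1 xc) g.2)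

/-- `K` is a cover of the complement of the seven curves, with an action `σ` of `(ℤ/n)²`, and `C` is
the integral closure of `B` in `K`. It is generated by `n`-th roots `p`, `q` of `s`, `t`, on which
`(ℤ/n)²` acts through the coordinates of an automorphism `χ` of `(ℤ/n)²`. -/
structure IsLocalModel {B C K : Type} [CommRing B] [CommRing C] [CommRing K] [Algebra B C]
    [Algebra ℂ C] [Algebra R K] (n : ℕ) (σ : ZMod n × ZMod n → K →ₐ[R] K) (i : B →+* R) (s t : B)
    (p q : C) (ψ : C →+* K) (χ : ZMod n × ZMod n ≃+ ZMod n × ZMod n)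
    (α : ZMod n × ZMod n → C →ₐ[B] C) : Prop where
  isBikummer : IsBikummer n s t p q
  comp_algebraMap : ψ.comp (algebraMap B C) = (algebraMap R K).comp i
  injective : Function.Injective ψ
  mem_range : ∀ y, ((algebraMap R K).comp i).IsIntegralElem y → ∃ c, ψ c = y
  act_fst : ∀ g, α g p = algebraMap ℂ C (zeta n ^ (χ g).1.val) * p
  act_snd : ∀ g, α g q = algebraMap ℂ C (zeta n ^ (χ g).2.val) * q
  comp_act : ∀ g x, ψ (α g x) = σ g (ψ x)

lemma cycAct_root {A : Type} [CommRing A] [Algebra ℂ A] (n : ℕ) (f : A) (a : ZMod n) :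
    cycAct n f a (AdjoinRoot.root _) =
      algebraMap ℂ (Cyc A n f) (zeta n ^ a.val) * AdjoinRoot.root _ :=
  AdjoinRoot.liftAlgHom_root ..

lemma isUnit_zeta (n : ℕ) : IsUnit (zeta n) := (Complex.exp_ne_zero _).isUnit

lemma zpow_eq_pow_val {G : Type} [Group G] {ζ : G} {n : ℕ} [NeZero n] (hζ : ζ ^ n = 1) (x : ℤ) :
    ζ ^ x = ζ ^ (x : ZMod n).val := by
  rw [← zpow_natCast ζ (ZMod.val _), ZMod.val_intCast]
  exact zpow_eq_zpow_emod x (by rwa [zpow_natCast])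

/-- The automorphism of `A²` given by an invertible matrix. -/
def addEquivOfMatrix {A : Type} [CommRing A] (a b d e D : A) (h : (a * e - b * d) * D = 1) :
    A × A ≃+ A × A where
  toFun g := (e * D * g.1 + -(b * D) * g.2, -(d * D) * g.1 + a * D * g.2)
  invFun g := (a * g.1 + b * g.2, d * g.1 + e * g.2)
  left_inv g := by
    ext
    · linear_combination g.1 * h
    · linear_combination g.2 * h
  right_inv g := by
    ext
    · linear_combination g.1 * h
    · linear_combination g.2 * h
  map_add' g g' := by
    ext
    · simp only [Prod.fst_add, Prod.snd_add]
      ring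
    · simp only [Prod.fst_add, Prod.snd_add]
      ring

lemma exists_isBikummer (B : Type) [CommRing B] [Algebra ℂ B] (n : ℕ) (f g : B) :
    ∃ (C : Type) (_ : CommRing C) (_ : Algebra ℂ C) (_ : Algebra B C) (_ : IsScalarTower ℂ B C)
      (p q : C), IsBikummer n f g p q :=
  ⟨Cyc₂ B n f g, inferInstance, inferInstance, inferInstance, inferInstance, _, _,
    isBikummer_cyc₂ B n f g⟩

section

variable {h : PolyXY} {B : Type} [CommRing B] [Algebra ℂ B] [Algebra PolyXY B]
  [IsScalarTower ℂ PolyXY B] [IsLocalization.Away h B]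

omit [Algebra ℂ B] [IsScalarTower ℂ PolyXY B] in
variable (h) in
lemma isLocalization_away_mul_X_mul_Y (E : Type) [CommRing E] [Algebra B E] [Algebra PolyXY E]
    [IsScalarTower PolyXY B E] [IsLocalization.Away (sX B * sY B) E] :
    IsLocalization.Away (h * MvPolynomial.X 0 * MvPolynomial.X 1) E := by
  rw [mul_assoc]
  exact IsLocalization.Away.mul_of_associated h _ (sX B * sY B) (by rw [map_mul])

/-- `R` and the localization of `B` at `s t` both represent pairs of coordinates at which `h s t` is
invertible. -/
lemma isLocalization_away_of_isCoord (i : B →ₐ[ℂ] R)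
    (hi : IsCoord (i (sX B)) (i (sY B)) (h * MvPolynomial.X 0 * MvPolynomial.X 1)) :
    letI := i.toRingHom.toAlgebra
    IsLocalization.Away (sX B * sY B) R := by
  let := i.toRingHom.toAlgebra
  let E := Localization.Away (sX B * sY B)
  have := isLocalization_away_mul_X_mul_Y h (B := B) E
  obtain ⟨e, h0, h1⟩ := hi.exists_equiv E
  have hc : e.toAlgHom.comp (IsScalarTower.toAlgHom ℂ B E) = i :=
    (isCoord_localization h B).ext _ _ h0 h1
  exact IsLocalization.isLocalization_of_algEquiv _
    ({ e with commutes' := fun x ↦ congr($hc x) } : E ≃ₐ[B] R)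

variable {K : Type} [CommRing K] [Algebra R K] [Algebra ℂ K] [IsScalarTower ℂ R K] {n : ℕ}

omit [IsScalarTower ℂ R K] in
/-- The roots of the coordinates `s`, `t` in the étale cover, and the action on them. -/
lemma exists_roots_act (hn : n ≠ 0) {f g : R} {z w : K} (hK : IsBikummer n f g z w)
    (σ : ZMod n × ZMod n → K →ₐ[R] K) (hz : ∀ g, σ g z = algebraMap ℂ K (zeta n ^ g.1.val) * z)
    (hw : ∀ g, σ g w = algebraMap ℂ K (zeta n ^ g.2.val) * w) (i : B →ₐ[ℂ] R)
    (hi : IsCoord (i (sX B)) (i (sY B)) (h * MvPolynomial.X 0 * MvPolynomial.X 1))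
    (hm : IsMonomialPair n i.toRingHom (sX B) (sY B) f g) :
    ∃ (u v : Bˣ) (p q : K) (χ : ZMod n × ZMod n ≃+ ZMod n × ZMod n),
      p ^ n = algebraMap R K (i (u * sX B)) ∧ q ^ n = algebraMap R K (i (v * sY B)) ∧
      Algebra.adjoin R {p, q} = ⊤ ∧
      ∀ g, σ g p = algebraMap ℂ _ (zeta n ^ (χ g).1.val) * p ∧
        σ g q = algebraMap ℂ _ (zeta n ^ (χ g).2.val) * q := by
  have : NeZero n := ⟨hn⟩
  let : Algebra B R := i.toRingHom.toAlgebra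
  have hloc : IsLocalization.Away (sX B * sY B) R := isLocalization_away_of_isCoord i hi
  let : Algebra B K := ((algebraMap R K).comp i.toRingHom).toAlgebra
  have : IsScalarTower B R K := .of_algebraMap_eq fun _ ↦ rfl
  obtain ⟨c, c', u₀, v₀, a, b, d, e, hc, hc', hu₀, hv₀, hf, hg, D, y, hco⟩ := hm
  -- The Bézout coefficient `D` inverts the determinant modulo `n`; the same `D` enters the matrix
  -- of `χ`.
  have hD : ((a : ℤ) * e - b * d) * D = 1 + n * (-y) := by linear_combination hco
  have hst : IsUnit (algebraMap B R (sX B * sY B)) := IsLocalization.Away.algebraMap_isUnit _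
  rw [map_mul, IsUnit.mul_iff] at hst
  obtain ⟨u, v, p, q, hp, hq, hadj, hact⟩ := exists_roots (B := B) hn hK.adjoin_eq_top hK.pow_fst
    hK.pow_snd hst.1 hst.2 hc hc' hu₀ hv₀ hf hg hD
  have hD' : ((a : ZMod n) * e - b * d) * D = 1 := by
    have := congrArg (Int.cast : ℤ → ZMod n) hD
    push_cast at this
    rw [this, CharP.cast_eq_zero, zero_mul, add_zero]
  obtain ⟨ζ, hζ⟩ := isUnit_zeta n
  let ζK : Kˣ := Units.map (algebraMap ℂ K) ζ
  have hζK : ζK ^ n = 1 := by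
    ext
    simp [ζK, hζ, ← map_pow, zeta_pow]
  have hval (N : ℕ) : ((ζK ^ N : Kˣ) : K) = algebraMap ℂ K (zeta n ^ N) := by
    simp [ζK, hζ]
  refine ⟨u, v, p, q, addEquivOfMatrix (a : ZMod n) b d e D hD', hp, hq, hadj, fun g ↦ ?_⟩
  obtain ⟨h1, h2⟩ := hact (σ g) ζK g.1.val g.2.val (by rw [zpow_natCast, hval, hz])
    (by rw [zpow_natCast, hval, hw])
  rw [h1, h2, zpow_eq_pow_val hζK, zpow_eq_pow_val hζK, hval, hval]
  push_cast
  simp only [ZMod.natCast_zmod_val]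
  exact ⟨rfl, rfl⟩

variable {C : Type} [CommRing C] [Algebra B C] [Algebra ℂ C] [IsScalarTower ℂ B C]

omit [Algebra ℂ B] [IsScalarTower ℂ PolyXY B] in
lemma isPrime_span_unit_mul_pair (hh : MvPolynomial.constantCoeff h ≠ 0) (u v : Bˣ) :
    (Ideal.span {(u : B) * sX B, (v : B) * sY B}).IsPrime := by
  have := isPrime_span_pair hh B
  rwa [Ideal.span_insert, Ideal.span_singleton_mul_left_unit u.isUnit,
    Ideal.span_singleton_mul_left_unit v.isUnit, ← Ideal.span_insert]

omit [Algebra ℂ B] [IsScalarTower ℂ PolyXY B] in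
include h in
lemma prime_unit_mul_X (hh : MvPolynomial.constantCoeff h ≠ 0) (u : Bˣ) (j : Fin 2) :
    Prime ((u : B) * algebraMap PolyXY B (MvPolynomial.X j)) :=
  (associated_unit_mul_right _ _ u.isUnit).prime (prime_algebraMap_X hh B j)

omit [Algebra ℂ B] [IsScalarTower ℂ PolyXY B] in
lemma not_unit_mul_dvd (hh : MvPolynomial.constantCoeff h ≠ 0) (u v : Bˣ) :
    ¬ (v : B) * sY B ∣ u * sX B := by
  rw [Units.mul_left_dvd, Units.dvd_mul_left]
  rintro ⟨c, hc⟩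
  obtain ⟨l, a, ha⟩ := IsLocalization.Away.surj h c
  have h1 : MvPolynomial.X 1 ∣ h ^ l * MvPolynomial.X 0 := by
    refine ⟨a, IsLocalization.injective B (powers_le_nonZeroDivisors hh) ?_⟩
    rw [map_mul, map_mul, ← ha, map_pow]
    linear_combination algebraMap PolyXY B h ^ l * hc
  have hX : Prime (MvPolynomial.X 1 : PolyXY) := MvPolynomial.X_prime
  rcases hX.dvd_or_dvd h1 with h2 | h2
  · obtain ⟨b, rfl⟩ := hX.dvd_of_dvd_pow h2
    simp at hh
  · simp [MvPolynomial.X_dvd_X] at h2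

/-- `C` maps to `K` by sending its roots to `p'`, `q'`, and its image is integrally closed because
the roots are prime. The roots of unity by which the group acts on `p'`, `q'` also define the action
on `C`; the two actions are compatible since they agree on generators. -/
lemma exists_isLocalModel (hh : MvPolynomial.constantCoeff h ≠ 0) (hn : n ≠ 0)
    (σ : ZMod n × ZMod n → K →ₐ[R] K) (i : B →ₐ[ℂ] R)
    (hRK : Function.Injective (algebraMap R K))
    (hi : IsCoord (i (sX B)) (i (sY B)) (h * MvPolynomial.X 0 * MvPolynomial.X 1))
    {u v : Bˣ} {p' q' : K} (χ : ZMod n × ZMod n ≃+ ZMod n × ZMod n)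
    (hp : p' ^ n = algebraMap R K (i (u * sX B))) (hq : q' ^ n = algebraMap R K (i (v * sY B)))
    (hadj : Algebra.adjoin R {p', q'} = ⊤)
    (hσ : ∀ g, σ g p' = algebraMap ℂ _ (zeta n ^ (χ g).1.val) * p' ∧
        σ g q' = algebraMap ℂ _ (zeta n ^ (χ g).2.val) * q') {p q : C}
    (hC : IsBikummer n (u * sX B) (v * sY B) p q) :
    IsDomain K ∧ ∃ (ψ : C →+* K) (α : ZMod n × ZMod n → C →ₐ[B] C),
      IsLocalModel n σ i.toRingHom (u * sX B) (v * sY B) p q ψ χ α := by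
  have := isDomain_localization_of_constantCoeff hh B
  have : IsNoetherianRing B := IsLocalization.isNoetherianRing (Submonoid.powers h) _ inferInstance
  let : Algebra B R := i.toRingHom.toAlgebra
  have hloc : IsLocalization.Away (sX B * sY B) R := isLocalization_away_of_isCoord i hi
  have hloc' : IsLocalization.Away ((u * sX B) * (v * sY B)) R := by
    refine IsLocalization.Away.of_associated (r := sX B * sY B) ?_
    exact (associated_unit_mul_right _ _ u.isUnit).mul_mul (associated_unit_mul_right _ _ v.isUnit)
  let : Algebra B K := ((algebraMap R K).comp i.toRingHom).toAlgebra
  have : IsScalarTower B R K := .of_algebraMap_eq fun _ ↦ rfl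
  have : IsScalarTower ℂ B K := .of_algebraMap_eq fun x ↦ by
    rw [IsScalarTower.algebraMap_apply ℂ R K, ← i.commutes]
    rfl
  obtain ⟨ψ, hψp, hψq⟩ := hC.lift p' q' hp hq
  let : Algebra C K := ψ.toRingHom.toAlgebra
  have : IsScalarTower B C K := .of_algebraMap_eq fun x ↦ (ψ.commutes x).symm
  have hs := prime_unit_mul_X hh u 0
  have ht := prime_unit_mul_X hh v 1
  have hst := isPrime_span_unit_mul_pair hh u v
  have hdvd := not_unit_mul_dvd hh u v
  have hBR : Function.Injective (algebraMap B R) := IsLocalization.injective R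
    (powers_le_nonZeroDivisors_of_noZeroDivisors (mul_ne_zero hs.ne_zero ht.ne_zero))
  have hBK : Function.Injective (algebraMap B K) := hRK.comp hBR
  have hadj' : Algebra.adjoin R {algebraMap C K p, algebraMap C K q} = ⊤ := by
    rw [← hadj, ← hψp, ← hψq]
    rfl
  have hα (g : ZMod n × ZMod n) : ∃ a : C →ₐ[B] C,
      a p = algebraMap ℂ C (zeta n ^ (χ g).1.val) * p ∧
      a q = algebraMap ℂ C (zeta n ^ (χ g).2.val) * q := by
    have (N : ℕ) : (zeta n ^ N) ^ n = 1 := by rw [← pow_mul, mul_comm, pow_mul, zeta_pow, one_pow]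
    apply hC.lift
    · rw [mul_pow, ← map_pow, this, map_one, one_mul, hC.pow_fst]
    · rw [mul_pow, ← map_pow, this, map_one, one_mul, hC.pow_snd]
  choose α hα using hα
  refine ⟨hC.isDomain_of_isLocalization (R' := R) hn hs ht hdvd hst hBK hadj', ψ, α, hC, ?_, ?_, ?_,
    fun g ↦ (hα g).1, fun g ↦ (hα g).2, fun g ↦ ?_⟩
  · ext x
    exact ψ.commutes x
  · exact hC.algebraMap_injective_of_isIntegral hn hs ht hdvd hst hBK
  · exact fun y hy ↦ hC.mem_range_of_isIntegral (R' := R) hn hs ht hdvd hst hBK hadj' y hy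
  · have hψℂ (c : ℂ) : ψ (algebraMap ℂ C c) = algebraMap ℂ K c := by
      rw [IsScalarTower.algebraMap_apply ℂ B C, ψ.commutes, ← IsScalarTower.algebraMap_apply]
    have : ψ.comp (α g) = ((σ g).restrictScalars B).comp ψ := by
      apply algHom_ext_of_adjoin_pair hC.adjoin_eq_top
      · simp [hα, hψℂ, hψp, hσ]
      · simp [hα, hψℂ, hψq, hσ]
    exact fun x ↦ congr($this x)

end

lemma actK_fst (n : ℕ) (m : Fin 4 → ℕ) (k : Fin 3 → ℕ) (g : ZMod n × ZMod n) :
    actK n m k g (Algebra.TensorProduct.includeLeft (R := R) (S := R) (AdjoinRoot.root _)) =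
      algebraMap ℂ (Kummer n m k) (zeta n ^ g.1.val) *
        Algebra.TensorProduct.includeLeft (R := R) (S := R) (AdjoinRoot.root _) := by
  rw [Algebra.TensorProduct.includeLeft_apply, Algebra.TensorProduct.map_tmul, cycAct_root, map_one,
    Algebra.TensorProduct.algebraMap_apply, Algebra.TensorProduct.tmul_mul_tmul, one_mul]

lemma actK_snd (n : ℕ) (m : Fin 4 → ℕ) (k : Fin 3 → ℕ) (g : ZMod n × ZMod n) :
    actK n m k g (Algebra.TensorProduct.includeRight (AdjoinRoot.root _)) =
      algebraMap ℂ (Kummer n m k) (zeta n ^ g.2.val) *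
        Algebra.TensorProduct.includeRight (AdjoinRoot.root _) := by
  rw [Algebra.TensorProduct.includeRight_apply, Algebra.TensorProduct.map_tmul, cycAct_root, map_one,
    IsScalarTower.algebraMap_apply ℂ R (Kummer n m k), IsScalarTower.algebraMap_apply ℂ R (Cyc _ _ _),
    ← Algebra.smul_def, ← Algebra.smul_def, TensorProduct.tmul_smul]

/-! ### Inertia groups and cotangent actions in an affine chart -/

section Stalk

lemma SpecMap_stalkEnd {X : Scheme.{0}} (σ : X ⟶ X) (x : X) (h : σ x = x) :
    Spec.map (CommRingCat.ofHom (stalkEnd σ x h)) ≫ X.fromSpecStalk x = X.fromSpecStalk x ≫ σ := by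
  rw [stalkEnd, CommRingCat.ofHom_hom, Spec.map_comp, Category.assoc,
    Scheme.SpecMap_stalkSpecializes_fromSpecStalk, Scheme.SpecMap_stalkMap_fromSpecStalk]

lemma apply_eq_of_mem_inertia {G : Type} {X : Scheme.{0}} {act : G → (X ⟶ X)} {x : X} {g : G}
    (hg : g ∈ inertia act x) : act g x = x := by
  let y : Spec (X.residueField x) := IsLocalRing.closedPoint (X.residueField x)
  have h : act g (X.fromSpecResidueField x y) = X.fromSpecResidueField x y := congr($hg y)
  rwa [Scheme.fromSpecResidueField_apply] at h

lemma stalkEnd_sub_mem_of_mem_inertia {G : Type} {X : Scheme.{0}} {act : G → (X ⟶ X)} {x : X} {g : G}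
    (hg : g ∈ inertia act x) (h : act g x = x) (y : X.presheaf.stalk x) :
    stalkEnd (act g) x h y - y ∈ IsLocalRing.maximalIdeal (X.presheaf.stalk x) := by
  have h1 : X.fromSpecResidueField x ≫ act g = X.fromSpecResidueField x := hg
  rw [Scheme.fromSpecResidueField, Category.assoc, ← SpecMap_stalkEnd _ x h, ← Category.assoc,
    cancel_mono, ← Spec.map_comp, Spec.map_inj] at h1
  rw [← Ideal.Quotient.eq_zero_iff_mem, map_sub, sub_eq_zero]
  exact congr(($h1).hom y)

variable {X : Scheme.{0}} {C : Type} [CommRing C] (κ : Spec (CommRingCat.of C) ⟶ X)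
  [IsOpenImmersion κ] (P : Spec (CommRingCat.of C))

/-- The localization map from the coordinate ring of an affine open subscheme to a local ring. -/
def toStalk : CommRingCat.of C ⟶ X.presheaf.stalk (κ P) :=
  ((Scheme.ΓSpecIso (CommRingCat.of C)).inv ≫
    (Spec (CommRingCat.of C)).presheaf.germ ⊤ P trivial) ≫ inv (κ.stalkMap P)

lemma SpecMap_toStalk : Spec.map (toStalk κ P) ≫ κ = X.fromSpecStalk (κ P) := by
  have h := Scheme.SpecMap_stalkMap_fromSpecStalk κ (x := P)
  rw [Spec.fromSpecStalk_eq] at h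
  rw [toStalk, Spec.map_comp, Category.assoc, ← h, ← Spec.map_comp_assoc, IsIso.hom_inv_id, Spec.map_id,
    Category.id_comp]

/-- The prime ideal of a point of an affine scheme. -/
def primeIdeal {C : Type} [CommRing C] (P : Spec (CommRingCat.of C)) : Ideal C :=
  PrimeSpectrum.asIdeal P

instance {C : Type} [CommRing C] (P : Spec (CommRingCat.of C)) : (primeIdeal P).IsPrime :=
  PrimeSpectrum.isPrime P

lemma isLocalization_toStalk :
    letI : Algebra C (X.presheaf.stalk (κ P)) := (toStalk κ P).hom.toAlgebra
    IsLocalization.AtPrime (X.presheaf.stalk (κ P)) (primeIdeal P) := by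
  let : Algebra C (X.presheaf.stalk (κ P)) := (toStalk κ P).hom.toAlgebra
  let e : (Spec (CommRingCat.of C)).presheaf.stalk P ≃+* X.presheaf.stalk (κ P) :=
    (asIso (inv (κ.stalkMap P))).commRingCatIsoToRingEquiv
  let : Algebra C ((Spec (CommRingCat.of C)).presheaf.stalk P) :=
    (StructureSheaf.toStalk C P).hom.toAlgebra
  have : IsLocalization.AtPrime ((Spec (CommRingCat.of C)).presheaf.stalk P)
      (primeIdeal P) := StructureSheaf.IsLocalization.to_stalk C P
  exact IsLocalization.isLocalization_of_algEquiv _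
    ({ e with commutes' := fun x ↦ rfl } :
      (Spec (CommRingCat.of C)).presheaf.stalk P ≃ₐ[C] X.presheaf.stalk (κ P))

lemma toStalk_mem_maximalIdeal_iff (c : C) :
    toStalk κ P c ∈ IsLocalRing.maximalIdeal (X.presheaf.stalk (κ P)) ↔ c ∈ (primeIdeal P) := by
  let : Algebra C (X.presheaf.stalk (κ P)) := (toStalk κ P).hom.toAlgebra
  have := isLocalization_toStalk κ P
  exact IsLocalization.AtPrime.to_map_mem_maximal_iff (X.presheaf.stalk (κ P)) (primeIdeal P) c

lemma stalkConst_eq [Algebra ℂ C] {s : X ⟶ pt}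
    (hs : κ ≫ s = Spec.map (CommRingCat.ofHom (algebraMap ℂ C))) (c : ℂ) :
    stalkConst s (κ P) c = toStalk κ P (algebraMap ℂ C c) := by
  have h : Spec.map (CommRingCat.ofHom (stalkConst s (κ P))) =
      Spec.map (CommRingCat.ofHom (algebraMap ℂ C) ≫ toStalk κ P) := by
    rw [Spec.map_comp, ← hs, ← Category.assoc, SpecMap_toStalk, stalkConst,
      CommRingCat.ofHom_hom, Spec.map_comp, Spec.map_comp, ← Scheme.fromSpecStalk_toSpecΓ,
      Category.assoc, Category.assoc, ← Scheme.toSpecΓ_naturality_assoc,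
      ← SpecMap_ΓSpecIso_hom, ← Spec.map_comp, Iso.inv_hom_id, Spec.map_id, Category.comp_id]
  exact congr(($(Spec.map_injective h)).hom c)

variable {κ P} in
-- As `κ` is a monomorphism, the condition compares two homomorphisms from `C` to the residue field,
-- whose kernel condition is membership in the prime ideal.
lemma mem_inertia_iff {G : Type} {act : G → (X ⟶ X)} {g : G} {a : C →+* C}
    (ha : κ ≫ act g = Spec.map (CommRingCat.ofHom a) ≫ κ) :
    g ∈ inertia act (κ P) ↔ ∀ c, a c - c ∈ (primeIdeal P) := by
  let r := toStalk κ P ≫ X.residue (κ P)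
  have h1 : X.fromSpecResidueField (κ P) = Spec.map r ≫ κ := by
    rw [Scheme.fromSpecResidueField, ← SpecMap_toStalk, Spec.map_comp, Category.assoc]
  change X.fromSpecResidueField (κ P) ≫ act g = X.fromSpecResidueField (κ P) ↔ _
  rw [h1, Category.assoc, ha, ← Category.assoc, cancel_mono, ← Spec.map_comp, Spec.map_inj]
  rw [CommRingCat.hom_ext_iff, RingHom.ext_iff]
  refine forall_congr' fun c ↦ ?_
  rw [← toStalk_mem_maximalIdeal_iff κ P, ← Ideal.Quotient.eq_zero_iff_mem, map_sub, map_sub,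
    sub_eq_zero]
  rfl

variable {κ P} in
lemma stalkEnd_toStalk {σ : X ⟶ X} {a : C →+* C}
    (ha : κ ≫ σ = Spec.map (CommRingCat.ofHom a) ≫ κ) (h : σ (κ P) = κ P) (c : C) :
    stalkEnd σ (κ P) h (toStalk κ P c) = toStalk κ P (a c) := by
  have h1 := SpecMap_stalkEnd σ (κ P) h
  rw [← SpecMap_toStalk, Category.assoc, ha, ← Category.assoc, ← Category.assoc, cancel_mono,
    ← Spec.map_comp, ← Spec.map_comp, Spec.map_inj] at h1
  exact congr(($h1).hom c)

variable {κ P} in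
-- The maximal ideal of the local ring is generated by `p`, on which `g` acts by the scalar `c`. For
-- a general element `r p` of it, inertia gives `g r ≡ r` modulo the maximal ideal, so `g` acts by
-- `c` on the whole cotangent space.
lemma isInertiaGenerator_iff [Algebra ℂ C] [IsDomain C] {s : X ⟶ pt}
    (hs : κ ≫ s = Spec.map (CommRingCat.ofHom (algebraMap ℂ C))) {G : Type} {act : G → (X ⟶ X)}
    {a : G → C →+* C} (ha : ∀ g, κ ≫ act g = Spec.map (CommRingCat.ofHom (a g)) ≫ κ) {p : C}
    (hp : p ≠ 0) (hP : (primeIdeal P) = Ideal.span {p}) {g : G} {c : ℂ}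
    (hc : a g p = algebraMap ℂ C c * p) :
    IsInertiaGenerator s act (κ P) g ↔
      g ∈ inertia act (κ P) ∧ c = zeta (Nat.card (inertia act (κ P))) := by
  let : Algebra C (X.presheaf.stalk (κ P)) := (toStalk κ P).hom.toAlgebra
  have hloc := isLocalization_toStalk κ P
  have hle : (primeIdeal P).primeCompl ≤ nonZeroDivisors C := (primeIdeal P).primeCompl_le_nonZeroDivisors
  have : IsDomain (X.presheaf.stalk (κ P)) := IsLocalization.isDomain_of_le_nonZeroDivisors _ hle
  have hm : IsLocalRing.maximalIdeal (X.presheaf.stalk (κ P)) = Ideal.span {toStalk κ P p} := by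
    rw [← IsLocalization.AtPrime.map_eq_maximalIdeal (primeIdeal P), hP, Ideal.map_span,
      Set.image_singleton]
    rfl
  have hp0 : toStalk κ P p ≠ 0 := by
    rw [← map_zero (toStalk κ P).hom]
    exact (IsLocalization.injective (X.presheaf.stalk (κ P)) hle).ne hp
  refine and_congr_right fun hg ↦ ?_
  set ζ := zeta (Nat.card (inertia act (κ P)))
  have hfix := apply_eq_of_mem_inertia hg
  have hE := stalkEnd_sub_mem_of_mem_inertia hg hfix
  constructor
  · rintro ⟨h, ht⟩
    have h1 := ht (toStalk κ P p) (hm ▸ Ideal.mem_span_singleton_self _)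
    rw [stalkEnd_toStalk (ha g), hc, stalkConst_eq κ P hs, ← map_mul, ← map_sub, ← sub_mul,
      ← map_sub, map_mul, hm, Ideal.span_singleton_pow, Ideal.mem_span_singleton, pow_two] at h1
    -- If `c ≠ ζ`, the difference is an invertible constant, so `p ^ 2` divides `p` and `p` would be
    -- a unit of the local ring.
    by_contra hne
    have hu : IsUnit (toStalk κ P (algebraMap ℂ C (c - ζ))) :=
      ((sub_ne_zero.mpr hne).isUnit.map (algebraMap ℂ C)).map _
    rw [IsUnit.dvd_mul_left hu] at h1
    have h2 : IsUnit (toStalk κ P p) := isUnit_of_dvd_one (by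
      obtain ⟨d, hd⟩ := h1
      refine ⟨d, mul_left_cancel₀ hp0 ?_⟩
      rw [mul_one, ← mul_assoc]
      exact hd)
    have h3 : toStalk κ P p ∈ IsLocalRing.maximalIdeal _ := hm ▸ Ideal.mem_span_singleton_self _
    exact (IsLocalRing.mem_maximalIdeal _).mp h3 h2
  · rintro rfl
    refine ⟨hfix, fun t ht ↦ ?_⟩
    rw [hm, Ideal.mem_span_singleton'] at ht
    obtain ⟨r, rfl⟩ := ht
    rw [map_mul, stalkEnd_toStalk (ha g), hc, stalkConst_eq κ P hs, map_mul]
    have h1 := Ideal.mul_mem_left _ (toStalk κ P (algebraMap ℂ C ζ))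
      (Ideal.mul_mem_mul (hE r) (hm ▸ Ideal.mem_span_singleton_self (toStalk κ P p)))
    rw [← pow_two] at h1
    convert! h1 using 1
    ring

end Stalk

section

variable {B C : Type} [CommRing B] [CommRing C] [Algebra B C] {n : ℕ} {f g : B} {p q : C}

/-- The fibre of a Kummer extension over the divisor `f = 0`. -/
lemma IsBikummer.exists_quotient (h : IsBikummer n f g p q) (hn : n ≠ 0) :
    ∃ φ : C →ₐ[B] Cyc (B ⧸ Ideal.span {f}) n (Ideal.Quotient.mk _ g), φ p = 0 ∧
      φ q = AdjoinRoot.root _ := by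
  refine h.lift 0 (AdjoinRoot.root _) ?_ (Cyc.root_pow ..)
  have h1 : algebraMap B (B ⧸ Ideal.span {f}) f = 0 :=
    Ideal.Quotient.eq_zero_iff_mem.mpr (Ideal.mem_span_singleton_self f)
  rw [zero_pow hn, IsScalarTower.algebraMap_apply B (B ⧸ Ideal.span {f}), h1, map_zero]

/-- The fibre over `f = 0` is a Kummer extension of `B / f`, into which `B / f` injects, and `p`
vanishes on it. -/
lemma IsBikummer.comap_span_fst (h : IsBikummer n f g p q) (hn : n ≠ 0) :
    (Ideal.span {p}).comap (algebraMap B C) = Ideal.span {f} := by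
  apply le_antisymm
  · intro b hb
    obtain ⟨φ, hφ, -⟩ := h.exists_quotient hn
    obtain ⟨c, hc⟩ := Ideal.mem_span_singleton.mp hb
    have h1 := φ.commutes b
    rw [hc, map_mul, hφ, zero_mul, IsScalarTower.algebraMap_apply B (B ⧸ Ideal.span {f})] at h1
    exact Ideal.Quotient.eq_zero_iff_mem.mp
      (Cyc.algebraMap_injective hn _ ((map_zero _).trans h1)).symm
  · rw [Ideal.span_singleton_le_iff_mem, Ideal.mem_comap, ← h.pow_fst]
    exact Ideal.pow_mem_of_mem _ (Ideal.mem_span_singleton_self p) _ (Nat.pos_of_ne_zero hn)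

lemma IsBikummer.snd_notMem_span_fst (h : IsBikummer n f g p q) (hn : n ≠ 0) (hfg : ¬ f ∣ g) :
    q ∉ Ideal.span {p} := by
  intro hq
  apply hfg
  rw [← Ideal.mem_span_singleton, ← h.comap_span_fst hn, Ideal.mem_comap, ← h.pow_snd]
  exact Ideal.pow_mem_of_mem _ hq _ (Nat.pos_of_ne_zero hn)

/-- Such a prime contains `p` because `p ^ n = f`, and in an integral extension there are no strict
inclusions between primes over the same prime. So only one point of the cover lies over the generic
point of the divisor. -/
lemma IsBikummer.eq_span_fst (h : IsBikummer n f g p q) (hn : n ≠ 0) (hp : Prime p) {P : Ideal C}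
    (hP : P.IsPrime) (hPf : P.comap (algebraMap B C) = Ideal.span {f}) : P = Ideal.span {p} := by
  have hpP : Ideal.span {p} ≤ P := by
    rw [Ideal.span_singleton_le_iff_mem]
    apply hP.mem_of_pow_mem n
    rw [h.pow_fst, ← Ideal.mem_comap, hPf]
    exact Ideal.mem_span_singleton_self f
  refine le_antisymm (fun x hx ↦ ?_) hpP
  by_contra hx'
  have := h.isIntegral hn
  have : (Ideal.span {p}).IsPrime := (Ideal.span_singleton_prime hp.ne_zero).mpr hp
  have hlt := Ideal.comap_lt_comap_of_integral_mem_sdiff (R := B) hpP ⟨hx, hx'⟩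
    (Algebra.IsIntegral.isIntegral x)
  rw [hPf, h.comap_span_fst hn] at hlt
  exact lt_irrefl _ hlt

end

lemma zeta_pow_val_eq_zeta_pow_val_iff {n : ℕ} [NeZero n] {a b : ZMod n} :
    zeta n ^ a.val = zeta n ^ b.val ↔ a = b :=
  ⟨fun h ↦ ZMod.val_injective n
    ((Complex.isPrimitiveRoot_exp n (NeZero.ne n)).pow_inj a.val_lt b.val_lt h), fun h ↦ h ▸ rfl⟩

lemma zeta_pow_val_eq_one_iff {n : ℕ} [NeZero n] {a : ZMod n} : zeta n ^ a.val = 1 ↔ a = 0 := by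
  rw [← zeta_pow_val_eq_zeta_pow_val_iff, ZMod.val_zero, pow_zero]

lemma zeta_pow_val_eq_zeta_iff {n : ℕ} [NeZero n] (hn : 2 ≤ n) {a : ZMod n} :
    zeta n ^ a.val = zeta n ↔ a = 1 := by
  have : Fact (1 < n) := ⟨hn⟩
  rw [← zeta_pow_val_eq_zeta_pow_val_iff, ZMod.val_one, pow_one]

section

variable {B C K : Type} [CommRing B] [CommRing C] [CommRing K] [Algebra B C]
  [Algebra ℂ C] [Algebra R K] {n : ℕ} {σ : ZMod n × ZMod n → K →ₐ[R] K} {i : B →+* R} {s t : B}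
  {p q : C} {ψ : C →+* K} {χ : ZMod n × ZMod n ≃+ ZMod n × ZMod n}
  {α : ZMod n × ZMod n → C →ₐ[B] C}

lemma IsLocalModel.symm (h : IsLocalModel n σ i s t p q ψ χ α) :
    IsLocalModel n σ i t s q p ψ (χ.trans AddEquiv.prodComm) α where
  isBikummer := h.isBikummer.symm
  comp_algebraMap := h.comp_algebraMap
  injective := h.injective
  mem_range := h.mem_range
  act_fst := h.act_snd
  act_snd := h.act_fst
  comp_act := h.comp_act

/-- Modulo `p` the algebra is generated by `q`, which is not zero there, so the action is trivial
exactly when the root of unity multiplying `q` is `1`. -/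
lemma IsLocalModel.sub_mem_span_iff [NeZero n] [Nontrivial C] (h : IsLocalModel n σ i s t p q ψ χ α)
    (hp : Prime p) (hst : ¬ s ∣ t) (g : ZMod n × ZMod n) :
    (∀ c, α g c - c ∈ Ideal.span {p}) ↔ (χ g).2 = 0 := by
  have hP : (Ideal.span {p}).IsPrime := (Ideal.span_singleton_prime hp.ne_zero).mpr hp
  constructor
  · intro hg
    have h1 := hg q
    rw [h.act_snd, ← sub_one_mul] at h1
    have h2 := (hP.mem_or_mem h1).resolve_right (h.isBikummer.snd_notMem_span_fst (NeZero.ne n) hst)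
    rw [← map_one (algebraMap ℂ C), ← map_sub] at h2
    rw [← zeta_pow_val_eq_one_iff]
    by_contra hne
    exact hP.ne_top (Ideal.eq_top_of_isUnit_mem _ h2 ((sub_ne_zero.mpr hne).isUnit.map _))
  · intro hg
    have : (Ideal.Quotient.mkₐ B (Ideal.span {p})).comp (α g) = Ideal.Quotient.mkₐ B _ := by
      apply algHom_ext_of_adjoin_pair h.isBikummer.adjoin_eq_top
      · rw [AlgHom.comp_apply, h.act_fst]
        refine Ideal.Quotient.eq.mpr ?_
        rw [← sub_one_mul]
        exact Ideal.mul_mem_left _ _ (Ideal.mem_span_singleton_self p)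
      · rw [AlgHom.comp_apply, h.act_snd, hg, ZMod.val_zero, pow_zero, map_one, one_mul]
    exact fun c ↦ Ideal.Quotient.eq.mp congr($this c)

/-- The local monodromy around the divisor `s = 0`. -/
lemma IsLocalModel.isInertiaGenerator_iff [NeZero n] (hn : 2 ≤ n) [IsDomain C]
    (h : IsLocalModel n σ i s t p q ψ χ α) (hp : Prime p) (hst : ¬ s ∣ t) {X : Scheme.{0}}
    (κ : Spec (CommRingCat.of C) ⟶ X) [IsOpenImmersion κ] {str : X ⟶ pt}
    (hstr : κ ≫ str = Spec.map (CommRingCat.ofHom (algebraMap ℂ C)))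
    {act : ZMod n × ZMod n → (X ⟶ X)}
    (hact : ∀ g, κ ≫ act g = Spec.map (CommRingCat.ofHom (α g).toRingHom) ≫ κ)
    {P : Spec (CommRingCat.of C)} (hP : primeIdeal P = Ideal.span {p}) (g : ZMod n × ZMod n) :
    IsInertiaGenerator str act (κ P) g ↔ g = χ.symm (1, 0) := by
  have h1 : inertia act (κ P) = {g | (χ g).2 = 0} := by
    ext g
    rw [mem_inertia_iff (hact g), hP]
    exact h.sub_mem_span_iff hp hst g
  have h2 : Nat.card (inertia act (κ P)) = n := by
    rw [h1]
    -- In the coordinates given by `χ` the inertia group is the first axis, a copy of `ℤ/n`.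
    refine (Nat.card_congr (Equiv.ofBijective
      (fun a : ZMod n ↦ (⟨χ.symm (a, 0), by simp⟩ : {g | (χ g).2 = 0}))
      ⟨fun a b hab ↦ ?_, ?_⟩)).symm.trans (Nat.card_zmod n)
    · simpa using hab
    · rintro ⟨g, hg⟩
      refine ⟨(χ g).1, Subtype.ext ?_⟩
      rw [AddEquiv.symm_apply_eq]
      exact Prod.ext rfl hg.symm
  rw [AbelianCover.isInertiaGenerator_iff hstr hact hp.ne_zero hP (h.act_fst g), h2,
    zeta_pow_val_eq_zeta_iff hn, h1, AddEquiv.eq_symm_apply, Prod.ext_iff, and_comm]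
  rfl

end

/-! ### The part of `S` over an affine open subscheme of `Z` -/

/-- The relative normalization does not change if the target is replaced by an integral scheme
over it, and the source by an isomorphic scheme. -/
lemma exists_normalization_iso_of_iso {X' X T Y : Scheme.{0}} (e : X' ≅ X) (f₁ : X ⟶ T) (f₂ : T ⟶ Y)
    [QuasiCompact f₁] [QuasiSeparated f₁] [IsIntegralHom f₂] (f : X' ⟶ Y) [QuasiCompact f]
    [QuasiSeparated f] (hf : f = e.hom ≫ f₁ ≫ f₂) :
    ∃ ε : f.normalization ≅ f₁.normalization,
      f.toNormalization ≫ ε.hom = e.hom ≫ f₁.toNormalization ∧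
      ε.hom ≫ f₁.fromNormalization ≫ f₂ = f.fromNormalization := by
  let u : f.normalization ⟶ T := f.normalizationDesc (e.hom ≫ f₁) f₂ (by rw [hf, Category.assoc])
  let a : f.normalization ⟶ f₁.normalization :=
    f.normalizationDesc (e.hom ≫ f₁.toNormalization) (f₁.fromNormalization ≫ f₂) (by simp [hf])
  have hu1 : f.toNormalization ≫ u = e.hom ≫ f₁ := Scheme.Hom.toNormalization_normalizationDesc ..
  let c : f₁.normalization ⟶ f.normalization :=
    f₁.normalizationDesc (e.inv ≫ f.toNormalization) u (by simp [hu1])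
  have ha1 : f.toNormalization ≫ a = e.hom ≫ f₁.toNormalization :=
    Scheme.Hom.toNormalization_normalizationDesc ..
  have ha2 : a ≫ f₁.fromNormalization ≫ f₂ = f.fromNormalization :=
    Scheme.Hom.normalizationDesc_comp ..
  have hc1 : f₁.toNormalization ≫ c = e.inv ≫ f.toNormalization :=
    Scheme.Hom.toNormalization_normalizationDesc ..
  have hc2 : c ≫ u = f₁.fromNormalization := Scheme.Hom.normalizationDesc_comp ..
  have hu2 : u ≫ f₂ = f.fromNormalization := Scheme.Hom.normalizationDesc_comp ..
  have hau : a ≫ f₁.fromNormalization = u := by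
    apply Scheme.Hom.normalization.hom_ext _ _ _ f₂ _ (by rw [Category.assoc, ha2]) hu2
    rw [reassoc_of% ha1, Scheme.Hom.toNormalization_fromNormalization, hu1]
  refine ⟨⟨a, c, ?_, ?_⟩, ha1, ha2⟩
  · apply Scheme.Hom.normalization.hom_ext _ _ _ f.fromNormalization
    · rw [reassoc_of% ha1, hc1, Iso.hom_inv_id_assoc, Category.comp_id]
    · rw [Category.assoc, ← hu2, reassoc_of% hc2, ha2, hu2]
    · simp
  · apply Scheme.Hom.normalization.hom_ext _ _ _ f₁.fromNormalization
    · rw [reassoc_of% hc1, ha1, Iso.inv_hom_id_assoc, Category.comp_id]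
    · rw [Category.assoc, hau, hc2]
    · simp

variable {n : ℕ} {m : Fin 4 → ℕ} {k : Fin 3 → ℕ} {Z : Scheme.{0}} {π : Z ⟶ P1xP1}

instance : IsIntegralHom (Sig.toP1xP1 n m k) :=
  inferInstanceAs (IsIntegralHom (V.toP1xP1 n m k).fromNormalization)

lemma toSig_toP1xP1 : V.toSig n m k ≫ Sig.toP1xP1 n m k = V.toP1xP1 n m k :=
  Scheme.Hom.toNormalization_fromNormalization _

/-- The inverse image in `Σ ×_{ℙ¹ × ℙ¹} Z` of the étale cover `V` is isomorphic to `V`. -/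
lemma exists_iso_VZ (hπ : IsBlowup π centre) {j : Spec (CommRingCat.of R) ⟶ Z} (hj : j ≫ π = chart) :
    ∃ e : V n m k ≅ pullback (V.toSig n m k) (pullback.fst (Sig.toP1xP1 n m k) π),
      e.hom ≫ VZ.toSigZ n m k π ≫ pullback.snd _ _ =
        Spec.map (CommRingCat.ofHom (algebraMap R (Kummer n m k))) ≫ j ∧
      ∀ g, e.hom ≫ pullback.map _ _ _ _ (actV n m k g) (actSigZ n m k π g) (actSig n m k g)
        (toSig_actSig n m k g) (pullback.lift_fst _ _ _).symm = actV n m k g ≫ e.hom := by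
  let a : V n m k ⟶ Spec (CommRingCat.of R) :=
    Spec.map (CommRingCat.ofHom (algebraMap R (Kummer n m k)))
  have hV : V.toP1xP1 n m k = a ≫ chart := rfl
  -- The complement of the curves contains no centre, so `π` is an isomorphism over it.
  obtain ⟨j', hj'⟩ := hπ.exists_isPullback chart comap_chart_centre
  obtain rfl : j' = j := by
    refine (hπ.universal chart (comap_chart_centre ▸ isInvertibleIdeal_top)).unique ?_ hj
    rw [← hj'.w, Category.id_comp]
  have h1 : IsPullback (𝟙 (V n m k)) a a (𝟙 _) := IsPullback.of_horiz_isIso ⟨by simp⟩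
  have h2 := h1.paste_vert hj'
  have h3 := IsPullback.of_hasPullback (Sig.toP1xP1 n m k) π
  let l : V n m k ⟶ SigZ n m k π := pullback.lift (V.toSig n m k) (a ≫ j')
    (by rw [toSig_toP1xP1, hV, Category.assoc, hj])
  have hl1 : l ≫ pullback.fst _ _ = V.toSig n m k := pullback.lift_fst _ _ _
  have hl2 : l ≫ pullback.snd _ _ = a ≫ j' := pullback.lift_snd _ _ _
  have h4 : IsPullback (𝟙 (V n m k)) l (V.toSig n m k) (pullback.fst (Sig.toP1xP1 n m k) π) := by
    refine IsPullback.of_bot ?_ (by rw [hl1, Category.id_comp]) h3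
    rw [hl2, toSig_toP1xP1]
    exact h2
  have he1 : h4.isoPullback.hom ≫ pullback.fst _ _ = 𝟙 _ := h4.isoPullback_hom_fst
  have he2 : h4.isoPullback.hom ≫ pullback.snd _ _ = l := h4.isoPullback_hom_snd
  refine ⟨h4.isoPullback, ?_, fun g ↦ ?_⟩
  · rw [← Category.assoc]
    exact (congrArg (· ≫ pullback.snd _ _) he2).trans hl2
  · have hact : actV n m k g ≫ a = a := by
      have := actV_comp n m k g
      rwa [hV, ← Category.assoc, cancel_mono] at this
    apply pullback.hom_ext
    · rw [Category.assoc, Category.assoc, pullback.lift_fst, reassoc_of% he1, he1, Category.comp_id]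
    · rw [Category.assoc, Category.assoc, pullback.lift_snd, reassoc_of% he2, he2]
      apply pullback.hom_ext
      · rw [Category.assoc, Category.assoc, actSigZ, pullback.lift_fst, reassoc_of% hl1, hl1,
          toSig_actSig]
      · rw [Category.assoc, Category.assoc, actSigZ, pullback.lift_snd, hl2, Category.comp_id,
          hl2, reassoc_of% hact]

/-- The inclusion in `S` of the inverse image of `V ⊆ Σ`. -/
def VZ.toS : pullback (V.toSig n m k) (pullback.fst (Sig.toP1xP1 n m k) π) ⟶ S n m k π :=
  (VZ.toSigZ n m k π).toNormalization

/-- The morphism from `S` to `Σ ×_{ℙ¹ × ℙ¹} Z`. -/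
def S.toSigZ : S n m k π ⟶ SigZ n m k π := (VZ.toSigZ n m k π).fromNormalization

lemma toSigZ_snd : S.toSigZ ≫ pullback.snd _ _ = S.toZ n m k π := rfl

lemma toS_actS (g : ZMod n × ZMod n) :
    VZ.toS ≫ actS n m k π g = pullback.map _ _ _ _ (actV n m k g) (actSigZ n m k π g)
      (actSig n m k g) (toSig_actSig n m k g) (pullback.lift_fst _ _ _).symm ≫ VZ.toS :=
  toNormalization_normalizationMap ..

lemma actS_toSigZ (g : ZMod n × ZMod n) :
    actS n m k π g ≫ S.toSigZ = S.toSigZ ≫ actSigZ n m k π g :=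
  normalizationMap_fromNormalization ..

lemma actS_comp (g : ZMod n × ZMod n) : actS n m k π g ≫ S.toZ n m k π = S.toZ n m k π := by
  rw [← toSigZ_snd, ← Category.assoc, actS_toSigZ, Category.assoc, actSigZ, pullback.lift_snd,
    Category.comp_id]

lemma exists_normalization_iso_S {X : Scheme.{0}}
    (e : X ≅ pullback (V.toSig n m k) (pullback.fst (Sig.toP1xP1 n m k) π)) (f : X ⟶ Z)
    [QuasiCompact f] [QuasiSeparated f]
    (hf : f = e.hom ≫ VZ.toSigZ n m k π ≫ pullback.snd _ _) :
    ∃ ε : f.normalization ≅ S n m k π, f.toNormalization ≫ ε.hom = e.hom ≫ VZ.toS ∧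
      ε.hom ≫ S.toZ n m k π = f.fromNormalization :=
  exists_normalization_iso_of_iso e (VZ.toSigZ n m k π) (pullback.snd (Sig.toP1xP1 n m k) π) f hf

/-- The part of `S` over an affine open subscheme `Spec B` of `Z`, and the action of `(ℤ/n)²` on
it, if the integral closure `C` of `B` in the coordinate ring of the étale cover is known. -/
lemma exists_isPullback_S (hπ : IsBlowup π centre) {B C : Type} [CommRing B] [CommRing C]
    (φ : B →+* C) (ψ : C →+* Kummer n m k) (i : B →+* R)
    (hi : ψ.comp φ = (algebraMap R (Kummer n m k)).comp i) (hφ : φ.IsIntegral)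
    (hψ : Function.Injective ψ) (hcl : ∀ y, (ψ.comp φ).IsIntegralElem y → ∃ c, ψ c = y)
    (b : Spec (CommRingCat.of B) ⟶ Z) [IsOpenImmersion b]
    (hb : Spec.map (CommRingCat.ofHom i) ≫ b ≫ π = chart) :
    ∃ κ : Spec (CommRingCat.of C) ⟶ S n m k π,
      IsPullback κ (Spec.map (CommRingCat.ofHom φ)) (S.toZ n m k π) b ∧
      ∀ (g : ZMod n × ZMod n) (α : C →+* C), α.comp φ = φ →
        (∀ c, ψ (α c) = actK n m k g (ψ c)) →
        κ ≫ actS n m k π g = Spec.map (CommRingCat.ofHom α) ≫ κ := by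
  obtain ⟨e, he, hact⟩ := exists_iso_VZ (n := n) (m := m) (k := k) hπ
    (j := Spec.map (CommRingCat.ofHom i) ≫ b) (by rw [Category.assoc, hb])
  let f : V n m k ⟶ Z := Spec.map (CommRingCat.ofHom φ ≫ CommRingCat.ofHom ψ) ≫ b
  have hf : f = e.hom ≫ VZ.toSigZ n m k π ≫ pullback.snd _ _ := by
    rw [he, ← Spec.map_comp_assoc, ← CommRingCat.ofHom_comp, ← hi]
    rfl
  have : QuasiCompact f := by
    rw [hf]
    infer_instance
  have : QuasiSeparated f := by
    rw [hf]
    infer_instance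
  obtain ⟨κ₀, h1, h2⟩ := exists_isPullback_normalization (CommRingCat.ofHom φ) (CommRingCat.ofHom ψ)
    hφ hψ hcl f b rfl
  obtain ⟨ε, h3, h4⟩ := exists_normalization_iso_S e f hf
  let κ : Spec (CommRingCat.of C) ⟶ S n m k π := κ₀ ≫ ε.hom
  have hκ : IsPullback κ (Spec.map (CommRingCat.ofHom φ)) (S.toZ n m k π) b :=
    h1.of_iso (Iso.refl _) ε (Iso.refl _) (Iso.refl _) (by simp [κ]) (by simp) (by simp [h4])
      (by simp)
  have hκψ : Spec.map (CommRingCat.ofHom ψ) ≫ κ = e.hom ≫ VZ.toS := by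
    rw [← Category.assoc, h2, h3]
  refine ⟨κ, hκ, fun g α hα hαψ ↦ ?_⟩
  have : IsOpenImmersion κ := MorphismProperty.of_isPullback hκ.flip inferInstance
  have hαψ' : CommRingCat.ofHom α ≫ CommRingCat.ofHom ψ = CommRingCat.ofHom ψ ≫
      CommRingCat.ofHom (actK n m k g).toRingHom := by
    ext c
    exact hαψ c
  -- The action commutes with the covering, so it restricts to `Spec C`. There it must be `α`,
  -- because both are determined by the étale cover.
  let k' : Spec (CommRingCat.of C) ⟶ Spec (CommRingCat.of C) :=
    hκ.lift (κ ≫ actS n m k π g) (Spec.map (CommRingCat.ofHom φ))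
      (by rw [Category.assoc, actS_comp, hκ.w])
  have hk' : k' ≫ κ = κ ≫ actS n m k π g := hκ.lift_fst ..
  suffices k' = Spec.map (CommRingCat.ofHom α) by rw [← this, hk']
  refine specMap_epi_of_injective (CommRingCat.ofHom ψ) hψ _ _ ?_
  rw [← cancel_mono κ, Category.assoc, hk', ← Category.assoc, hκψ, ← Spec.map_comp, hαψ',
    Spec.map_comp, Category.assoc, Category.assoc, hκψ]
  rw [toS_actS, ← Category.assoc, hact g, Category.assoc]
  rfl

lemma chart_toPt : chart ≫ P1xP1.toPt = Spec.map (CommRingCat.ofHom (algebraMap ℂ R)) := by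
  rw [P1xP1.toPt, chart, pullback.lift_fst_assoc, affPoint_toPt]

variable {Z : Scheme.{0}} {π : Z ⟶ P1xP1}

section

variable {B : Type} [CommRing B] [Algebra ℂ B] {b : Spec (CommRingCat.of B) ⟶ Z} {i : B →ₐ[ℂ] R}

lemma toPt_of_chart (hi : Function.Injective i)
    (hb : Spec.map (CommRingCat.ofHom i.toRingHom) ≫ b ≫ π = chart) :
    b ≫ π ≫ P1xP1.toPt = Spec.map (CommRingCat.ofHom (algebraMap ℂ B)) := by
  refine specMap_epi_of_injective (CommRingCat.ofHom i.toRingHom) hi _ _ ?_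
  have h := congr($hb ≫ P1xP1.toPt)
  rw [Category.assoc, Category.assoc] at h
  rw [h, chart_toPt, ← Spec.map_comp, ← CommRingCat.ofHom_comp]
  exact congrArg (fun f ↦ Spec.map (CommRingCat.ofHom f)) i.comp_algebraMap.symm

/-- The complement of the curves is the image of `Spec R`, and `π` is an isomorphism over it; in the
chart it is the open set where `r` does not vanish. -/
lemma mem_branchCurves_iff (hπ : IsBlowup π centre) [IsOpenImmersion b]
    (hb : Spec.map (CommRingCat.ofHom i.toRingHom) ≫ b ≫ π = chart) {r : B}
    (hr : letI := i.toRingHom.toAlgebra; IsLocalization.Away r R) (y : Spec (CommRingCat.of B)) :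
    π (b y) ∈ branchCurves ↔ r ∈ primeIdeal y := by
  let := i.toRingHom.toAlgebra
  obtain ⟨j, hj⟩ := hπ.exists_isPullback chart comap_chart_centre
  obtain rfl : Spec.map (CommRingCat.ofHom i.toRingHom) ≫ b = j := by
    refine (hπ.universal chart (comap_chart_centre ▸ isInvertibleIdeal_top)).unique ?_ ?_
    · rw [Category.assoc, hb]
    · rw [← hj.w, Category.id_comp]
  have h1 : Set.range (Spec.map (CommRingCat.ofHom i.toRingHom)) =
      {y | r ∉ primeIdeal y} := PrimeSpectrum.localization_away_comap_range R r
  have h2 : y ∈ Set.range (Spec.map (CommRingCat.ofHom i.toRingHom)) ↔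
      π (b y) ∈ Set.range chart := by
    constructor
    · rintro ⟨x, rfl⟩
      exact ⟨x, congr($hb x).symm⟩
    · rintro ⟨x, hx⟩
      obtain ⟨w, -, hw⟩ := Scheme.exists_preimage_of_isPullback hj x (b y) hx
      exact ⟨w, b.isOpenEmbedding.injective hw⟩
  rw [range_chart, h1, Set.mem_compl_iff] at h2
  exact not_iff_not.mp h2.symm

end

/-! ### Local charts of the covering `S ⟶ Z` -/

variable (n : ℕ) (m : Fin 4 → ℕ) (k : Fin 3 → ℕ) (π)

/-- An affine open subscheme `Spec B` of `Z` on which the branch curves are defined by prime elements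
`s`, `t`, and its inverse image `Spec C` in `S`. -/
structure LocalChart where
  (B C : Type)
  [commRingB : CommRing B]
  [isDomainB : IsDomain B]
  [commRingC : CommRing C]
  [isDomainC : IsDomain C]
  [algebraC : Algebra ℂ C]
  [algebra : Algebra B C]
  (b : Spec (CommRingCat.of B) ⟶ Z)
  [isOpenImmersionB : IsOpenImmersion b]
  (κ : Spec (CommRingCat.of C) ⟶ S n m k π)
  (isPullback : IsPullback κ (Spec.map (CommRingCat.ofHom (algebraMap B C))) (S.toZ n m k π) b)
  (i : B →+* R)
  (s t : B)
  (p q : C)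
  (ψ : C →+* Kummer n m k)
  (χ : ZMod n × ZMod n ≃+ ZMod n × ZMod n)
  (α : ZMod n × ZMod n → C →ₐ[B] C)
  (isLocalModel : IsLocalModel n (actK n m k) i s t p q ψ χ α)
  (comp_actS : ∀ g, κ ≫ actS n m k π g = Spec.map (CommRingCat.ofHom (α g).toRingHom) ≫ κ)
  (prime_s : Prime s)
  (prime_t : Prime t)
  (not_dvd : ¬ s ∣ t)
  (not_dvd' : ¬ t ∣ s)
  (prime_p : Prime p)
  (prime_q : Prime q)
  (smooth : SmoothOfRelativeDimension 2 (Spec.map (CommRingCat.ofHom (algebraMap ℂ C))))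
  (comp_toPt : κ ≫ S.toPt n m k π = Spec.map (CommRingCat.ofHom (algebraMap ℂ C)))
  (mem_branchCurves_iff : ∀ y : Spec (CommRingCat.of B),
    π (b y) ∈ branchCurves ↔ s ∈ primeIdeal y ∨ t ∈ primeIdeal y)
  (isDomain_kummer : IsDomain (Kummer n m k))

attribute [instance] LocalChart.commRingB LocalChart.isDomainB LocalChart.commRingC
  LocalChart.isDomainC LocalChart.algebraC LocalChart.algebra LocalChart.isOpenImmersionB

variable {n m k π}

instance (c : LocalChart π n m k) : IsOpenImmersion c.κ :=
  MorphismProperty.of_isPullback c.isPullback.flip inferInstance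

/-- Interchange the two coordinates. -/
def LocalChart.symm (c : LocalChart π n m k) : LocalChart π n m k where
  B := c.B
  C := c.C
  b := c.b
  κ := c.κ
  isPullback := c.isPullback
  i := c.i
  s := c.t
  t := c.s
  p := c.q
  q := c.p
  ψ := c.ψ
  χ := c.χ.trans AddEquiv.prodComm
  α := c.α
  isLocalModel := c.isLocalModel.symm
  comp_actS := c.comp_actS
  prime_s := c.prime_t
  prime_t := c.prime_s
  not_dvd := c.not_dvd'
  not_dvd' := c.not_dvd
  prime_p := c.prime_q
  prime_q := c.prime_p
  smooth := c.smooth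
  comp_toPt := c.comp_toPt
  mem_branchCurves_iff y := (c.mem_branchCurves_iff y).trans or_comm
  isDomain_kummer := c.isDomain_kummer

section

variable {h : PolyXY} {B C : Type} [CommRing B] [Algebra ℂ B] [Algebra PolyXY B]
  [IsScalarTower ℂ PolyXY B] [IsLocalization.Away h B] [CommRing C] [IsDomain C] [Algebra B C]
  [Algebra ℂ C] [IsScalarTower ℂ B C] {p q : C}

lemma IsBikummer.smoothOfRelativeDimension (hn : n ≠ 0) (hh : MvPolynomial.constantCoeff h ≠ 0) {u v : Bˣ}
    (hC : IsBikummer n (u * sX B) (v * sY B) p q) :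
    SmoothOfRelativeDimension 2 (Spec.map (CommRingCat.ofHom (algebraMap ℂ C))) := by
  let : Algebra PolyXY C := ((algebraMap B C).comp (algebraMap PolyXY B)).toAlgebra
  have : IsScalarTower PolyXY B C := .of_algebraMap_eq fun _ ↦ rfl
  have : IsScalarTower ℂ PolyXY C := .of_algebraMap_eq fun x ↦ by
    rw [IsScalarTower.algebraMap_apply ℂ B C, IsScalarTower.algebraMap_apply ℂ PolyXY B]
    rfl
  have hBC := hC.algebraMap_injective hn
  have : FaithfulSMul PolyXY C := by
    rw [faithfulSMul_iff_algebraMap_injective]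
    exact hBC.comp (IsLocalization.injective B (powers_le_nonZeroDivisors hh))
  have := hC.isIntegral hn
  have := isDomain_localization_of_constantCoeff hh B
  have : Algebra.IsAlgebraic PolyXY B := IsLocalization.isAlgebraic _ (Submonoid.powers h)
  have : FaithfulSMul B C := (faithfulSMul_iff_algebraMap_injective B C).mpr hBC
  have : Algebra.IsAlgebraic B C := inferInstance
  have : Algebra.IsAlgebraic PolyXY C := Algebra.IsAlgebraic.trans PolyXY B C
  have := hC.formallySmooth (isCoord_localization h B) hn
  have := hC.finitePresentation
  have : Algebra.FinitePresentation PolyXY B := IsLocalization.Away.finitePresentation h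
  have : Algebra.FinitePresentation ℂ B := Algebra.FinitePresentation.trans ℂ PolyXY B
  have : Algebra.FinitePresentation ℂ C := Algebra.FinitePresentation.trans ℂ B C
  exact smoothOfRelativeDimension_two C

end

/-- The corner at `z` yields the roots `p'`, `q'` in the étale cover, these yield the integral
closure `C` of `B`, and `C` describes `S` over `Spec B`. -/
lemma exists_localChart (hn : n ≠ 0) (hG : GoodExponents n m k) (hπ : IsBlowup π centre) (z : Z) :
    ∃ c : LocalChart π n m k, z ∈ Set.range c.b := by
  obtain ⟨h, i, b, hh, hbo, hz, hb, hi, hm⟩ := hasCorner hG hπ z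
  have hK := isBikummer_tensor R n (formZ n m 1 xc 1 yc) (formW k 1 xc)
  obtain ⟨u, v, p', q', χ, hp, hq, hadj, hσ⟩ := exists_roots_act hn hK (actK n m k)
    (actK_fst n m k) (actK_snd n m k) i hi hm
  obtain ⟨C, hC1, hC2, hC3, hC4, p, q, hC⟩ := exists_isBikummer (Localization.Away h) n
    (u * sX (Localization.Away h)) (v * sY _)
  obtain ⟨hKdom, ψ, α, hM⟩ := exists_isLocalModel hh hn (actK n m k) i (hK.algebraMap_injective hn) hi
    χ hp hq hadj hσ hC
  have := isDomain_localization_of_constantCoeff hh (Localization.Away h)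
  have : IsNoetherianRing (Localization.Away h) :=
    IsLocalization.isNoetherianRing (Submonoid.powers h) _ inferInstance
  have hs := prime_unit_mul_X hh u 0
  have ht := prime_unit_mul_X hh v 1
  have hdvd := not_unit_mul_dvd hh u v
  have hst := isPrime_span_unit_mul_pair hh u v
  have := hC.isDomain hn hs ht hdvd hst
  have hint := hC.isIntegral hn
  obtain ⟨κ, hκ, hact⟩ := exists_isPullback_S hπ (algebraMap (Localization.Away h) C) ψ i.toRingHom
    hM.comp_algebraMap (algebraMap_isIntegral_iff.mpr hint) hM.injective
    (hM.comp_algebraMap ▸ hM.mem_range) b hb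
  have hloc := isLocalization_away_of_isCoord i hi
  have hinj : Function.Injective i := by
    let := i.toRingHom.toAlgebra
    exact IsLocalization.injective R (powers_le_nonZeroDivisors_of_noZeroDivisors
      (mul_ne_zero (prime_algebraMap_X hh _ 0).ne_zero (prime_algebraMap_X hh _ 1).ne_zero))
  let c : LocalChart π n m k :=
    { B := Localization.Away h
      C := C
      b := b
      κ := κ
      isPullback := hκ
      i := i.toRingHom
      s := u * sX _
      t := v * sY _
      p := p
      q := q
      ψ := ψ
      χ := χ
      α := α
      isLocalModel := hM
      comp_actS := fun g ↦ hact g (α g) (α g).comp_algebraMap (hM.comp_act g)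
      prime_s := hs
      prime_t := ht
      not_dvd := fun hd ↦ hdvd (hs.irreducible.dvd_comm ht.irreducible |>.mp hd)
      not_dvd' := hdvd
      prime_p := hC.prime_fst hn hs ht hdvd hst
      prime_q := hC.prime_snd hn hs ht hdvd hst
      smooth := hC.smoothOfRelativeDimension hn hh
      comp_toPt := by
        rw [S.toPt, ← Category.assoc, hκ.w, Category.assoc, toPt_of_chart hinj hb, ← Spec.map_comp,
          ← CommRingCat.ofHom_comp, ← IsScalarTower.algebraMap_eq]
      mem_branchCurves_iff := fun y ↦ by
        have hy : (primeIdeal y).IsPrime := inferInstance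
        rw [mem_branchCurves_iff hπ hb hloc, hy.mul_mem_iff_mem_or_mem,
          Ideal.unit_mul_mem_iff_mem _ u.isUnit, Ideal.unit_mul_mem_iff_mem _ v.isUnit]
      isDomain_kummer := hKdom }
  exact ⟨c, hz⟩

/-! ### Irreducibility, smoothness, branch locus and local monodromy of `S` -/

variable {n : ℕ} {m : Fin 4 → ℕ} {k : Fin 3 → ℕ} {Z : Scheme.{0}} {π : Z ⟶ P1xP1}

lemma exists_chart_lift (hπ : IsBlowup π centre) :
    ∃ j : Spec (CommRingCat.of R) ⟶ Z, IsOpenImmersion j ∧ j ≫ π = chart ∧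
      ∀ z, z ∈ Set.range j ↔ π z ∉ branchCurves := by
  obtain ⟨j, hj⟩ := hπ.exists_isPullback chart comap_chart_centre
  refine ⟨j, MorphismProperty.of_isPullback hj inferInstance, ?_, fun z ↦ ?_⟩
  · rw [← hj.w, Category.id_comp]
  · rw [← Set.mem_compl_iff, ← range_chart]
    constructor
    · rintro ⟨x, rfl⟩
      exact ⟨x, congr($hj.w x)⟩
    · rintro ⟨x, hx⟩
      obtain ⟨w, -, hw⟩ := Scheme.exists_preimage_of_isPullback hj x z hx
      exact ⟨w, hw⟩

/-- The normalization in an integral scheme is integral, so it suffices that the ring of the étale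
cover is a domain. A single local chart shows this. -/
lemma isIntegral_S (hn : n ≠ 0) (hG : GoodExponents n m k) (hπ : IsBlowup π centre) :
    IsIntegral (S n m k π) := by
  obtain ⟨j, -, hj, -⟩ := exists_chart_lift hπ
  have hR : Nontrivial R := by
    have hd : disc ≠ 0 := fun h ↦ by
      -- Any two distinct values different from `0` and `1` would do; the complement of the curves
      -- is therefore not empty.
      have := congrArg (MvPolynomial.eval ![2, 3]) h
      simp [disc] at this
      norm_num at this
    exact (IsLocalization.injective R
      (powers_le_nonZeroDivisors_of_noZeroDivisors hd)).nontrivial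
  obtain ⟨c, -⟩ := exists_localChart hn hG hπ (j (Classical.arbitrary (PrimeSpectrum R)))
  have := c.isDomain_kummer
  obtain ⟨e, -⟩ := exists_iso_VZ (n := n) (m := m) (k := k) hπ hj
  have : IsIntegral (pullback (V.toSig n m k) (pullback.fst (Sig.toP1xP1 n m k) π)) := by
    have : Nonempty ((pullback (V.toSig n m k) (pullback.fst (Sig.toP1xP1 n m k) π) : Scheme.{0})) :=
      ⟨e.hom (Classical.arbitrary (V n m k))⟩
    exact isIntegral_of_isOpenImmersion e.inv
  exact inferInstanceAs (IsIntegral (VZ.toSigZ n m k π).normalization)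

lemma LocalChart.exists_of_toZ (c : LocalChart π n m k) {ξ : S n m k π} {y : Spec (CommRingCat.of c.B)}
    (h : S.toZ n m k π ξ = c.b y) : ∃ P : Spec (CommRingCat.of c.C), c.κ P = ξ ∧
      Spec.map (CommRingCat.ofHom (algebraMap c.B c.C)) P = y :=
  Scheme.exists_preimage_of_isPullback c.isPullback ξ y h

lemma smooth_S (hn : n ≠ 0) (hG : GoodExponents n m k) (hπ : IsBlowup π centre) :
    SmoothOfRelativeDimension 2 (S.toPt n m k π) := by
  choose c hc using exists_localChart hn hG hπ
  have hcov : ⨆ z, (c z).κ.opensRange = ⊤ := by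
    refine TopologicalSpace.Opens.ext (Set.eq_univ_of_forall fun ξ ↦ ?_)
    obtain ⟨y, hy⟩ := hc (S.toZ n m k π ξ)
    obtain ⟨P, hP, -⟩ := (c _).exists_of_toZ hy.symm
    exact TopologicalSpace.Opens.mem_iSup.mpr ⟨_, P, hP⟩
  have : IsZariskiLocalAtSource (@SmoothOfRelativeDimension.{0} 2) :=
    HasRingHomProperty.instIsZariskiLocalAtSource
      (Q := RingHom.Locally (RingHom.IsStandardSmoothOfRelativeDimension 2))
  rw [IsZariskiLocalAtSource.iff_of_iSup_eq_top (P := @SmoothOfRelativeDimension.{0} 2) _ hcov]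
  intro z
  have hz : (c z).κ.isoOpensRange.inv ≫ (c z).κ = (c z).κ.opensRange.ι := by
    rw [Iso.inv_comp_eq, Scheme.Hom.isoOpensRange_hom_ι]
  rw [← hz, Category.assoc, (c z).comp_toPt]
  exact IsZariskiLocalAtSource.comp (c z).smooth _

lemma isUnit_formZ : IsUnit (formZ n m 1 xc 1 yc) := by
  have h := isCoord_xc_yc.isUnit
  simp only [disc, map_mul, map_sub, map_one, MvPolynomial.aeval_X, Matrix.cons_val_zero,
    Matrix.cons_val_one, IsUnit.mul_iff] at h
  obtain ⟨⟨⟨⟨-, -⟩, hy⟩, hy1⟩, hxy⟩ := h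
  simp only [formZ, one_pow, one_mul, mul_one, IsUnit.mul_iff]
  exact ⟨⟨hy.pow _, hy1.pow _⟩, hxy.pow _⟩

lemma isUnit_formW : IsUnit (formW k 1 xc) := by
  have h := isCoord_xc_yc.isUnit
  simp only [disc, map_mul, map_sub, map_one, MvPolynomial.aeval_X, Matrix.cons_val_zero,
    Matrix.cons_val_one, IsUnit.mul_iff] at h
  obtain ⟨⟨⟨⟨hx, hx1⟩, -⟩, -⟩, -⟩ := h
  simp only [formW, one_pow, one_mul, IsUnit.mul_iff]
  exact ⟨hx.pow _, hx1.pow _⟩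

/-- The complement of the branch curves does not meet the branch locus. -/
lemma notMem_branchLocus (hn : n ≠ 0) (hπ : IsBlowup π centre) {z : Z}
    (hz : π z ∉ branchCurves) : z ∉ branchLocus (S.toZ n m k π) := by
  obtain ⟨j, hj, hjπ, hr⟩ := exists_chart_lift hπ
  have hK := isBikummer_tensor R n (formZ n m 1 xc 1 yc) (formW k 1 xc)
  have := hK.isIntegral hn
  obtain ⟨κ, hκ, -⟩ := exists_isPullback_S (n := n) (m := m) (k := k) hπ
    (algebraMap R (Kummer n m k)) (RingHom.id _) (RingHom.id R) rfl
    (algebraMap_isIntegral_iff.mpr this) Function.injective_id (fun y _ ↦ ⟨y, rfl⟩) j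
    (by rw [CommRingCat.ofHom_id, Spec.map_id, Category.id_comp, hjπ])
  have het : Etale (Spec.map (CommRingCat.ofHom (algebraMap R (Kummer n m k)))) := by
    rw [HasRingHomProperty.Spec_iff (P := @Etale)]
    have hRn : IsUnit (n : R) := by
      have := (Nat.cast_ne_zero.mpr hn : (n : ℂ) ≠ 0).isUnit.map (algebraMap ℂ R)
      simpa using this
    have : Algebra.Etale R (Kummer n m k) :=
      hK.etale hRn hn isUnit_formZ isUnit_formW
    exact RingHom.etale_algebraMap.mpr this
  refine not_not.mpr ⟨j.opensRange, (hr z).mpr hz, ?_⟩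
  have h1 := (isPullback_morphismRestrict (S.toZ n m k π) j.opensRange).flip
  have h2 : j.isoOpensRange.hom ≫ j.opensRange.ι = j := Scheme.Hom.isoOpensRange_hom_ι j
  rw [← h2] at hκ
  let k' := h1.lift κ (Spec.map (CommRingCat.ofHom (algebraMap R (Kummer n m k))) ≫
    j.isoOpensRange.hom) (by rw [hκ.w, Category.assoc])
  have hk' : k' ≫ (S.toZ n m k π ⁻¹ᵁ j.opensRange).ι = κ := h1.lift_fst ..
  have hk'' : k' ≫ (S.toZ n m k π ∣_ j.opensRange) = _ := h1.lift_snd ..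
  rw [← hk'] at hκ
  have : IsIso k' := (hκ.of_right hk'' h1).isIso_fst_of_isIso
  rw [show S.toZ n m k π ∣_ j.opensRange = inv k' ≫ _ from (IsIso.eq_inv_comp k').mpr hk'']
  infer_instance

/-- If the covering were étale near the image of `y`, it would be unramified on a basic open
neighbourhood of a point above `y`. But `p` vanishes at that point, and the Kummer extension is
ramified there. -/
lemma LocalChart.mem_branchLocus (hn : 2 ≤ n) (c : LocalChart π n m k) (y : Spec (CommRingCat.of c.B))
    (hy : c.s ∈ primeIdeal y) : c.b y ∈ branchLocus (S.toZ n m k π) := by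
  rintro ⟨U, hU, het⟩
  have hC := c.isLocalModel.isBikummer
  have := hC.isIntegral (by lia)
  have hinj := hC.algebraMap_injective (by lia)
  have : FaithfulSMul c.B c.C := (faithfulSMul_iff_algebraMap_injective _ _).mpr hinj
  obtain ⟨P, hP⟩ : ∃ P, Spec.map (CommRingCat.ofHom (algebraMap c.B c.C)) P = y :=
    Algebra.IsIntegral.comap_surjective c.B c.C y
  have hp : c.p ∈ primeIdeal P := by
    refine Ideal.IsPrime.mem_of_pow_mem inferInstance n ?_
    rw [hC.pow_fst]
    rw [← hP] at hy
    exact hy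
  have hPU : P ∈ (c.κ ≫ S.toZ n m k π) ⁻¹ᵁ U := by
    rw [c.isPullback.w]
    change c.b (Spec.map _ P) ∈ U
    rwa [hP]
  obtain ⟨_, ⟨a, rfl⟩, ha, haU⟩ := PrimeSpectrum.isTopologicalBasis_basic_opens.exists_subset_of_mem_open
    hPU (TopologicalSpace.Opens.isOpen _)
  let g : Spec (CommRingCat.of (Localization.Away a)) ⟶ Spec (CommRingCat.of c.C) :=
    Spec.map (CommRingCat.ofHom (algebraMap c.C (Localization.Away a)))
  have hg : Set.range (g ≫ c.κ) ⊆ Set.range (S.toZ n m k π ⁻¹ᵁ U).ι := by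
    rintro _ ⟨Q, rfl⟩
    have hQ : g Q ∈ (PrimeSpectrum.basicOpen a : Set (PrimeSpectrum c.C)) := by
      rw [← PrimeSpectrum.localization_away_comap_range (Localization.Away a) a]
      exact ⟨Q, rfl⟩
    rw [Scheme.Opens.range_ι]
    exact haU hQ
  let l := IsOpenImmersion.lift (S.toZ n m k π ⁻¹ᵁ U).ι (g ≫ c.κ) hg
  have hl : l ≫ (S.toZ n m k π ⁻¹ᵁ U).ι = g ≫ c.κ := IsOpenImmersion.lift_fac ..
  have : IsOpenImmersion (l ≫ (S.toZ n m k π ⁻¹ᵁ U).ι) := by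
    rw [hl]
    infer_instance
  have : IsOpenImmersion l := IsOpenImmersion.of_comp l (S.toZ n m k π ⁻¹ᵁ U).ι
  have h1 : l ≫ (S.toZ n m k π ∣_ U) ≫ U.ι =
      (g ≫ Spec.map (CommRingCat.ofHom (algebraMap c.B c.C))) ≫ c.b := by
    rw [morphismRestrict_ι, reassoc_of% hl, c.isPullback.w, Category.assoc]
  have h2 : FormallyUnramified ((g ≫ Spec.map (CommRingCat.ofHom (algebraMap c.B c.C))) ≫ c.b) := by
    rw [← h1]
    infer_instance
  have h3 := FormallyUnramified.of_comp
    (g ≫ Spec.map (CommRingCat.ofHom (algebraMap c.B c.C))) c.b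
  rw [← Spec.map_comp, HasRingHomProperty.Spec_iff (P := @FormallyUnramified)] at h3
  refine hC.not_formallyUnramified hn (algebraMap c.C (primeIdeal P).ResidueField) (a := a) ?_ ?_
    (Localization.Away a) ?_
  · exact Ideal.algebraMap_residueField_eq_zero.mpr hp
  · exact Ideal.algebraMap_residueField_eq_zero.not.mpr ha
  · rw [← RingHom.formallyUnramified_algebraMap]
    exact h3

lemma branchLocus_eq (hn : 2 ≤ n) (hG : GoodExponents n m k) (hπ : IsBlowup π centre) :
    branchLocus (S.toZ n m k π) = π ⁻¹' branchCurves := by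
  ext z
  constructor
  · exact fun hz ↦ by_contra fun hz' ↦ notMem_branchLocus (by lia) hπ hz' hz
  · intro hz
    obtain ⟨c, y, rfl⟩ := exists_localChart (by lia) hG hπ z
    rcases (c.mem_branchCurves_iff y).mp hz with h | h
    · exact c.mem_branchLocus hn y h
    · exact c.symm.mem_branchLocus hn y h

lemma isClosed_branchCurves : IsClosed branchCurves := by
  rw [← compl_compl branchCurves, ← range_chart]
  exact chart.isOpenEmbedding.isOpen_range.isClosed_compl

/-- The point of a chart which is generic on `s = 0`. -/
def LocalChart.generic (c : LocalChart π n m k) : Spec (CommRingCat.of c.B) :=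
  (⟨Ideal.span {c.s}, (Ideal.span_singleton_prime c.prime_s.ne_zero).mpr c.prime_s⟩ :
    PrimeSpectrum c.B)

lemma LocalChart.primeIdeal_generic (c : LocalChart π n m k) :
    primeIdeal c.generic = Ideal.span {c.s} := rfl

/-- `D` is contained in the closure of the generic point of `s = 0`, which is irreducible and lies
over the branch curves. By maximality the two sets are equal, hence so are their generic points. -/
lemma LocalChart.eq_generic (c : LocalChart π n m k) {D : Set Z}
    (hD : Maximal (fun T ↦ IsIrreducible T ∧ T ⊆ π ⁻¹' branchCurves) D)
    {y : Spec (CommRingCat.of c.B)} (hy : c.s ∈ primeIdeal y) (hη : IsGenericPoint (c.b y) D) :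
    y = c.generic := by
  have h1 : c.generic ⤳ y := by
    refine (PrimeSpectrum.le_iff_specializes _ _).mp ?_
    exact (Ideal.span_singleton_le_iff_mem _).mpr hy
  have h2 : c.b c.generic ⤳ c.b y := h1.map c.b.continuous
  have h3 : closure {c.b c.generic} ⊆ π ⁻¹' branchCurves := by
    refine closure_minimal (Set.singleton_subset_iff.mpr ?_)
      (isClosed_branchCurves.preimage π.continuous)
    exact (c.mem_branchCurves_iff _).mpr (Or.inl (Ideal.mem_span_singleton_self _))
  have h4 : D ⊆ closure {c.b c.generic} := by
    rw [← hη.def]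
    exact h2.closure_subset
  have h5 := hD.2 ⟨isIrreducible_singleton.closure, h3⟩ h4
  have h6 : c.b y ⤳ c.b c.generic := by
    rw [specializes_iff_mem_closure, hη.def]
    exact h5 (subset_closure rfl)
  exact c.b.isOpenEmbedding.injective (h6.antisymm h2).eq

/-- Since `(p)` is the only prime of `C` over `(s)`, there is exactly one point of `S` to consider,
and the local model gives its inertia generator. This is why the monodromy is independent of
choices. -/
lemma LocalChart.isLocalMonodromy_iff (c : LocalChart π n m k) (hn : 2 ≤ n) (g : ZMod n × ZMod n) :
    IsLocalMonodromy n m k π (c.b c.generic) g ↔ g = c.χ.symm (1, 0) := by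
  have : NeZero n := ⟨by lia⟩
  have hC := c.isLocalModel.isBikummer
  have hcomap (P : Spec (CommRingCat.of c.C)) :
      Spec.map (CommRingCat.ofHom (algebraMap c.B c.C)) P = c.generic ↔
        (primeIdeal P).comap (algebraMap c.B c.C) = Ideal.span {c.s} := by
    rw [← c.primeIdeal_generic]
    exact PrimeSpectrum.ext_iff
  have key (P : Spec (CommRingCat.of c.C)) (hP : primeIdeal P = Ideal.span {c.p}) :=
    c.isLocalModel.isInertiaGenerator_iff hn c.prime_p c.not_dvd c.κ c.comp_toPt c.comp_actS hP g
  constructor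
  · rintro ⟨ξ, hξ, hg⟩
    obtain ⟨P, rfl, hP⟩ := c.exists_of_toZ hξ
    exact (key P (hC.eq_span_fst (by lia) c.prime_p inferInstance ((hcomap P).mp hP))).mp hg
  · intro hg
    let P : Spec (CommRingCat.of c.C) :=
      (⟨Ideal.span {c.p}, (Ideal.span_singleton_prime c.prime_p.ne_zero).mpr c.prime_p⟩ :
        PrimeSpectrum c.C)
    refine ⟨c.κ P, ?_, (key P rfl).mpr hg⟩
    rw [← (hcomap P).mpr (hC.comap_span_fst (by lia))]
    exact congr($c.isPullback.w P)

lemma addOrderOf_symm_apply_one_zero (χ : ZMod n × ZMod n ≃+ ZMod n × ZMod n) :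
    addOrderOf (χ.symm (1, 0)) = n := by
  rw [AddEquiv.addOrderOf_eq, Prod.addOrderOf]
  simp [ZMod.addOrderOf_one]

lemma exists_localMonodromy (hn : 2 ≤ n) (hG : GoodExponents n m k) (hπ : IsBlowup π centre)
    {D : Set Z} (hD : Maximal (fun T ↦ IsIrreducible T ∧ T ⊆ branchLocus (S.toZ n m k π)) D)
    {η : Z} (hη : IsGenericPoint η D) :
    ∃ g : ZMod n × ZMod n, (∀ g', IsLocalMonodromy n m k π η g' ↔ g' = g) ∧ addOrderOf g = n := by
  rw [branchLocus_eq hn hG hπ] at hD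
  obtain ⟨c, y, rfl⟩ := exists_localChart (by lia) hG hπ η
  have key (c : LocalChart π n m k) (y : Spec (CommRingCat.of c.B)) (hη : IsGenericPoint (c.b y) D)
      (hs : c.s ∈ primeIdeal y) : ∃ g : ZMod n × ZMod n,
      (∀ g', IsLocalMonodromy n m k π (c.b y) g' ↔ g' = g) ∧ addOrderOf g = n := by
    obtain rfl := c.eq_generic hD hs hη
    exact ⟨_, c.isLocalMonodromy_iff hn, addOrderOf_symm_apply_one_zero _⟩
  -- If `η` lies on `t = 0` instead of `s = 0`, the chart with interchanged coordinates reduces to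
  -- the first case.
  rcases (c.mem_branchCurves_iff y).mp (hD.1.2 hη.mem) with h | h
  · exact key c y hη h
  · exact key c.symm y hη h

end AbelianCover

end

theorem mainTheorem8 (n : ℕ) (m : Fin 4 → ℕ) (k : Fin 3 → ℕ) (hn : 5 ≤ n) (hn6 : n.Coprime 6)
    (hm : ∀ j, 1 ≤ m j ∧ m j ≤ n - 1) (hk : ∀ i, 1 ≤ k i ∧ k i ≤ n - 1)
    (hm_sum : ∑ j, m j = n) (hk_sum : ∑ i, k i = n)
    (hm_unit : ∀ j, (m j).Coprime n) (hk_unit : ∀ i, (k i).Coprime n)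
    (hm3_unit : ∀ i : Fin 3, (m i.castSucc + m 3).Coprime n)
    (Z : Scheme.{0}) (π : Z ⟶ AbelianCover.P1xP1)
    (hπ : AbelianCover.IsBlowup π AbelianCover.centre) :
    IsIntegral (AbelianCover.S n m k π) ∧
    SmoothOfRelativeDimension 2 (AbelianCover.S.toPt n m k π) ∧
    AbelianCover.branchLocus (AbelianCover.S.toZ n m k π) = π ⁻¹' AbelianCover.branchCurves ∧
    ∀ D : Set Z,
      Maximal (fun T => IsIrreducible T ∧
        T ⊆ AbelianCover.branchLocus (AbelianCover.S.toZ n m k π)) D →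
      ∀ η : Z, IsGenericPoint η D →
        ∃ g : ZMod n × ZMod n,
          (∀ g', AbelianCover.IsLocalMonodromy n m k π η g' ↔ g' = g) ∧ addOrderOf g = n := by
  have hG : AbelianCover.GoodExponents n m k := ⟨hm_sum, hk_sum, hm_unit, hk_unit, hm3_unit⟩
  exact ⟨AbelianCover.isIntegral_S (by lia) hG hπ, AbelianCover.smooth_S (by lia) hG hπ,
    AbelianCover.branchLocus_eq (by lia) hG hπ,
    fun D hD η hη ↦ AbelianCover.exists_localMonodromy (by lia) hG hπ hD hη⟩
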